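/- Let $(T,r)$ and $(T',r')$ be finite rooted trees of orders $n$ and $n'$; an isomorphism between them is a graph isomorphism that maps $r$ to $r'$. The height of a rooted tree is the maximal length of a path starting at the root, the level of a vertex $v$ is the height minus the distance from the root to $v$, and $T_i$ is the set of vertices of level $i$; a leaf is a vertex of degree at most one. Tuples of integers are ordered lexicographically, a proper prefix being smaller. The algorithm AHU works with lists $L$, $L'$ of vertex-label pairs. If the heights of $T$ and $T'$ differ, it returns False. Otherwise let $h$ be the common height; start with empty $L$, $L'$, and for $i=0,1,\dots,h$ do the following. 1. CreateLabels: replace $L$ by the list obtained by first listing $(v,())$ for every leaf $v\in T_i$, and then, for each pair $(v,k)$ of the old $L$ in order, appending $k$ to the label of the parent $p$ of $v$ if $p$ is already listed, and appending the new pair $(p,(k))$ otherwise. Do the same with $L'$ and $T'_i$. 2. LEXsort: rearrange $L$, and also $L'$, so that the labels are in lexicographical order. 3. If the sequences of labels of $L$ and $L'$ differ, return False. 4. CondenseLabels: replace the labels of $L$ in order by integers, starting with $0$ and increasing by one whenever the label differs from the preceding one; give the labels of $L'$ the same integers. If the loop is completed, return True. **Theorem.** (a) Whatever the order in which the vertices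 of each level are listed, and however the sorting orders pairs with equal labels, AHU returns True if and only if $(T,r)$ and $(T',r')$ are isomorphic. (b) AHU can be implemented in linear time: there are a constant $C$ and a single program for a unit-cost random access machine (integer variables and arrays, with indirect addressing, comparison, and addition and subtraction of $1$ as the only arithmetic) such that, for all rooted trees $T$ on $\{0,\dots,n-1\}$ and $T'$ on $\{0,\dots,n'-1\}$ given by their orders, roots and adjacency lists in arbitrary order, the program executes AHU on $T$ and $T'$ and halts with the value returned by AHU after at most $C\,(n+n')$ steps. Here "executes AHU" means that, for some listing of the levels and some order of pairs with equal labels, the memory of the machine holds, at successive times and in a fixed layout, the heights and the lists of the levels $T_i$, $T'_i$, and then, in each iteration that AHU carries out, the values of $i$, $L$ and $L'$ after step 1, after step 2 and (if reached) after step 4. -/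

import Mathlib

namespace AHU

universe u v

/-! ### Rooted trees -/

/-- A rooted tree on the vertex set `V`. -/
structure RTree (V : Type u) where
  graph : SimpleGraph V
  isTree : graph.IsTree
  root : V

/-- Isomorphism of rooted trees: a graph isomorphism that maps root to root. -/
def Isomorphic {V : Type u} {V' : Type v} (T : RTree V) (T' : RTree V') : Prop :=
  ∃ φ : T.graph ≃g T'.graph, φ T.root = T'.root

namespace RTree

variable {V : Type u} (T : RTree V)

/-- The unique path from the root to `v`. -/
noncomputable def pathTo (v : V) : T.graph.Walk T.root v :=
  (T.isTree.existsUnique_path T.root v).choose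

/-- The parent of `v`: the vertex before `v` on the path from the root to `v`
(for the root itself, which has no parent, the value is the root). -/
noncomputable def parent (v : V) : V := (T.pathTo v).penultimate

/-- A leaf is a vertex of degree zero or one. -/
def IsLeaf (v : V) : Prop := (T.graph.neighborSet v).encard ≤ 1

/-- The height: the maximal length of a path that starts at the root. -/
noncomputable def height [Fintype V] : ℕ :=
  Finset.univ.sup fun v => (T.pathTo v).length

/-- The level of `v`: the height minus the distance from the root (never truncated). -/
noncomputable def level [Fintype V] (v : V) : ℕ :=
  T.height - T.graph.dist T.root v

end RTree

/-! ### The algorithm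

Lists of vertex-label pairs are lists in `V × List ℕ` (tuple labels) or `V × ℕ` (condensed
labels). -/

section Algorithm

variable {V : Type u} {V' : Type v}

/-- The level sets `T_i`, each listed without repetition, in an arbitrary order. -/
structure LevelLists [Fintype V] (T : RTree V) where
  list : ℕ → List V
  nodup : ∀ i, (list i).Nodup
  mem_iff : ∀ i w, w ∈ list i ↔ T.level w = i

/-- A routine that rearranges lists of vertex-label pairs so that the labels are in
lexicographical order. Nothing is prescribed about pairs with equal labels. -/
structure LexSort (V : Type u) where
  sort : List (V × List ℕ) → List (V × List ℕ)
  perm : ∀ L, (sort L).Perm L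
  sorted : ∀ L, (sort L).Pairwise fun a b => a.2 ≤ b.2

/-- Append `k` to the label of `p` if `p` occurs in the list, otherwise append the new
pair `(p, [k])`. -/
def appendLabel [DecidableEq V] (L : List (V × List ℕ)) (p : V) (k : ℕ) :
    List (V × List ℕ) :=
  if p ∈ L.map Prod.fst then
    L.map fun q => if q.1 = p then (q.1, q.2 ++ [k]) else q
  else L ++ [(p, [k])]

open Classical in
/-- The subroutine `CreateLabels`; `W` lists the vertices of the level to be labelled, `L` the
vertices of the level below with their integer labels. -/
noncomputable def createLabels (T : RTree V) (L : List (V × ℕ)) (W : List V) :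
    List (V × List ℕ) :=
  L.foldl (fun M q => appendLabel M (T.parent q.1) q.2)
    ((W.filter fun w => decide (T.IsLeaf w)).map fun w => (w, []))

/-- The loop of `CondenseLabels`, with current values of `prevInt` and `prevLabel`. -/
def condenseAux : ℕ → List ℕ → List (V × List ℕ) → List (V × ℕ)
  | _, _, [] => []
  | prevInt, prevLabel, (w, l) :: L =>
    if l ≠ prevLabel then (w, prevInt + 1) :: condenseAux (prevInt + 1) l L
    else (w, prevInt) :: condenseAux prevInt prevLabel L

/-- The subroutine `CondenseLabels`. -/
def condenseLabels : List (V × List ℕ) → List (V × ℕ)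
  | [] => []
  | (w, l) :: L => condenseAux 0 l ((w, l) :: L)

/-- The points of an execution of the algorithm at which its variables are recorded. -/
inductive Stage (V : Type u) (V' : Type v)
  /-- the level lists have been computed -/
  | preprocessed
  /-- the labels of level `lvl` have been created -/
  | created (lvl : ℕ) (L : List (V × List ℕ)) (L' : List (V' × List ℕ))
  /-- the labels of level `lvl` have been sorted -/
  | sorted (lvl : ℕ) (L : List (V × List ℕ)) (L' : List (V' × List ℕ))
  /-- the labels of level `lvl` have been found to agree and have been condensed -/
  | condensed (lvl : ℕ) (L : List (V × ℕ)) (L' : List (V' × ℕ))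

variable [Fintype V] [Fintype V'] (T : RTree V) (T' : RTree V')
  (lv : LevelLists T) (lv' : LevelLists T') (ls : LexSort V) (ls' : LexSort V')

/-- The `for`-loop of the algorithm. The first argument is the number of iterations left, `lvl`
the loop variable, and `L`, `L'` the condensed lists of the previous iteration. The
value is the list of the stages passed through, and the value returned by the algorithm.
The lists are compared by their labels only, the vertices being satellite data; when they agree,
the condensed labels of `L` become those of `L'` as well. -/
noncomputable def loop : ℕ → ℕ → List (V × ℕ) → List (V' × ℕ) → List (Stage V V') × Bool
  | 0, _, _, _ => ([], true)
  | k + 1, lvl, L, L' =>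
    let A := createLabels T L (lv.list lvl)
    let A' := createLabels T' L' (lv'.list lvl)
    let M := ls.sort A
    let M' := ls'.sort A'
    if M.map Prod.snd ≠ M'.map Prod.snd then
      ([.created lvl A A', .sorted lvl M M'], false)
    else
      let K := condenseLabels M
      let K' := (M'.map Prod.fst).zip (K.map Prod.snd)
      let rest := loop k (lvl + 1) K K'
      (.created lvl A A' :: .sorted lvl M M' :: .condensed lvl K K' :: rest.1, rest.2)

/-- The whole algorithm: the stages passed through, and the value returned. -/
noncomputable def run : List (Stage V V') × Bool :=
  if T.height ≠ T'.height then ([.preprocessed], false)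
  else
    let r := loop T T' lv lv' ls ls' (T.height + 1) 0 [] []
    (.preprocessed :: r.1, r.2)

/-- The successive stages of the execution of the algorithm on `T` and `T'`. -/
noncomputable def stages : List (Stage V V') := (run T T' lv lv' ls ls').1

/-- The value that the algorithm returns on `T` and `T'`. -/
noncomputable def output : Bool := (run T T' lv lv' ls ls').2

end Algorithm

/-! ### The machine

A unit-cost random access machine, programmed by structured commands. The memory consists of
numbered integer variables and numbered integer arrays; a program mentions finitely many of them.
The only arithmetic is adding or subtracting one, so that after `t` steps no number in
memory exceeds the largest number in the input and the program by more than `t`. -/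

/-- The memory. -/
structure Mem where
  var : ℕ → ℕ
  arr : ℕ → ℕ → ℕ

/-- Tests: comparison of two variables. -/
inductive Test
  | lt (x y : ℕ)
  | eq (x y : ℕ)

def Test.eval (s : Mem) : Test → Bool
  | .lt x y => decide (s.var x < s.var y)
  | .eq x y => decide (s.var x = s.var y)

/-- Commands. -/
inductive Cmd
  /-- do nothing -/
  | skip
  /-- `x := n` -/
  | const (x n : ℕ)
  /-- `x := y` -/
  | copy (x y : ℕ)
  /-- `x := x + 1` -/
  | succ (x : ℕ)
  /-- `x := x - 1` (zero stays zero) -/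
  | pred (x : ℕ)
  /-- `x := a[i]`, where `i` is a variable -/
  | load (x a i : ℕ)
  /-- `a[i] := x`, where `i` is a variable -/
  | store (a i x : ℕ)
  /-- `c; d` -/
  | seq (c d : Cmd)
  /-- `if b then c else d` -/
  | ite (b : Test) (c d : Cmd)
  /-- `while b do c` -/
  | loop (b : Test) (c : Cmd)

def Mem.setVar (s : Mem) (x n : ℕ) : Mem :=
  { s with var := Function.update s.var x n }

def Mem.setArr (s : Mem) (a i n : ℕ) : Mem :=
  { s with arr := Function.update s.arr a (Function.update (s.arr a) i n) }

/-- A configuration: the commands still to be executed, and the memory. -/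
structure Config where
  todo : List Cmd
  mem : Mem

/-- One step of the machine. A configuration with nothing left to execute has halted. -/
def step : Config → Config
  | ⟨[], s⟩ => ⟨[], s⟩
  | ⟨.skip :: k, s⟩ => ⟨k, s⟩
  | ⟨.const x n :: k, s⟩ => ⟨k, s.setVar x n⟩
  | ⟨.copy x y :: k, s⟩ => ⟨k, s.setVar x (s.var y)⟩
  | ⟨.succ x :: k, s⟩ => ⟨k, s.setVar x (s.var x + 1)⟩
  | ⟨.pred x :: k, s⟩ => ⟨k, s.setVar x (s.var x - 1)⟩
  | ⟨.load x a i :: k, s⟩ => ⟨k, s.setVar x (s.arr a (s.var i))⟩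
  | ⟨.store a i x :: k, s⟩ => ⟨k, s.setArr a (s.var i) (s.var x)⟩
  | ⟨.seq c d :: k, s⟩ => ⟨c :: d :: k, s⟩
  | ⟨.ite b c d :: k, s⟩ => ⟨(if b.eval s then c else d) :: k, s⟩
  | ⟨.loop b c :: k, s⟩ => if b.eval s then ⟨c :: .loop b c :: k, s⟩ else ⟨k, s⟩

/-- The configuration after `t` steps of the program `P` on the initial memory `s`. -/
def after (P : Cmd) (s : Mem) (t : ℕ) : Config := step^[t] ⟨[P], s⟩

/-! ### Input and representation in memory -/

/-- Adjacency lists of a graph with vertices `0, …, n - 1`, each in an arbitrary order. -/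
structure AdjLists {n : ℕ} (G : SimpleGraph (Fin n)) where
  nbrs : Fin n → List (Fin n)
  nodup : ∀ w, (nbrs w).Nodup
  mem_iff : ∀ w x, x ∈ nbrs w ↔ G.Adj w x

namespace AdjLists

variable {n : ℕ} {G : SimpleGraph (Fin n)} (A : AdjLists G)

/-- The concatenation of all adjacency lists. -/
def flat : List ℕ := (List.finRange n).flatMap fun w => (A.nbrs w).map Fin.val

/-- The `n + 1` positions in the concatenation at which the adjacency lists
of `0, …, n - 1` begin, and its end. -/
def offsets : List ℕ :=
  (List.range (n + 1)).map fun i =>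
    (((List.finRange n).take i).map fun w => (A.nbrs w).length).sum

end AdjLists

/-- The initial memory: variables `0`, `1` hold the order and the root of the first tree,
arrays `0`, `1` its offsets and concatenated adjacency lists; variables `2`, `3` and
arrays `2`, `3` hold the same for the second tree. Everything else is zero. -/
def inputMem {n n' : ℕ} (T : RTree (Fin n)) (T' : RTree (Fin n'))
    (A : AdjLists T.graph) (A' : AdjLists T'.graph) : Mem where
  var x := [n, T.root.val, n', T'.root.val].getD x 0
  arr a i := ([A.offsets, A.flat, A'.offsets, A'.flat].getD a []).getD i 0

/-- Where a program keeps the data of one of the two trees. -/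
structure Layout where
  /-- variable: the height -/
  height : ℕ
  /-- arrays: start and length of the list of each level, and the array of these lists -/
  lvlStart : ℕ
  lvlLen : ℕ
  lvlData : ℕ
  /-- variable: the length of the current list of vertex-label pairs -/
  size : ℕ
  /-- array: the vertices of the current list, in order -/
  verts : ℕ
  /-- arrays: start and length of the tuple label of each vertex, and the array of these tuples -/
  tupStart : ℕ
  tupLen : ℕ
  tupData : ℕ
  /-- array: the integer label of each vertex -/
  int : ℕ

namespace Layout

variable {n : ℕ} (l : Layout) (s : Mem)

/-- The slice of length `xs.length` that begins at position `p` of array `a` is `xs`. -/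
def IsSlice (s : Mem) (a p : ℕ) (xs : List ℕ) : Prop :=
  ∀ (j : ℕ) (hj : j < xs.length), s.arr a (p + j) = xs[j]

/-- The memory holds the height and the level lists of `T`. -/
def HoldsLevels (T : RTree (Fin n)) (lv : LevelLists T) : Prop :=
  s.var l.height = T.height ∧ ∀ i ≤ T.height,
    s.arr l.lvlLen i = (lv.list i).length ∧
    IsSlice s l.lvlData (s.arr l.lvlStart i) ((lv.list i).map Fin.val)

/-- The memory holds the list `L` of vertices with tuple labels. -/
def HoldsTuples (L : List (Fin n × List ℕ)) : Prop :=
  s.var l.size = L.length ∧ IsSlice s l.verts 0 (L.map fun q => q.1.val) ∧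
    ∀ q ∈ L, s.arr l.tupLen q.1 = q.2.length ∧
      IsSlice s l.tupData (s.arr l.tupStart q.1) q.2

/-- The memory holds the list `L` of vertices with integer labels. -/
def HoldsInts (L : List (Fin n × ℕ)) : Prop :=
  s.var l.size = L.length ∧ IsSlice s l.verts 0 (L.map fun q => q.1.val) ∧
    ∀ q ∈ L, s.arr l.int q.1 = q.2

end Layout

/-- The memory `s` holds the values of the variables of the algorithm at the given stage; the
variable `x` of the machine holds the loop variable. -/
def HoldsStage {n n' : ℕ} {T : RTree (Fin n)} {T' : RTree (Fin n')} (lv : LevelLists T)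
    (lv' : LevelLists T') (l l' : Layout) (x : ℕ) (s : Mem) : Stage (Fin n) (Fin n') → Prop
  | .preprocessed => l.HoldsLevels s T lv ∧ l'.HoldsLevels s T' lv'
  | .created i L L' => s.var x = i ∧ l.HoldsTuples s L ∧ l'.HoldsTuples s L'
  | .sorted i L L' => s.var x = i ∧ l.HoldsTuples s L ∧ l'.HoldsTuples s L'
  | .condensed i L L' => s.var x = i ∧ l.HoldsInts s L ∧ l'.HoldsInts s L'

/-- The program `P`, with its data laid out as `l`, `l'`, `x` say, executes the algorithm on `T` and
`T'`, given by the adjacency lists `A` and `A'`, in at most `N` steps: for some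
listing of the levels and some sorting routines, the run of `P` passes
through memories that hold the successive stages of the algorithm, and halts within `N` steps with
the returned value (`1` for true, `0` for false) in variable `0`. -/
def Executes (P : Cmd) (l l' : Layout) (x : ℕ) {n n' : ℕ} (T : RTree (Fin n))
    (T' : RTree (Fin n')) (A : AdjLists T.graph) (A' : AdjLists T'.graph) (N : ℕ) : Prop :=
  ∃ (lv : LevelLists T) (lv' : LevelLists T') (ls : LexSort (Fin n)) (ls' : LexSort (Fin n'))
    (t : ℕ) (τ : Fin (stages T T' lv lv' ls ls').length → ℕ),
    t ≤ N ∧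
    (after P (inputMem T T' A A') t).todo = [] ∧
    (after P (inputMem T T' A A') t).mem.var 0 = (output T T' lv lv' ls ls').toNat ∧
    StrictMono τ ∧
    ∀ i, τ i ≤ t ∧ HoldsStage lv lv' l l' x (after P (inputMem T T' A A') (τ i)).mem
      ((stages T T' lv lv' ls ls').get i)

end AHU

/-! Correctness. Suppose the vertices of the level below are listed by nondecreasing integers. Then
the tuple that `createLabels` gives to a vertex is the nondecreasing list of the integers of its
children (`createLabels_eq`), so it encodes exactly their multiset. On a sorted list,
`condenseLabels` replaces each tuple by its rank in the set of tuples present (`condenseLabels_eq`).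
The ranks depend only on the sequence of labels and are injective on it, so two trees with the same
sequence are given comparable integers. Going up the levels, equal integers in the two trees mean
isomorphic subtrees: equal tuples pair the children by position (`subtreeIso_of_lab_eq`). At the
roots this yields an isomorphism, assembled from the root downwards (`isomorphic_of_subtreeIso`).
Conversely, an isomorphism carries the list of the first tree to a permutation of the list of the
second on every level, and sorted lists that are permutations of each other coincide, so no
comparison fails (`loop_eq_true`). Neither argument depends on the listing of the levels or on the
order of ties.

Running time. Preprocessing is a breadth first search. An iteration costs a constant multiple of the
sizes of its level and of the level below, plus a constant; as the levels partition the vertices and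
the height is less than the order, the sum is linear. This rests on the following points. The label
of a vertex is stored in a block with as many cells as its adjacency list has entries. Labels are no
longer than that (`IsLevelList.length_lab_le`), so blocks never overflow and nothing has to be
moved. For sorting, the vertices of a level descend a trie while the list of the level below is
read. Keys arrive in nondecreasing order, so the child wanted at a node is either its last child or
a new one, and is found in constant time. Nodes are kept in a linked list by decreasing labels,
together with a token for each node that stands ahead of all its descendants; a new child is spliced
in directly after the token (`Trie.insert`). Emptying the buckets of the nodes along this list
produces the stable sort. Two labels are equal exactly if the vertices have reached the same node,
so condensing takes constant time per vertex. Comparing the trees costs the total length of the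
labels, which is the size of the level below (`sum_length_lab`).

The program is verified with a big-step semantics that counts steps. The command `skip` is reserved
as a marker of the moments at which a stage is recorded. The code for one tree is written once and
run twice, with renamed registers. -/

namespace AHU

universe u v

open SimpleGraph

/-! ### Depth, parents and children in a rooted tree -/

namespace RTree

variable {V : Type u} (T : RTree V)

/-- The distance from the root. -/
noncomputable def depth (v : V) : ℕ := T.graph.dist T.root v

/-- `w` is a child of `v`. -/
def IsChild (w v : V) : Prop := w ≠ T.root ∧ T.parent w = v

theorem eq_pathTo {v : V} {p : T.graph.Walk T.root v} (hp : p.IsPath) : p = T.pathTo v :=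
  (T.isTree.existsUnique_path T.root v).choose_spec.2 p hp

/-- Some path realizes the distance, and there is only one path. -/
theorem pathTo_length (v : V) : (T.pathTo v).length = T.depth v := by
  obtain ⟨p, hp, hl⟩ := T.isTree.connected.exists_path_of_dist T.root v
  rw [← T.eq_pathTo hp, hl, depth]

@[simp] theorem depth_root : T.depth T.root = 0 := by simp [depth]

theorem depth_eq_zero {v : V} : T.depth v = 0 ↔ v = T.root := by
  rw [depth, T.isTree.connected.dist_eq_zero_iff, eq_comm]

@[simp] theorem parent_root : T.parent T.root = T.root := by
  have h : (Walk.nil : T.graph.Walk T.root T.root) = T.pathTo T.root := T.eq_pathTo .nil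
  rw [parent, ← h, Walk.penultimate_nil]

variable {T}

/-- The path to `v`, prolonged by the edge, has the length of a geodesic. Hence it is a path, and so
it is the path to `w`. -/
theorem parent_of_adj {v w : V} (h : T.graph.Adj v w) (hd : T.depth w = T.depth v + 1) :
    T.parent w = v := by
  have hp : ((T.pathTo v).concat h).IsPath := by
    apply Walk.isPath_of_length_eq_dist
    rw [Walk.length_concat, pathTo_length, ← hd, depth]
  rw [parent, ← T.eq_pathTo hp, Walk.penultimate_concat]

theorem adj_parent {v : V} (hv : v ≠ T.root) : T.graph.Adj (T.parent v) v :=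
  Walk.adj_penultimate (Walk.not_nil_of_ne hv.symm)

/-- Dropping the last edge of the path bounds the depth of the parent from above; along an edge of a
tree the distance from the root changes by exactly one. -/
theorem depth_parent {v : V} (hv : v ≠ T.root) : T.depth v = T.depth (T.parent v) + 1 := by
  have hle : T.depth (T.parent v) ≤ T.depth v - 1 := by
    refine (dist_le (T.pathTo v).dropLast).trans_eq ?_
    rw [← pathTo_length]
    have ha : T.graph.Adj (T.pathTo v).penultimate v := adj_parent hv
    have := congrArg Walk.length (Walk.concat_dropLast ha)
    rw [Walk.length_concat] at this
    omega
  have := T.isTree.dist_eq_dist_add_one_of_adj T.root (adj_parent hv)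
  have hpos : T.depth v ≠ 0 := fun h => hv (T.depth_eq_zero.1 h)
  unfold depth at *
  omega

theorem isChild_iff {w v : V} :
    T.IsChild w v ↔ T.graph.Adj v w ∧ T.depth w = T.depth v + 1 := by
  constructor
  · rintro ⟨hw, rfl⟩
    exact ⟨adj_parent hw, depth_parent hw⟩
  · rintro ⟨h, hd⟩
    refine ⟨?_, parent_of_adj h hd⟩
    rintro rfl
    simp at hd

theorem adj_iff {v w : V} : T.graph.Adj v w ↔ T.IsChild v w ∨ T.IsChild w v := by
  constructor
  · intro h
    rcases T.isTree.dist_eq_dist_add_one_of_adj T.root h with hd | hd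
    · exact Or.inl (isChild_iff.2 ⟨h.symm, hd⟩)
    · exact Or.inr (isChild_iff.2 ⟨h, hd⟩)
  · rintro (h | h)
    · exact (isChild_iff.1 h).1.symm
    · exact (isChild_iff.1 h).1

/-- This is the test made by the breadth first search. The convention that the root is its own
parent keeps it valid at the root. -/
theorem isChild_iff_adj_ne {w v : V} :
    T.IsChild w v ↔ T.graph.Adj v w ∧ w ≠ T.parent v := by
  constructor
  · intro h
    obtain ⟨ha, hd⟩ := isChild_iff.1 h
    refine ⟨ha, ?_⟩
    rintro rfl
    by_cases hv : v = T.root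
    · subst hv
      simp at hd
    · have := depth_parent hv
      omega
  · rintro ⟨h, hne⟩
    rcases adj_iff.1 h with h' | h'
    · exact absurd h'.2.symm hne
    · exact h'

theorem isChild_parent {v : V} (hv : v ≠ T.root) : T.IsChild v (T.parent v) := ⟨hv, rfl⟩

theorem IsChild.depth {w v : V} (h : T.IsChild w v) : T.depth w = T.depth v + 1 :=
  (isChild_iff.1 h).2

/-- Of two distinct neighbours at most one is the parent. The converse fails for a root of degree
one, which counts as a leaf but has a child; such a root is merely listed from the start, with the
empty label. -/
theorem exists_isChild_of_not_isLeaf {v : V} (h : ¬ T.IsLeaf v) : ∃ w, T.IsChild w v := by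
  rw [IsLeaf, not_le, Set.one_lt_encard_iff] at h
  obtain ⟨a, b, ha, hb, hab⟩ := h
  by_cases h1 : a = T.parent v
  · exact ⟨b, isChild_iff_adj_ne.2 ⟨hb, fun h2 => hab (h1.trans h2.symm)⟩⟩
  · exact ⟨a, isChild_iff_adj_ne.2 ⟨ha, h1⟩⟩

variable [Fintype V]

theorem depth_le_height (v : V) : T.depth v ≤ T.height := by
  rw [← pathTo_length]
  exact Finset.le_sup (f := fun v => (T.pathTo v).length) (Finset.mem_univ v)

theorem exists_depth_eq_height : ∃ v, T.depth v = T.height := by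
  obtain ⟨v, -, hv⟩ := Finset.exists_mem_eq_sup Finset.univ ⟨T.root, Finset.mem_univ _⟩
    (fun v => (T.pathTo v).length)
  exact ⟨v, by rw [← pathTo_length]; exact hv.symm⟩

theorem level_add_depth (v : V) : T.level v + T.depth v = T.height :=
  Nat.sub_add_cancel (depth_le_height v)

theorem level_eq_height {v : V} : T.level v = T.height ↔ v = T.root := by
  rw [← depth_eq_zero]
  have := level_add_depth (T := T) v
  omega

theorem level_root : T.level T.root = T.height := level_eq_height.2 rfl

theorem IsChild.level {w v : V} (h : T.IsChild w v) : T.level v = T.level w + 1 := by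
  have := h.depth
  have := level_add_depth (T := T) v
  have := level_add_depth (T := T) w
  omega

theorem level_parent {v : V} {i : ℕ} (h : T.level v = i) (hi : i < T.height) :
    T.IsChild v (T.parent v) ∧ T.level (T.parent v) = i + 1 := by
  have hv : v ≠ T.root := by
    rintro rfl
    rw [level_root] at h
    omega
  exact ⟨isChild_parent hv, by rw [(isChild_parent hv).level, h]⟩

end RTree

end AHU

namespace AHU

universe u v

/-! ### Closed form of the creation of labels -/

section Create

variable {V : Type u} (T : RTree V)

open Classical in
/-- The label that the list `L` of the vertices of a level produces for `v`. -/
noncomputable def lab (L : List (V × ℕ)) (v : V) : List ℕ :=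
  (L.filter fun q => decide (T.parent q.1 = v)).map Prod.snd

open Classical in
/-- The list `o`, extended by the parents of the vertices of `L` in order of first appearance. -/
noncomputable def parentOrder (o : List V) (L : List (V × ℕ)) : List V :=
  L.foldl (fun o q => if T.parent q.1 ∈ o then o else o ++ [T.parent q.1]) o

open Classical in
/-- The leaves in the list `W`. -/
noncomputable def leaves (W : List V) : List V := W.filter fun w => decide (T.IsLeaf w)

open Classical in
theorem parentOrder_concat (o : List V) (L : List (V × ℕ)) (q : V × ℕ) :
    parentOrder T o (L ++ [q]) =
      if T.parent q.1 ∈ parentOrder T o L then parentOrder T o L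
      else parentOrder T o L ++ [T.parent q.1] := by
  rw [parentOrder, List.foldl_append]
  rfl

open Classical in
theorem lab_concat (L : List (V × ℕ)) (q : V × ℕ) (v : V) :
    lab T (L ++ [q]) v = if T.parent q.1 = v then lab T L v ++ [q.2] else lab T L v := by
  by_cases h : T.parent q.1 = v <;> simp [lab, List.filter_append, h]

@[simp] theorem lab_nil (v : V) : lab T [] v = [] := rfl

theorem mem_parentOrder (o : List V) (L : List (V × ℕ)) (v : V) :
    v ∈ parentOrder T o L ↔ v ∈ o ∨ ∃ q ∈ L, T.parent q.1 = v := by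
  induction L using List.reverseRecOn generalizing v with
  | nil => simp [parentOrder]
  | append_singleton L q ih =>
    rw [parentOrder_concat]
    split_ifs with h
    · rw [ih]
      rw [ih] at h
      constructor
      · rintro (h' | ⟨q', hq', h'⟩)
        · exact Or.inl h'
        · exact Or.inr ⟨q', by simp [hq'], h'⟩
      · rintro (h' | ⟨q', hq', rfl⟩)
        · exact Or.inl h'
        · rcases List.mem_append.1 hq' with h2 | h2
          · exact Or.inr ⟨q', h2, rfl⟩
          · rw [List.mem_singleton] at h2
            rw [h2]
            exact h
    · rw [List.mem_append, ih]
      constructor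
      · rintro ((h' | ⟨q', hq', h'⟩) | h')
        · exact Or.inl h'
        · exact Or.inr ⟨q', by simp [hq'], h'⟩
        · exact Or.inr ⟨q, by simp, (List.mem_singleton.1 h').symm⟩
      · rintro (h' | ⟨q', hq', rfl⟩)
        · exact Or.inl (Or.inl h')
        · rcases List.mem_append.1 hq' with h2 | h2
          · exact Or.inl (Or.inr ⟨q', h2, rfl⟩)
          · rw [List.mem_singleton] at h2
            subst h2
            exact Or.inr (by simp)

theorem nodup_parentOrder {o : List V} (ho : o.Nodup) (L : List (V × ℕ)) :
    (parentOrder T o L).Nodup := by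
  induction L using List.reverseRecOn with
  | nil => exact ho
  | append_singleton L q ih =>
    rw [parentOrder_concat]
    split_ifs with h
    · exact ih
    · rw [List.nodup_append]
      refine ⟨ih, List.nodup_singleton _, ?_⟩
      intro a ha b hb hab
      rw [List.mem_singleton] at hb
      exact h (hb ▸ hab ▸ ha)

theorem lab_eq_nil {o : List V} {L : List (V × ℕ)} {v : V} (h : v ∉ parentOrder T o L) :
    lab T L v = [] := by
  rw [mem_parentOrder] at h
  push Not at h
  simp only [lab, List.map_eq_nil_iff, List.filter_eq_nil_iff]
  intro q hq
  simpa using h.2 q hq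

/-- Induction from the end of `L` follows the left fold. A parent that is not yet listed has had no
child before, so its label so far is empty, and both branches of `appendLabel` amount to appending
the integer. -/
theorem createLabels_eq (L : List (V × ℕ)) (W : List V) :
    createLabels T L W =
      (parentOrder T (leaves T W) L).map fun v => (v, lab T L v) := by
  classical
  induction L using List.reverseRecOn with
  | nil => simp [createLabels, parentOrder, leaves]
  | append_singleton L q ih =>
    -- `createLabels` uses classical decidable equality, so the instance is named explicitly.
    have hstep : createLabels T (L ++ [q]) W =
        @appendLabel V (fun a b => Classical.propDecidable (a = b)) (createLabels T L W)
          (T.parent q.1) q.2 := by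
      simp [createLabels, List.foldl_append]
    rw [hstep, ih, appendLabel, parentOrder_concat]
    have hmap : ((parentOrder T (leaves T W) L).map fun v => (v, lab T L v)).map Prod.fst =
        parentOrder T (leaves T W) L := by
      simp [List.map_map, Function.comp_def]
    rw [hmap]
    split_ifs with h
    · rw [List.map_map]
      apply List.map_congr_left
      intro v _
      simp only [Function.comp_apply, lab_concat]
      by_cases hv : v = T.parent q.1
      · simp [hv]
      · rw [if_neg hv, if_neg (Ne.symm hv)]
    · rw [List.map_append]
      congr 1
      · apply List.map_congr_left
        intro v hv
        rw [lab_concat, if_neg]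
        rintro rfl
        exact h hv
      · simp [lab_concat, lab_eq_nil T h]

end Create

/-! ### Condensed labels are ranks -/

section Condense

variable {V : Type u}

/-- The number of elements of `S` below `l`. -/
def rank (S : Finset (List ℕ)) (l : List ℕ) : ℕ := (S.filter (· < l)).card

theorem rank_lt_rank {S : Finset (List ℕ)} {l m : List ℕ} (hl : l ∈ S) (h : l < m) :
    rank S l < rank S m := by
  apply Finset.card_lt_card
  rw [Finset.ssubset_iff_of_subset]
  · exact ⟨l, by simp [hl, h], by simp⟩
  · intro x hx
    simp only [Finset.mem_filter] at hx ⊢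
    exact ⟨hx.1, hx.2.trans h⟩

theorem rank_le_rank {S : Finset (List ℕ)} {l m : List ℕ} (h : l ≤ m) : rank S l ≤ rank S m := by
  apply Finset.card_le_card
  intro x hx
  simp only [Finset.mem_filter] at hx ⊢
  exact ⟨hx.1, hx.2.trans_le h⟩

theorem rank_inj {S : Finset (List ℕ)} {l m : List ℕ} (hl : l ∈ S) (hm : m ∈ S)
    (h : rank S l = rank S m) : l = m := by
  rcases lt_trichotomy l m with h' | h' | h'
  · exact absurd h (rank_lt_rank hl h').ne
  · exact h'
  · exact absurd h (rank_lt_rank hm h').ne'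

/-- The counter of the loop is the rank of the previous label `p`. The last hypothesis says that the
elements of `S` above `p` are still to come; hence, when the label changes to `l`, the elements
below `l` are `p` and those below `p`, and the rank grows by exactly one. -/
theorem condenseAux_eq (S : Finset (List ℕ)) (M : List (V × List ℕ)) :
    ∀ p : List ℕ, p ∈ S → M.Pairwise (fun a b => a.2 ≤ b.2) → (∀ q ∈ M, p ≤ q.2) →
      (∀ q ∈ M, q.2 ∈ S) → (∀ l ∈ S, l ≤ p ∨ l ∈ M.map Prod.snd) →
      condenseAux (rank S p) p M = M.map fun q => (q.1, rank S q.2) := by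
  induction M with
  | nil => intros; rfl
  | cons q M ih =>
    intro p hp hsort hle hS hcov
    obtain ⟨w, l⟩ := q
    rw [List.pairwise_cons] at hsort
    rw [condenseAux]
    split_ifs with h
    · have hlt : p < l := lt_of_le_of_ne (hle (w, l) (by simp)) (Ne.symm h)
      have hcov' : ∀ x ∈ S, x ≤ l ∨ x ∈ M.map Prod.snd := by
        intro x hx
        rcases hcov x hx with h1 | h1
        · exact Or.inl (h1.trans hlt.le)
        · rw [List.map_cons, List.mem_cons] at h1
          rcases h1 with h1 | h1
          · exact Or.inl h1.le
          · exact Or.inr h1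
      have hr : rank S l = rank S p + 1 := by
        have : S.filter (· < l) = insert p (S.filter (· < p)) := by
          ext x
          simp only [Finset.mem_filter, Finset.mem_insert]
          constructor
          · rintro ⟨hx, hxl⟩
            rcases hcov x hx with h1 | h1
            · rcases h1.eq_or_lt with h2 | h2
              · exact Or.inl h2
              · exact Or.inr ⟨hx, h2⟩
            · exfalso
              rw [List.map_cons, List.mem_cons] at h1
              rcases h1 with h1 | h1
              · exact hxl.ne h1
              · obtain ⟨q, hq, rfl⟩ := List.mem_map.1 h1
                exact absurd (hsort.1 q hq) (not_le.2 hxl)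
          · rintro (rfl | ⟨hx, hxp⟩)
            · exact ⟨hp, hlt⟩
            · exact ⟨hx, hxp.trans hlt⟩
        rw [rank, this, Finset.card_insert_of_notMem (by simp), rank]
      rw [← hr, ih l (hS (w, l) (by simp)) hsort.2 (fun q hq => hsort.1 q hq)
        (fun q hq => hS q (by simp [hq])) hcov']
      rfl
    · rw [not_not] at h
      subst h
      rw [ih l hp hsort.2 (fun q hq => hsort.1 q hq) (fun q hq => hS q (by simp [hq]))]
      · rfl
      · intro x hx
        rcases hcov x hx with h1 | h1
        · exact Or.inl h1
        · rw [List.map_cons, List.mem_cons] at h1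
          rcases h1 with h1 | h1
          · exact Or.inl h1.le
          · exact Or.inr h1

theorem condenseLabels_eq {M : List (V × List ℕ)} (h : M.Pairwise fun a b => a.2 ≤ b.2) :
    condenseLabels M = M.map fun q => (q.1, rank (M.map Prod.snd).toFinset q.2) := by
  cases M with
  | nil => rfl
  | cons q M =>
    obtain ⟨w, l⟩ := q
    set S := (((w, l) :: M).map Prod.snd).toFinset with hS
    have hmin : ∀ q ∈ (w, l) :: M, l ≤ q.2 := by
      intro q hq
      rcases List.mem_cons.1 hq with rfl | hq
      · exact le_rfl
      · exact (List.pairwise_cons.1 h).1 q hq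
    have h0 : rank S l = 0 := by
      rw [rank, Finset.card_eq_zero, Finset.filter_eq_empty_iff]
      intro x hx
      rw [hS, List.mem_toFinset] at hx
      obtain ⟨q, hq, rfl⟩ := List.mem_map.1 hx
      exact not_lt.2 (hmin q hq)
    have := condenseAux_eq S ((w, l) :: M) l (by simp [hS]) h hmin
      (fun q hq => by rw [hS, List.mem_toFinset]; exact List.mem_map_of_mem hq)
      (fun x hx => Or.inr (by rwa [hS, List.mem_toFinset] at hx))
    rw [h0] at this
    exact this

theorem condenseLabels_map_fst {M : List (V × List ℕ)} (h : M.Pairwise fun a b => a.2 ≤ b.2) :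
    (condenseLabels M).map Prod.fst = M.map Prod.fst := by
  rw [condenseLabels_eq h, List.map_map]
  rfl

theorem condenseLabels_map_snd {M : List (V × List ℕ)} (h : M.Pairwise fun a b => a.2 ≤ b.2) :
    (condenseLabels M).map Prod.snd =
      (M.map Prod.snd).map (rank (M.map Prod.snd).toFinset) := by
  rw [condenseLabels_eq h, List.map_map, List.map_map]
  rfl

/-- The integers depend only on the sequence of labels, so handing over those of `M` has the same
effect as condensing `M'`. -/
theorem zip_condenseLabels {V' : Type v} {M : List (V × List ℕ)} {M' : List (V' × List ℕ)}
    (h : M.Pairwise fun a b => a.2 ≤ b.2) (h' : M'.Pairwise fun a b => a.2 ≤ b.2)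
    (heq : M.map Prod.snd = M'.map Prod.snd) :
    (M'.map Prod.fst).zip ((condenseLabels M).map Prod.snd) = condenseLabels M' := by
  rw [condenseLabels_map_snd h, heq, ← condenseLabels_map_snd h', ← condenseLabels_map_fst h']
  exact (List.zip_of_prod rfl rfl).symm

end Condense

/-! ### The invariant of the list passed from level to level -/

section LevelList

variable {V : Type u} [Fintype V] (T : RTree V)

/-- `K` lists, without repetition and by nondecreasing integers, the vertices of the level
below `i`. -/
structure IsLevelList (i : ℕ) (K : List (V × ℕ)) : Prop where
  nodup : (K.map Prod.fst).Nodup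
  mem_iff : ∀ w, w ∈ K.map Prod.fst ↔ T.level w + 1 = i
  sorted : K.Pairwise fun a b => a.2 ≤ b.2

variable {T}

theorem isLevelList_nil : IsLevelList T 0 [] := ⟨by simp, by simp, by simp⟩

variable {i : ℕ} {K : List (V × ℕ)}

theorem IsLevelList.isChild (hK : IsLevelList T i K) (hi : i ≤ T.height) {q : V × ℕ}
    (hq : q ∈ K) : T.IsChild q.1 (T.parent q.1) ∧ T.level (T.parent q.1) = i := by
  have hl := (hK.mem_iff q.1).1 (List.mem_map_of_mem hq)
  have := RTree.level_parent (i := T.level q.1) rfl (by omega)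
  exact ⟨this.1, by rw [this.2, hl]⟩

theorem IsLevelList.lab_sorted (hK : IsLevelList T i K) (v : V) :
    (lab T K v).Pairwise (· ≤ ·) := by
  rw [lab, List.pairwise_map]
  exact hK.sorted.filter _

variable (lv : LevelLists T)

/-- The order in which `createLabels` lists the vertices of level `i`. -/
noncomputable def created (i : ℕ) (K : List (V × ℕ)) : List V :=
  parentOrder T (leaves T (lv.list i)) K

theorem nodup_created (i : ℕ) (K : List (V × ℕ)) : (created lv i K).Nodup :=
  nodup_parentOrder T ((lv.nodup i).filter _) K

/-- A leaf is listed from the start, any other vertex of the level through one of its children,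
which lie on the level below. -/
theorem IsLevelList.mem_created (hK : IsLevelList T i K) (hi : i ≤ T.height) (w : V) :
    w ∈ created lv i K ↔ T.level w = i := by
  rw [created, mem_parentOrder]
  constructor
  · rintro (h | ⟨q, hq, rfl⟩)
    · rw [leaves, List.mem_filter, lv.mem_iff] at h
      exact h.1
    · exact (hK.isChild hi hq).2
  · intro h
    by_cases hl : T.IsLeaf w
    · left
      rw [leaves, List.mem_filter, lv.mem_iff]
      exact ⟨h, by simpa using hl⟩
    · right
      obtain ⟨c, hc⟩ := RTree.exists_isChild_of_not_isLeaf hl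
      have hcl := hc.level
      have : c ∈ K.map Prod.fst := (hK.mem_iff c).2 (by omega)
      obtain ⟨q, hq, rfl⟩ := List.mem_map.1 this
      exact ⟨q, hq, hc.2⟩

theorem createLabels_eq_created (i : ℕ) (K : List (V × ℕ)) :
    createLabels T K (lv.list i) = (created lv i K).map fun v => (v, lab T K v) :=
  createLabels_eq T K _

variable {lv} {M : List (V × List ℕ)}

theorem map_fst_perm_created (hM : M.Perm (createLabels T K (lv.list i))) :
    (M.map Prod.fst).Perm (created lv i K) := by
  rw [createLabels_eq_created] at hM
  simpa [List.map_map, Function.comp_def] using hM.map Prod.fst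

theorem snd_eq_lab (hM : M.Perm (createLabels T K (lv.list i))) {q : V × List ℕ}
    (hq : q ∈ M) : q.2 = lab T K q.1 := by
  rw [hM.mem_iff, createLabels_eq_created, List.mem_map] at hq
  obtain ⟨v, -, rfl⟩ := hq
  rfl

/-- The invariant is handed on to the next level: along a sorted list of labels the ranks are
nondecreasing. -/
theorem IsLevelList.condense (hK : IsLevelList T i K) (hi : i ≤ T.height)
    (hM : M.Perm (createLabels T K (lv.list i))) (hs : M.Pairwise fun a b => a.2 ≤ b.2) :
    IsLevelList T (i + 1) (condenseLabels M) := by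
  refine ⟨?_, ?_, ?_⟩
  · rw [condenseLabels_map_fst hs, (map_fst_perm_created hM).nodup_iff]
    exact nodup_created lv i K
  · intro w
    rw [condenseLabels_map_fst hs, (map_fst_perm_created hM).mem_iff, hK.mem_created lv hi]
    omega
  · rw [condenseLabels_eq hs, List.pairwise_map]
    exact hs.imp fun {a b} h => rank_le_rank (S := (M.map Prod.snd).toFinset) h

theorem mem_condenseLabels (hM : M.Perm (createLabels T K (lv.list i)))
    (hs : M.Pairwise fun a b => a.2 ≤ b.2) {v : V} {k : ℕ} (h : (v, k) ∈ condenseLabels M) :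
    lab T K v ∈ (M.map Prod.snd).toFinset ∧ k = rank (M.map Prod.snd).toFinset (lab T K v) := by
  rw [condenseLabels_eq hs, List.mem_map] at h
  obtain ⟨q, hq, he⟩ := h
  rw [Prod.mk.injEq] at he
  obtain ⟨rfl, rfl⟩ := he
  rw [← snd_eq_lab hM hq, List.mem_toFinset]
  exact ⟨List.mem_map_of_mem hq, rfl⟩

end LevelList

end AHU

namespace AHU

universe u v

/-! ### Isomorphism of subtrees and of rooted trees -/

section Isomorphism

variable {V : Type u} {V' : Type v} (T : RTree V) (T' : RTree V')

/-- Entries at equal positions are paired. The vertex `d` only supplies a value of the map away from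
`a`. -/
theorem exists_bijOn_of_map_snd_eq (d : V') {a : List (V × ℕ)} {b : List (V' × ℕ)}
    (ha : (a.map Prod.fst).Nodup) (hb : (b.map Prod.fst).Nodup)
    (h : a.map Prod.snd = b.map Prod.snd) :
    ∃ f : V → V', Set.BijOn f {c | c ∈ a.map Prod.fst} {c | c ∈ b.map Prod.fst} ∧
      ∀ q ∈ a, (f q.1, q.2) ∈ b := by
  classical
  induction a generalizing b with
  | nil =>
    cases b with
    | nil => exact ⟨fun _ => d, by simp [Set.BijOn, Set.MapsTo, Set.SurjOn], by simp⟩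
    | cons => simp at h
  | cons p a ih =>
    cases b with
    | nil => simp at h
    | cons q b =>
      simp only [List.map_cons, List.cons.injEq, List.nodup_cons] at h ha hb
      obtain ⟨f, hf, hfm⟩ := ih ha.2 hb.2 h.2
      have hne : ∀ c ∈ a.map Prod.fst, c ≠ p.1 := fun c hc h' => ha.1 (h' ▸ hc)
      have hq : ∀ c ∈ a.map Prod.fst, f c ≠ q.1 := fun c hc h' => hb.1 (h' ▸ hf.mapsTo hc)
      refine ⟨Function.update f p.1 q.1, ⟨?_, ?_, ?_⟩, ?_⟩
      · intro c hc
        simp only [List.map_cons, Set.mem_ofPred_eq, List.mem_cons] at hc ⊢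
        rcases hc with rfl | hc
        · simp
        · rw [Function.update_of_ne (hne c hc)]
          exact Or.inr (hf.mapsTo hc)
      · intro c hc e he hce
        simp only [List.map_cons, Set.mem_ofPred_eq, List.mem_cons] at hc he
        rcases hc with rfl | hc <;> rcases he with rfl | he
        · rfl
        · rw [Function.update_self, Function.update_of_ne (hne e he)] at hce
          exact absurd hce.symm (hq e he)
        · rw [Function.update_self, Function.update_of_ne (hne c hc)] at hce
          exact absurd hce (hq c hc)
        · rw [Function.update_of_ne (hne c hc), Function.update_of_ne (hne e he)] at hce
          exact hf.injOn hc he hce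
      · intro x hx
        simp only [List.map_cons, Set.mem_ofPred_eq, List.mem_cons] at hx
        rcases hx with rfl | hx
        · exact ⟨p.1, by simp, by simp⟩
        · obtain ⟨c, hc, rfl⟩ := hf.surjOn hx
          exact ⟨c, List.mem_cons_of_mem _ hc, Function.update_of_ne (hne c hc) _ _⟩
      · intro r hr
        rcases List.mem_cons.1 hr with rfl | hr
        · simp [h.1]
        · rw [Function.update_of_ne (hne r.1 (List.mem_map_of_mem hr))]
          exact List.mem_cons_of_mem _ (hfm r hr)

/-- The subtrees below `w` and `w'` are isomorphic. -/
inductive SubtreeIso : V → V' → Prop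
  | mk (w : V) (w' : V') (f : V → V') (hf : Set.BijOn f {c | T.IsChild c w} {c | T'.IsChild c w'})
      (h : ∀ c, T.IsChild c w → SubtreeIso c (f c)) : SubtreeIso w w'

open Classical in
/-- A bijection between the children of `w` and those of `w'`, if the subtrees are isomorphic. -/
noncomputable def childMap (w : V) (w' : V') : V → V' :=
  if h : ∃ f : V → V', Set.BijOn f {c | T.IsChild c w} {c | T'.IsChild c w'} ∧
    ∀ c, T.IsChild c w → SubtreeIso T T' c (f c) then h.choose else fun _ => T'.root

variable {T T'} in
theorem childMap_spec {w : V} {w' : V'} (h : SubtreeIso T T' w w') :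
    Set.BijOn (childMap T T' w w') {c | T.IsChild c w} {c | T'.IsChild c w'} ∧
    ∀ c, T.IsChild c w → SubtreeIso T T' c (childMap T T' w w' c) := by
  have h' : ∃ f : V → V', Set.BijOn f {c | T.IsChild c w} {c | T'.IsChild c w'} ∧
      ∀ c, T.IsChild c w → SubtreeIso T T' c (f c) := by
    cases h with
    | mk _ _ f hf h => exact ⟨f, hf, h⟩
  rw [childMap, dif_pos h']
  exact h'.choose_spec

/-- The map from `T` to `T'` built from the root by `childMap`, on vertices of depth `d`. -/
noncomputable def descend : ℕ → V → V'
  | 0, _ => T'.root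
  | d + 1, w => childMap T T' (T.parent w) (descend d (T.parent w)) w

variable {T T'}

/-- The bijections between children are pasted together from the root downwards; the properties of
the resulting map follow by induction on the depth. -/
theorem isomorphic_of_subtreeIso (h : SubtreeIso T T' T.root T'.root) : Isomorphic T T' := by
  set φ : V → V' := fun w => descend T T' (T.depth w) w with hφ
  have h0 : φ T.root = T'.root := by simp [hφ, descend]
  have hstep : ∀ w, w ≠ T.root → φ w = childMap T T' (T.parent w) (φ (T.parent w)) w := by
    intro w hw
    simp only [hφ]
    rw [RTree.depth_parent hw, descend]
  -- Subtrees at corresponding vertices remain isomorphic, so `childMap` never falls back on its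
  -- default value.
  have hsub : ∀ d w, T.depth w = d → SubtreeIso T T' w (φ w) := by
    intro d
    induction d with
    | zero =>
      intro w hw
      rw [RTree.depth_eq_zero] at hw
      subst hw
      rw [h0]
      exact h
    | succ d ih =>
      intro w hw
      have hr : w ≠ T.root := by
        rintro rfl
        simp at hw
      rw [hstep w hr]
      refine (childMap_spec (ih (T.parent w) ?_)).2 w (RTree.isChild_parent hr)
      rw [RTree.depth_parent hr] at hw
      omega
  have hchild : ∀ w, w ≠ T.root → T'.IsChild (φ w) (φ (T.parent w)) := by
    intro w hr
    rw [hstep w hr]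
    exact (childMap_spec (hsub _ (T.parent w) rfl)).1.mapsTo (RTree.isChild_parent hr)
  have hroot : ∀ w, φ w = T'.root ↔ w = T.root := by
    intro w
    constructor
    · intro hw
      by_contra hr
      exact (hchild w hr).1 hw
    · rintro rfl
      exact h0
  -- Equal images have parents with equal images; by induction the parents agree, and a single
  -- `childMap` is injective on their children.
  have hinj : ∀ d a b, T.depth a = d → φ a = φ b → a = b := by
    intro d
    induction d with
    | zero =>
      intro a b ha hab
      rw [RTree.depth_eq_zero] at ha
      subst ha
      rw [h0] at hab
      exact ((hroot b).1 hab.symm).symm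
    | succ d ih =>
      intro a b ha hab
      have hra : a ≠ T.root := by
        rintro rfl
        simp at ha
      have hrb : b ≠ T.root := fun hb => hra ((hroot a).1 (hab.trans ((hroot b).2 hb)))
      have hp : T.parent a = T.parent b := by
        apply ih
        · rw [RTree.depth_parent hra] at ha
          omega
        · rw [← (hchild a hra).2, ← (hchild b hrb).2, hab]
      rw [hstep a hra, hstep b hrb, ← hp] at hab
      exact (childMap_spec (hsub _ (T.parent a) rfl)).1.injOn (RTree.isChild_parent hra)
        ⟨hrb, hp.symm⟩ hab
  have hsurj : ∀ d x, T'.depth x = d → ∃ a, φ a = x := by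
    intro d
    induction d with
    | zero =>
      intro x hx
      rw [RTree.depth_eq_zero] at hx
      exact ⟨T.root, h0.trans hx.symm⟩
    | succ d ih =>
      intro x hx
      have hr : x ≠ T'.root := by
        rintro rfl
        simp at hx
      obtain ⟨p, hp⟩ := ih (T'.parent x) (by rw [RTree.depth_parent hr] at hx; omega)
      obtain ⟨c, hc, rfl⟩ := (childMap_spec (hsub _ p rfl)).1.surjOn
        (show x ∈ {c | T'.IsChild c (φ p)} from ⟨hr, hp.symm⟩)
      refine ⟨c, ?_⟩
      obtain ⟨hc1, rfl⟩ := hc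
      rw [hstep c hc1]
  have hbij : Function.Bijective φ :=
    ⟨fun a b hab => hinj _ a b rfl hab, fun x => hsurj _ x rfl⟩
  have hiff : ∀ a b, T'.IsChild (φ a) (φ b) ↔ T.IsChild a b := by
    intro a b
    constructor
    · intro hab
      have hr : a ≠ T.root := fun ha => hab.1 ((hroot a).2 ha)
      exact ⟨hr, hbij.1 ((hchild a hr).2.symm.trans hab.2)⟩
    · rintro ⟨hr, rfl⟩
      exact hchild a hr
  refine ⟨⟨Equiv.ofBijective φ hbij, ?_⟩, h0⟩
  intro a b
  simp only [Equiv.ofBijective_apply]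
  rw [RTree.adj_iff, RTree.adj_iff, hiff, hiff]

/-- The image of the path to `w` is a walk of the same length from the root. The inverse isomorphism
then gives equality. -/
theorem depth_map_le (φ : T.graph ≃g T'.graph) (hφ : φ T.root = T'.root) (w : V) :
    T'.depth (φ w) ≤ T.depth w := by
  rw [← T.pathTo_length, RTree.depth]
  refine (SimpleGraph.dist_le (((T.pathTo w).map φ.toHom).copy hφ rfl)).trans ?_
  simp

theorem depth_map (φ : T.graph ≃g T'.graph) (hφ : φ T.root = T'.root) (w : V) :
    T'.depth (φ w) = T.depth w := by
  refine (depth_map_le φ hφ w).antisymm ?_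
  have := depth_map_le φ.symm (by rw [← hφ]; simp) (φ w)
  simpa using this

theorem isChild_map (φ : T.graph ≃g T'.graph) (hφ : φ T.root = T'.root) (a b : V) :
    T'.IsChild (φ a) (φ b) ↔ T.IsChild a b := by
  rw [RTree.isChild_iff, RTree.isChild_iff, depth_map φ hφ, depth_map φ hφ, φ.map_adj_iff]

theorem parent_map (φ : T.graph ≃g T'.graph) (hφ : φ T.root = T'.root) (a : V) :
    T'.parent (φ a) = φ (T.parent a) := by
  by_cases ha : a = T.root
  · rw [ha, RTree.parent_root, hφ, RTree.parent_root]
  · exact ((isChild_map φ hφ _ _).2 (RTree.isChild_parent ha)).2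

variable [Fintype V] [Fintype V']

theorem height_map (φ : T.graph ≃g T'.graph) (hφ : φ T.root = T'.root) :
    T'.height = T.height := by
  apply le_antisymm
  · obtain ⟨x, hx⟩ := RTree.exists_depth_eq_height (T := T')
    obtain ⟨w, rfl⟩ := φ.surjective x
    rw [← hx, depth_map φ hφ]
    exact RTree.depth_le_height w
  · obtain ⟨w, hw⟩ := RTree.exists_depth_eq_height (T := T)
    rw [← hw, ← depth_map φ hφ]
    exact RTree.depth_le_height _

theorem level_map (φ : T.graph ≃g T'.graph) (hφ : φ T.root = T'.root) (w : V) :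
    T'.level (φ w) = T.level w := by
  have h1 := RTree.level_add_depth (T := T) w
  have h2 := RTree.level_add_depth (T := T') (φ w)
  rw [depth_map φ hφ, height_map φ hφ] at h2
  omega

end Isomorphism

/-! ### Correctness of the algorithm -/

section Correctness

variable {V : Type u} {V' : Type v} [Fintype V] [Fintype V'] {T : RTree V} {T' : RTree V'}

open Classical in
theorem IsLevelList.mem_filter_parent {i : ℕ} {K : List (V × ℕ)} (hK : IsLevelList T i K)
    (hi : i ≤ T.height) {w : V} (hw : T.level w = i) (c : V) :
    c ∈ (K.filter fun q => decide (T.parent q.1 = w)).map Prod.fst ↔ T.IsChild c w := by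
  constructor
  · intro h
    obtain ⟨q, hq, rfl⟩ := List.mem_map.1 h
    rw [List.mem_filter, decide_eq_true_eq] at hq
    rw [← hq.2]
    exact (hK.isChild hi hq.1).1
  · intro h
    have hl := h.level
    obtain ⟨q, hq, rfl⟩ := List.mem_map.1 ((hK.mem_iff c).2 (by omega))
    exact List.mem_map_of_mem (List.mem_filter.2 ⟨hq, by simpa using h.2⟩)

/-- Equal labels pair the children of `w` and `w'` by position, and paired children carry the same
integer. -/
theorem subtreeIso_of_lab_eq {i : ℕ} {K : List (V × ℕ)} {K' : List (V' × ℕ)}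
    (hK : IsLevelList T i K) (hK' : IsLevelList T' i K') (hi : i ≤ T.height) (hi' : i ≤ T'.height)
    (hiso : ∀ w w' k, (w, k) ∈ K → (w', k) ∈ K' → SubtreeIso T T' w w') {w : V} {w' : V'}
    (hw : T.level w = i) (hw' : T'.level w' = i) (h : lab T K w = lab T' K' w') :
    SubtreeIso T T' w w' := by
  classical
  obtain ⟨f, hf, hfm⟩ := exists_bijOn_of_map_snd_eq T'.root
    (hK.nodup.sublist (List.Sublist.map Prod.fst List.filter_sublist))
    (hK'.nodup.sublist (List.Sublist.map Prod.fst List.filter_sublist)) h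
  refine ⟨w, w', f, ?_, ?_⟩
  · convert hf using 1
    · ext c
      exact (hK.mem_filter_parent hi hw c).symm
    · ext c
      exact (hK'.mem_filter_parent hi' hw' c).symm
  · intro c hc
    obtain ⟨q, hq, rfl⟩ := List.mem_map.1 ((hK.mem_filter_parent hi hw c).2 hc)
    exact hiso q.1 _ q.2 (List.mem_filter.1 hq).1 (List.mem_filter.1 (hfm q hq)).1

variable (lv : LevelLists T) (lv' : LevelLists T') (ls : LexSort V) (ls' : LexSort V')

/-- After a successful comparison the zip in the algorithm is `condenseLabels` of the second list,
so that the two trees play symmetric roles. -/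
theorem loop_succ (k i : ℕ) (K : List (V × ℕ)) (K' : List (V' × ℕ)) :
    loop T T' lv lv' ls ls' (k + 1) i K K' =
      let A := createLabels T K (lv.list i)
      let A' := createLabels T' K' (lv'.list i)
      if (ls.sort A).map Prod.snd = (ls'.sort A').map Prod.snd then
        let r := loop T T' lv lv' ls ls' k (i + 1) (condenseLabels (ls.sort A))
          (condenseLabels (ls'.sort A'))
        (.created i A A' :: .sorted i (ls.sort A) (ls'.sort A') ::
          .condensed i (condenseLabels (ls.sort A)) (condenseLabels (ls'.sort A')) :: r.1, r.2)
      else ([.created i A A', .sorted i (ls.sort A) (ls'.sort A')], false) := by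
  rw [loop]
  by_cases h : (ls.sort (createLabels T K (lv.list i))).map Prod.snd =
      (ls'.sort (createLabels T' K' (lv'.list i))).map Prod.snd
  · simp only [ne_eq, h, not_true_eq_false, if_false, if_true]
    rw [zip_condenseLabels (ls.sorted _) (ls'.sorted _) h]
  · simp only [ne_eq, h, not_false_eq_true, if_true, if_false]

/-- The property carried upwards is that equal integers mean isomorphic subtrees. After the last
level the lists contain only the roots. -/
theorem subtreeIso_root_of_loop (hh : T.height = T'.height) (k : ℕ) :
    ∀ i K K', i + k = T.height + 1 → IsLevelList T i K → IsLevelList T' i K' →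
      K.map Prod.snd = K'.map Prod.snd →
      (∀ w w' k, (w, k) ∈ K → (w', k) ∈ K' → SubtreeIso T T' w w') →
      (loop T T' lv lv' ls ls' k i K K').2 = true → SubtreeIso T T' T.root T'.root := by
  induction k with
  | zero =>
    intro i K K' hi hK hK' hsnd hiso _
    obtain ⟨⟨w, a⟩, hq, hr⟩ := List.mem_map.1
      ((hK.mem_iff T.root).2 (by rw [RTree.level_root]; omega))
    subst hr
    have ha : a ∈ K'.map Prod.snd := by
      rw [← hsnd]
      exact List.mem_map_of_mem hq
    obtain ⟨⟨w', b⟩, hq', hb⟩ := List.mem_map.1 ha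
    subst hb
    have hw' := (hK'.mem_iff w').1 (List.mem_map_of_mem hq')
    have : w' = T'.root := RTree.level_eq_height.1 (by omega)
    subst this
    exact hiso _ _ _ hq hq'
  | succ k ih =>
    intro i K K' hi hK hK' hsnd hiso h
    have hi1 : i ≤ T.height := by omega
    have hi1' : i ≤ T'.height := by omega
    rw [loop_succ] at h
    simp only at h
    set M := ls.sort (createLabels T K (lv.list i)) with hM
    set M' := ls'.sort (createLabels T' K' (lv'.list i)) with hM'
    have hp : M.Perm _ := ls.perm (createLabels T K (lv.list i))
    have hp' : M'.Perm _ := ls'.perm (createLabels T' K' (lv'.list i))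
    have hs : M.Pairwise _ := ls.sorted (createLabels T K (lv.list i))
    have hs' : M'.Pairwise _ := ls'.sorted (createLabels T' K' (lv'.list i))
    split_ifs at h with heq
    have hC := hK.condense hi1 hp hs
    have hC' := hK'.condense hi1' hp' hs'
    refine ih (i + 1) _ _ (by omega) hC hC' ?_ ?_ h
    · rw [condenseLabels_map_snd hs, condenseLabels_map_snd hs', heq]
    · intro w w' k hk hk'
      have hw := (hC.mem_iff w).1 (List.mem_map_of_mem hk)
      have hw' := (hC'.mem_iff w').1 (List.mem_map_of_mem hk')
      obtain ⟨hm, he⟩ := mem_condenseLabels hp hs hk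
      obtain ⟨hm', he'⟩ := mem_condenseLabels hp' hs' hk'
      -- Both ranks now refer to the same set of labels, on which the rank is injective.
      rw [← heq] at hm' he'
      exact subtreeIso_of_lab_eq hK hK' hi1 hi1' hiso (by omega) (by omega)
        (rank_inj hm hm' (he.symm.trans he'))

/-- Both labels list the integers of corresponding children in nondecreasing order, and a multiset
has only one such listing. -/
theorem lab_map (φ : T.graph ≃g T'.graph) (hφ : φ T.root = T'.root) {i : ℕ} {K : List (V × ℕ)}
    {K' : List (V' × ℕ)} (hK : IsLevelList T i K) (hK' : IsLevelList T' i K')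
    (hp : (K.map (Prod.map φ id)).Perm K') (w : V) : lab T' K' (φ w) = lab T K w := by
  classical
  apply List.Perm.eq_of_pairwise (le := (· ≤ ·)) (fun a b _ _ h h' => le_antisymm h h')
    (hK'.lab_sorted _) (hK.lab_sorted _)
  have := (hp.symm.filter fun q => decide (T'.parent q.1 = φ w)).map Prod.snd
  refine this.trans (List.Perm.of_eq ?_)
  rw [lab, List.filter_map, List.map_map]
  congr 1
  apply List.filter_congr
  intro q _
  simp [parent_map φ hφ]

/-- The property carried upwards is that `φ` takes the first list to a permutation of the second. -/
theorem loop_eq_true (φ : T.graph ≃g T'.graph) (hφ : φ T.root = T'.root) (k : ℕ) :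
    ∀ i K K', i + k = T.height + 1 → IsLevelList T i K → IsLevelList T' i K' →
      (K.map (Prod.map φ id)).Perm K' → (loop T T' lv lv' ls ls' k i K K').2 = true := by
  induction k with
  | zero => intros; rfl
  | succ k ih =>
    intro i K K' hi hK hK' hperm
    have hh := height_map φ hφ
    have hi1 : i ≤ T.height := by omega
    have hi1' : i ≤ T'.height := by omega
    rw [loop_succ]
    simp only
    set M := ls.sort (createLabels T K (lv.list i)) with hM
    set M' := ls'.sort (createLabels T' K' (lv'.list i)) with hM'
    have hp : M.Perm _ := ls.perm (createLabels T K (lv.list i))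
    have hp' : M'.Perm _ := ls'.perm (createLabels T' K' (lv'.list i))
    have hs : M.Pairwise _ := ls.sorted (createLabels T K (lv.list i))
    have hs' : M'.Pairwise _ := ls'.sorted (createLabels T' K' (lv'.list i))
    have hO : ((created lv i K).map φ).Perm (created lv' i K') := by
      rw [List.perm_ext_iff_of_nodup ((nodup_created lv i K).map φ.injective)
        (nodup_created lv' i K')]
      intro x
      obtain ⟨w, rfl⟩ := φ.surjective x
      rw [hK'.mem_created lv' hi1', level_map φ hφ, ← hK.mem_created lv hi1]
      exact List.mem_map_of_injective φ.injective
    have hA : (M.map (Prod.map φ id)).Perm M' := by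
      refine (hp.map _).trans (List.Perm.trans ?_ hp'.symm)
      rw [createLabels_eq_created, createLabels_eq_created, List.map_map]
      refine List.Perm.trans (List.Perm.of_eq ?_) (hO.map fun v => (v, lab T' K' v))
      rw [List.map_map]
      apply List.map_congr_left
      intro w _
      simp [lab_map φ hφ hK hK' hperm]
    -- Sorted lists that are permutations of each other coincide, however ties were broken.
    have heq : M.map Prod.snd = M'.map Prod.snd := by
      apply List.Perm.eq_of_pairwise (le := (· ≤ ·)) (fun a b _ _ h h' => le_antisymm h h')
        (by rw [List.pairwise_map]; exact hs) (by rw [List.pairwise_map]; exact hs')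
      have := hA.map Prod.snd
      rwa [List.map_map] at this
    rw [if_pos heq]
    refine ih (i + 1) _ _ (by omega) (hK.condense hi1 hp hs) (hK'.condense hi1' hp' hs') ?_
    rw [condenseLabels_eq hs, condenseLabels_eq hs', heq, List.map_map]
    have := hA.map fun q => (q.1, rank (M'.map Prod.snd).toFinset q.2)
    rwa [List.map_map] at this

theorem output_eq_true_iff : output T T' lv lv' ls ls' = true ↔ Isomorphic T T' := by
  rw [output, run]
  constructor
  · intro h
    split_ifs at h with hh
    rw [not_not] at hh
    exact isomorphic_of_subtreeIso (subtreeIso_root_of_loop lv lv' ls ls' hh (T.height + 1) 0 [] []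
      (by omega) isLevelList_nil isLevelList_nil rfl (by simp) h)
  · rintro ⟨φ, hφ⟩
    have hh := height_map φ hφ
    rw [if_neg (by simp [hh])]
    exact loop_eq_true lv lv' ls ls' φ hφ (T.height + 1) 0 [] [] (by omega) isLevelList_nil
      isLevelList_nil (by simp)

end Correctness

end AHU

namespace AHU

/-! ### Big-step semantics and its agreement with the machine -/

section Semantics

/-- Big-step semantics: `Exec c s t τ s'` says that `c` takes `s` to `s'` in `t` steps; `τ` lists
the memories in which a command `skip` was executed. -/
inductive Exec : Cmd → Mem → ℕ → List Mem → Mem → Prop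
  | skip (s) : Exec .skip s 1 [s] s
  | const (x n s) : Exec (.const x n) s 1 [] (s.setVar x n)
  | copy (x y s) : Exec (.copy x y) s 1 [] (s.setVar x (s.var y))
  | succ (x s) : Exec (.succ x) s 1 [] (s.setVar x (s.var x + 1))
  | pred (x s) : Exec (.pred x) s 1 [] (s.setVar x (s.var x - 1))
  | load (x a i s) : Exec (.load x a i) s 1 [] (s.setVar x (s.arr a (s.var i)))
  | store (a i x s) : Exec (.store a i x) s 1 [] (s.setArr a (s.var i) (s.var x))
  | seq {c d s t τ s₁ t' τ₁ s₂} (h : Exec c s t τ s₁) (h' : Exec d s₁ t' τ₁ s₂) :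
      Exec (.seq c d) s (t + t' + 1) (τ ++ τ₁) s₂
  | ite {b c d s t τ s'} (h : Exec (if b.eval s then c else d) s t τ s') :
      Exec (.ite b c d) s (t + 1) τ s'
  | loop_false {b c s} (h : b.eval s = false) : Exec (.loop b c) s 1 [] s
  | loop_true {b c s t τ s₁ t' τ₁ s₂} (hb : b.eval s = true) (h : Exec c s t τ s₁)
      (h' : Exec (.loop b c) s₁ t' τ₁ s₂) : Exec (.loop b c) s (t + t' + 1) (τ ++ τ₁) s₂

/-- The first `t` steps from the configuration `k` lead to `k'` and pass successively through the
memories `τ`. -/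
def Passes (k : Config) (t : ℕ) (τ : List Mem) (k' : Config) : Prop :=
  step^[t] k = k' ∧ ∃ ts : List ℕ, ts.Pairwise (· < ·) ∧ (∀ x ∈ ts, x < t) ∧
    List.Forall₂ (fun x m => (step^[x] k).mem = m) ts τ

/-- The times of the second run are shifted by `t` and are therefore later than those of the first,
which are below `t`. -/
theorem Passes.trans {k k' k'' : Config} {t t' : ℕ} {τ τ' : List Mem} (h : Passes k t τ k')
    (h' : Passes k' t' τ' k'') : Passes k (t + t') (τ ++ τ') k'' := by
  obtain ⟨h1, ts, h2, h3, h4⟩ := h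
  obtain ⟨h1', ts', h2', h3', h4'⟩ := h'
  have hadd : ∀ x, step^[x + t] k = step^[x] k' := fun x => by
    rw [Function.iterate_add_apply, h1]
  refine ⟨by rw [add_comm, hadd, h1'], ts ++ ts'.map (· + t), ?_, ?_, ?_⟩
  · rw [List.pairwise_append]
    refine ⟨h2, ?_, ?_⟩
    · rw [List.pairwise_map]
      exact h2'.imp fun h => by omega
    · intro a ha b hb
      obtain ⟨y, -, rfl⟩ := List.mem_map.1 hb
      have := h3 a ha
      omega
  · intro x hx
    rcases List.mem_append.1 hx with hx | hx
    · have := h3 x hx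
      omega
    · obtain ⟨y, hy, rfl⟩ := List.mem_map.1 hx
      have := h3' y hy
      omega
  · refine List.rel_append h4 ?_
    rw [List.forall₂_map_left_iff]
    exact h4'.imp fun x m hx => by rw [hadd, hx]

theorem passes_one {k k' : Config} (h : step k = k') : Passes k 1 [] k' :=
  ⟨h, [], by simp, by simp, by simp⟩

/-- The stack `k` below the command is arbitrary, which is what the induction needs for sequences
and loops. -/
theorem Exec.passes {c : Cmd} {s : Mem} {t : ℕ} {τ : List Mem} {s' : Mem} (h : Exec c s t τ s') :
    ∀ k, Passes ⟨c :: k, s⟩ t τ ⟨k, s'⟩ := by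
  induction h with
  | skip s => exact fun k => ⟨rfl, [0], by simp, by simp, by simp⟩
  | const x n s => exact fun k => passes_one rfl
  | copy x y s => exact fun k => passes_one rfl
  | succ x s => exact fun k => passes_one rfl
  | pred x s => exact fun k => passes_one rfl
  | load x a i s => exact fun k => passes_one rfl
  | store a i x s => exact fun k => passes_one rfl
  | @seq c d s t τ s₁ t' τ' s₂ _ _ ih ih' =>
    intro k
    have := ((passes_one (k := ⟨.seq c d :: k, s⟩) rfl).trans (ih (d :: k))).trans (ih' k)
    rwa [List.nil_append, show 1 + t + t' = t + t' + 1 by omega] at this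
  | @ite b c d s t τ s' _ ih =>
    intro k
    have := (passes_one (k := ⟨.ite b c d :: k, s⟩) rfl).trans (ih k)
    rwa [List.nil_append, add_comm] at this
  | @loop_false b c s h =>
    intro k
    exact passes_one (by simp [step, h])
  | @loop_true b c s t τ s₁ t' τ' s₂ hb _ _ ih ih' =>
    intro k
    have := ((passes_one (k := ⟨.loop b c :: k, s⟩) (k' := ⟨c :: .loop b c :: k, s⟩)
      (by simp [step, hb])).trans (ih (.loop b c :: k))).trans (ih' k)
    rwa [List.nil_append, show 1 + t + t' = t + t' + 1 by omega] at this

end Semantics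

/-! ### Memory updates and syntactic data of commands -/

section Memory

@[simp] theorem Mem.setVar_var (s : Mem) (x n y : ℕ) :
    (s.setVar x n).var y = if y = x then n else s.var y := by
  simp [Mem.setVar, Function.update_apply]

@[simp] theorem Mem.setVar_arr (s : Mem) (x n : ℕ) : (s.setVar x n).arr = s.arr := rfl

@[simp] theorem Mem.setArr_var (s : Mem) (a i n : ℕ) : (s.setArr a i n).var = s.var := rfl

@[simp] theorem Mem.setArr_arr (s : Mem) (a i n b : ℕ) :
    (s.setArr a i n).arr b = if b = a then Function.update (s.arr a) i n else s.arr b := by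
  simp [Mem.setArr, Function.update_apply]

theorem Mem.ext' {s s' : Mem} (h : ∀ x, s.var x = s'.var x) (h' : ∀ a, s.arr a = s'.arr a) :
    s = s' := by
  cases s
  cases s'
  simp only [Mem.mk.injEq]
  exact ⟨funext h, funext h'⟩

end Memory

/-- Rename the variables. -/
def Test.rename (f : ℕ → ℕ) : Test → Test
  | .lt x y => .lt (f x) (f y)
  | .eq x y => .eq (f x) (f y)

namespace Cmd

/-- A command without effect. -/
def nop : Cmd := .copy 0 0

/-- Sequential composition of a list of commands. -/
def block : List Cmd → Cmd
  | [] => nop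
  | [c] => c
  | c :: d :: l => .seq c (block (d :: l))

/-- Commands without loops and `skip`. -/
def IsSimple : Cmd → Bool
  | .skip => false
  | .loop _ _ => false
  | .seq c d => c.IsSimple && d.IsSimple
  | .ite _ c d => c.IsSimple && d.IsSimple
  | _ => true

/-- A bound for the running time of a simple command. -/
def cost : Cmd → ℕ
  | .seq c d => c.cost + d.cost + 1
  | .ite _ c d => max c.cost d.cost + 1
  | _ => 1

/-- The effect of a simple command. -/
def eval : Cmd → Mem → Mem
  | .skip, s => s
  | .const x n, s => s.setVar x n
  | .copy x y, s => s.setVar x (s.var y)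
  | .succ x, s => s.setVar x (s.var x + 1)
  | .pred x, s => s.setVar x (s.var x - 1)
  | .load x a i, s => s.setVar x (s.arr a (s.var i))
  | .store a i x, s => s.setArr a (s.var i) (s.var x)
  | .seq c d, s => d.eval (c.eval s)
  | .ite b c d, s => if b.eval s then c.eval s else d.eval s
  | .loop _ _, s => s

/-- Whether the command may assign to the variable `x`. -/
def writesVar (x : ℕ) : Cmd → Bool
  | .const y _ => x == y
  | .copy y _ => x == y
  | .succ y => x == y
  | .pred y => x == y
  | .load y _ _ => x == y
  | .seq c d => c.writesVar x || d.writesVar x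
  | .ite _ c d => c.writesVar x || d.writesVar x
  | .loop _ c => c.writesVar x
  | _ => false

/-- Whether the command may assign to the array `a`. -/
def writesArr (a : ℕ) : Cmd → Bool
  | .store b _ _ => a == b
  | .seq c d => c.writesArr a || d.writesArr a
  | .ite _ c d => c.writesArr a || d.writesArr a
  | .loop _ c => c.writesArr a
  | _ => false

/-- Rename the variables and the arrays. -/
def rename (f : ℕ → ℕ) : Cmd → Cmd
  | .skip => .skip
  | .const x n => .const (f x) n
  | .copy x y => .copy (f x) (f y)
  | .succ x => .succ (f x)
  | .pred x => .pred (f x)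
  | .load x a i => .load (f x) (f a) (f i)
  | .store a i x => .store (f a) (f i) (f x)
  | .seq c d => .seq (c.rename f) (d.rename f)
  | .ite b c d => .ite (b.rename f) (c.rename f) (d.rename f)
  | .loop b c => .loop (b.rename f) (c.rename f)

@[simp] theorem eval_nop (s : Mem) : nop.eval s = s := by
  refine Mem.ext' (fun x => ?_) (fun _ => rfl)
  simp only [nop, eval, Mem.setVar_var]
  split_ifs with h
  · rw [h]
  · rfl

end Cmd

/-! ### Rules for correctness with running time -/

section Hoare

/-- `c` takes `s` within `N` steps, without passing a `skip`, to a memory that satisfies `Q`. -/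
def Ends (c : Cmd) (s : Mem) (N : ℕ) (Q : Mem → Prop) : Prop :=
  ∃ t ≤ N, ∃ s', Exec c s t [] s' ∧ Q s'

theorem Ends.mono {c : Cmd} {s : Mem} {N N' : ℕ} {Q Q' : Mem → Prop} (h : Ends c s N Q)
    (hN : N ≤ N') (hQ : ∀ s', Q s' → Q' s') : Ends c s N' Q' := by
  obtain ⟨t, ht, s', hs, hq⟩ := h
  exact ⟨t, ht.trans hN, s', hs, hQ s' hq⟩

/-- For loop-free code the final memory is computed by `Cmd.eval`, so that statements about it are
left to the simplifier. -/
theorem Exec.of_isSimple {c : Cmd} (h : c.IsSimple = true) (s : Mem) :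
    ∃ t ≤ c.cost, Exec c s t [] (c.eval s) := by
  induction c generalizing s with
  | skip => simp [Cmd.IsSimple] at h
  | loop => simp [Cmd.IsSimple] at h
  | const x n => exact ⟨1, le_rfl, .const x n s⟩
  | copy x y => exact ⟨1, le_rfl, .copy x y s⟩
  | succ x => exact ⟨1, le_rfl, .succ x s⟩
  | pred x => exact ⟨1, le_rfl, .pred x s⟩
  | load x a i => exact ⟨1, le_rfl, .load x a i s⟩
  | store a i x => exact ⟨1, le_rfl, .store a i x s⟩
  | seq c d ihc ihd =>
    rw [Cmd.IsSimple, Bool.and_eq_true] at h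
    obtain ⟨t, ht, hc⟩ := ihc h.1 s
    obtain ⟨t', ht', hd⟩ := ihd h.2 (c.eval s)
    exact ⟨t + t' + 1, by simp only [Cmd.cost]; omega, .seq hc hd⟩
  | ite b c d ihc ihd =>
    rw [Cmd.IsSimple, Bool.and_eq_true] at h
    by_cases hb : b.eval s = true
    · obtain ⟨t, ht, hc⟩ := ihc h.1 s
      refine ⟨t + 1, by simp only [Cmd.cost]; omega, .ite ?_⟩
      simpa [hb, Cmd.eval] using hc
    · obtain ⟨t, ht, hc⟩ := ihd h.2 s
      refine ⟨t + 1, by simp only [Cmd.cost]; omega, .ite ?_⟩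
      simpa [hb, Cmd.eval] using hc

theorem Ends.simple {c : Cmd} {s : Mem} {Q : Mem → Prop} (h : c.IsSimple = true)
    (hQ : Q (c.eval s)) : Ends c s c.cost Q := by
  obtain ⟨t, ht, he⟩ := Exec.of_isSimple h s
  exact ⟨t, ht, _, he, hQ⟩

theorem Ends.simple_le {c : Cmd} {s : Mem} {N : ℕ} {Q : Mem → Prop} (h : c.IsSimple = true)
    (hN : c.cost ≤ N) (hQ : Q (c.eval s)) : Ends c s N Q :=
  (Ends.simple h hQ).mono hN fun _ h => h

theorem Ends.seq {c d : Cmd} {s : Mem} {N N' : ℕ} {R Q : Mem → Prop} (h : Ends c s N R)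
    (h' : ∀ s₁, R s₁ → Ends d s₁ N' Q) : Ends (.seq c d) s (N + N' + 1) Q := by
  obtain ⟨t, ht, s₁, h1, hR⟩ := h
  obtain ⟨t', ht', s₂, h2, hQ⟩ := h' s₁ hR
  exact ⟨t + t' + 1, by omega, s₂, .seq h1 h2, hQ⟩

theorem Ends.seq_le {c d : Cmd} {s : Mem} {N N' M : ℕ} {R Q : Mem → Prop} (h : Ends c s N R)
    (h' : ∀ s₁, R s₁ → Ends d s₁ N' Q) (hM : N + N' + 1 ≤ M) : Ends (.seq c d) s M Q :=
  (h.seq h').mono hM fun _ h => h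

theorem Ends.ite {b : Test} {c d : Cmd} {s : Mem} {N : ℕ} {Q : Mem → Prop}
    (h : b.eval s = true → Ends c s N Q) (h' : b.eval s = false → Ends d s N Q) :
    Ends (.ite b c d) s (N + 1) Q := by
  by_cases hb : b.eval s = true
  · obtain ⟨t, ht, s₁, h1, hR⟩ := h hb
    exact ⟨t + 1, by omega, s₁, .ite (by rwa [if_pos hb]), hR⟩
  · obtain ⟨t, ht, s₁, h1, hR⟩ := h' (by simpa using hb)
    exact ⟨t + 1, by omega, s₁, .ite (by rwa [if_neg hb]), hR⟩

/-- `s'` agrees with `s` in all variables and arrays to which `c` does not assign. -/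
structure Unchanged (c : Cmd) (s s' : Mem) : Prop where
  var : ∀ x, c.writesVar x = false → s'.var x = s.var x
  arr : ∀ a, c.writesArr a = false → s'.arr a = s.arr a

theorem Unchanged.refl (c : Cmd) (s : Mem) : Unchanged c s s := ⟨fun _ _ => rfl, fun _ _ => rfl⟩

theorem Unchanged.trans {c : Cmd} {s s' s'' : Mem} (h : Unchanged c s s')
    (h' : Unchanged c s' s'') : Unchanged c s s'' :=
  ⟨fun x hx => (h'.var x hx).trans (h.var x hx), fun a ha => (h'.arr a ha).trans (h.arr a ha)⟩

/-- The frame rule. It is read off from the syntax, so that for concrete programs its side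
conditions are settled by `decide`. -/
theorem Exec.unchanged {c : Cmd} {s : Mem} {t : ℕ} {τ : List Mem} {s' : Mem}
    (h : Exec c s t τ s') : Unchanged c s s' := by
  induction h with
  | skip s => exact .refl _ s
  | const x n s => exact ⟨fun y hy => by simp_all [Cmd.writesVar], fun a _ => rfl⟩
  | copy x n s => exact ⟨fun y hy => by simp_all [Cmd.writesVar], fun a _ => rfl⟩
  | succ x s => exact ⟨fun y hy => by simp_all [Cmd.writesVar], fun a _ => rfl⟩
  | pred x s => exact ⟨fun y hy => by simp_all [Cmd.writesVar], fun a _ => rfl⟩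
  | load x a i s => exact ⟨fun y hy => by simp_all [Cmd.writesVar], fun a _ => rfl⟩
  | store a i x s => exact ⟨fun y _ => rfl, fun b hb => by simp_all [Cmd.writesArr]⟩
  | seq _ _ ih ih' =>
    constructor
    · intro x hx
      simp only [Cmd.writesVar, Bool.or_eq_false_iff] at hx
      rw [ih'.var x hx.2, ih.var x hx.1]
    · intro a ha
      simp only [Cmd.writesArr, Bool.or_eq_false_iff] at ha
      rw [ih'.arr a ha.2, ih.arr a ha.1]
  | ite _ ih =>
    constructor
    · intro x hx
      simp only [Cmd.writesVar, Bool.or_eq_false_iff] at hx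
      exact ih.var x (by split_ifs <;> simp [hx])
    · intro a ha
      simp only [Cmd.writesArr, Bool.or_eq_false_iff] at ha
      exact ih.arr a (by split_ifs <;> simp [ha])
  | loop_false _ => exact .refl _ _
  | loop_true _ _ _ ih ih₁ => exact Unchanged.trans ⟨ih.var, ih.arr⟩ ih₁

/-- The command assigns to none of the given variables and arrays. -/
def Cmd.avoids (c : Cmd) (vs as : List ℕ) : Bool :=
  vs.all (fun x => !c.writesVar x) && as.all fun a => !c.writesArr a

theorem Unchanged.of_avoids {c : Cmd} {s s' : Mem} (h : Unchanged c s s') {vs as : List ℕ}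
    (hc : c.avoids vs as = true) :
    (∀ x ∈ vs, s'.var x = s.var x) ∧ ∀ a ∈ as, s'.arr a = s.arr a := by
  simp only [Cmd.avoids, Bool.and_eq_true, List.all_eq_true, Bool.not_eq_true'] at hc
  exact ⟨fun x hx => h.var x (hc.1 x hx), fun a ha => h.arr a (hc.2 a ha)⟩

theorem Ends.unchanged {c : Cmd} {s : Mem} {N : ℕ} {Q : Mem → Prop} (h : Ends c s N Q) :
    Ends c s N fun s' => Q s' ∧ Unchanged c s s' := by
  obtain ⟨t, ht, s', he, hQ⟩ := h
  exact ⟨t, ht, s', he, hQ, he.unchanged⟩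

/-- A loop that runs through a list; the invariant is indexed by the part of the list that has been
treated and the part that has not. -/
theorem Ends.loop {α : Type*} {b : Test} {c : Cmd} (l : List α)
    (I : List α → List α → Mem → Prop) (f : α → ℕ) {s₀ : Mem} (h0 : I [] l s₀)
    (hstep : ∀ pre x post s, l = pre ++ x :: post → Unchanged c s₀ s → I pre (x :: post) s →
      b.eval s = true ∧ Ends c s (f x) (I (pre ++ [x]) post))
    (hend : ∀ s, Unchanged c s₀ s → I l [] s → b.eval s = false) :
    Ends (.loop b c) s₀ ((l.map fun x => f x + 1).sum + 1)
      fun s => I l [] s ∧ Unchanged c s₀ s := by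
  have key : ∀ post pre s, l = pre ++ post → Unchanged c s₀ s → I pre post s →
      Ends (.loop b c) s ((post.map fun x => f x + 1).sum + 1)
        fun s => I l [] s ∧ Unchanged c s₀ s := by
    intro post
    induction post with
    | nil =>
      intro pre s hl hu hI
      rw [List.append_nil] at hl
      subst hl
      exact ⟨1, by simp, s, .loop_false (hend s hu hI), hI, hu⟩
    | cons x post ih =>
      intro pre s hl hu hI
      obtain ⟨hb, t, ht, s₁, h1, hI1⟩ := hstep pre x post s hl hu hI
      obtain ⟨t', ht', s₂, h2, hQ⟩ := ih (pre ++ [x]) s₁ (by simp [hl]) (hu.trans h1.unchanged) hI1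
      refine ⟨t + t' + 1, ?_, s₂, .loop_true hb h1 h2, hQ⟩
      simp only [List.map_cons, List.sum_cons]
      omega
  exact key l [] s₀ rfl (.refl _ _) h0

/-- A loop that runs `m` times. -/
theorem Ends.loopNat {b : Test} {c : Cmd} (m : ℕ) (I : ℕ → Mem → Prop) (f : ℕ → ℕ) {s₀ : Mem}
    (h0 : I 0 s₀)
    (hstep : ∀ i s, i < m → Unchanged c s₀ s → I i s →
      b.eval s = true ∧ Ends c s (f i) (I (i + 1)))
    (hend : ∀ s, Unchanged c s₀ s → I m s → b.eval s = false) :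
    Ends (.loop b c) s₀ (((List.range m).map fun i => f i + 1).sum + 1)
      fun s => I m s ∧ Unchanged c s₀ s := by
  have := Ends.loop (b := b) (c := c) (List.range m) (fun pre _ s => I pre.length s) f h0 ?_ ?_
  · simpa using this
  · intro pre x post s hl hu hI
    have hx : x = pre.length := by
      have h1 : (List.range m)[pre.length]? = some x := by rw [hl]; simp
      rw [List.getElem?_range (by
        have := congrArg List.length hl
        simp at this
        omega)] at h1
      simpa using h1.symm
    subst hx
    have hlt : pre.length < m := by
      have := congrArg List.length hl
      simp at this
      omega
    simpa using hstep _ s hlt hu hI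
  · intro s hu hI
    rw [List.length_range] at hI
    exact hend s hu hI

end Hoare

/-! ### Renaming of registers -/

section Rename

/-- The part of the memory that a renamed program sees. -/
def view (f : ℕ → ℕ) (s : Mem) : Mem := ⟨fun x => s.var (f x), fun a => s.arr (f a)⟩

/-- `s'` agrees with `s` outside the range of `f`. -/
def AgreeOff (f : ℕ → ℕ) (s s' : Mem) : Prop :=
  ∀ x, (∀ y, f y ≠ x) → s'.var x = s.var x ∧ s'.arr x = s.arr x

theorem AgreeOff.refl (f : ℕ → ℕ) (s : Mem) : AgreeOff f s s := fun _ _ => ⟨rfl, rfl⟩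

theorem AgreeOff.trans {f : ℕ → ℕ} {s s' s'' : Mem} (h : AgreeOff f s s')
    (h' : AgreeOff f s' s'') : AgreeOff f s s'' :=
  fun x hx => ⟨(h' x hx).1.trans (h x hx).1, (h' x hx).2.trans (h x hx).2⟩

variable {f : ℕ → ℕ}

theorem view_setVar (hf : Function.Injective f) (s : Mem) (x n : ℕ) :
    view f (s.setVar (f x) n) = (view f s).setVar x n := by
  refine Mem.ext' (fun y => ?_) (fun _ => rfl)
  simp [view, hf.eq_iff]

theorem view_setArr (hf : Function.Injective f) (s : Mem) (a i n : ℕ) :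
    view f (s.setArr (f a) i n) = (view f s).setArr a i n := by
  refine Mem.ext' (fun _ => rfl) (fun b => ?_)
  simp [view, hf.eq_iff]

theorem agreeOff_setVar (s : Mem) (x n : ℕ) : AgreeOff f s (s.setVar (f x) n) := by
  intro y hy
  simp [Ne.symm (hy x)]

theorem agreeOff_setArr (s : Mem) (a i n : ℕ) : AgreeOff f s (s.setArr (f a) i n) := by
  intro y hy
  simp [Ne.symm (hy a)]

theorem Test.eval_rename (s : Mem) (b : Test) : (b.rename f).eval s = b.eval (view f s) := by
  cases b <;> rfl

/-- The renamed command simulates the original one on the registers in the range of `f`, which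
injectivity keeps apart. Empty traces suffice, because only the pieces of the program between two
stages are renamed. -/
theorem Exec.rename (hf : Function.Injective f) {c : Cmd} {m m' : Mem} {t : ℕ} {τ : List Mem}
    (h : Exec c m t τ m') : ∀ s, view f s = m → τ = [] →
      ∃ s', Exec (c.rename f) s t [] s' ∧ view f s' = m' ∧ AgreeOff f s s' := by
  induction h with
  | skip m => simp
  | const x n m =>
    rintro s rfl -
    exact ⟨_, .const _ _ _, view_setVar hf _ _ _, agreeOff_setVar _ _ _⟩
  | copy x y m =>
    rintro s rfl -
    exact ⟨_, .copy _ _ _, view_setVar hf _ _ _, agreeOff_setVar _ _ _⟩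
  | succ x m =>
    rintro s rfl -
    exact ⟨_, .succ _ _, view_setVar hf _ _ _, agreeOff_setVar _ _ _⟩
  | pred x m =>
    rintro s rfl -
    exact ⟨_, .pred _ _, view_setVar hf _ _ _, agreeOff_setVar _ _ _⟩
  | load x a i m =>
    rintro s rfl -
    exact ⟨_, .load _ _ _ _, view_setVar hf _ _ _, agreeOff_setVar _ _ _⟩
  | store a i x m =>
    rintro s rfl -
    exact ⟨_, .store _ _ _ _, view_setArr hf _ _ _ _, agreeOff_setArr _ _ _ _⟩
  | seq _ _ ih ih' =>
    rintro s hs hτ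
    rw [List.append_eq_nil_iff] at hτ
    obtain ⟨s₁, h1, h2, h3⟩ := ih s hs hτ.1
    obtain ⟨s₂, h1', h2', h3'⟩ := ih' s₁ h2 hτ.2
    exact ⟨s₂, .seq (τ := []) (τ₁ := []) h1 h1', h2', h3.trans h3'⟩
  | @ite b c d m t τ m' _ ih =>
    rintro s rfl hτ
    obtain ⟨s₁, h1, h2, h3⟩ := ih s rfl hτ
    refine ⟨s₁, ?_, h2, h3⟩
    refine .ite ?_
    rw [Test.eval_rename]
    split_ifs at h1 ⊢ <;> exact h1
  | @loop_false b c m hb =>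
    rintro s rfl -
    refine ⟨s, ?_, rfl, .refl _ _⟩
    exact .loop_false (by rwa [Test.eval_rename])
  | @loop_true b c m t τ m₁ t' τ' m₂ hb _ _ ih ih' =>
    rintro s rfl hτ
    rw [List.append_eq_nil_iff] at hτ
    obtain ⟨s₁, h1, h2, h3⟩ := ih s rfl hτ.1
    obtain ⟨s₂, h1', h2', h3'⟩ := ih' s₁ h2 hτ.2
    refine ⟨s₂, ?_, h2', h3.trans h3'⟩
    exact .loop_true (τ := []) (τ₁ := []) (by rwa [Test.eval_rename]) h1 h1'

theorem Ends.rename (hf : Function.Injective f) {c : Cmd} {s : Mem} {N : ℕ} {Q : Mem → Prop}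
    (h : Ends c (view f s) N Q) :
    Ends (c.rename f) s N fun s' => Q (view f s') ∧ AgreeOff f s s' := by
  obtain ⟨t, ht, m', he, hQ⟩ := h
  obtain ⟨s', h1, rfl, h3⟩ := he.rename hf s rfl rfl
  exact ⟨t, ht, s', h1, hQ, h3⟩

end Rename

end AHU

namespace AHU

/-! ### Adjacency lists in one array -/

section Adjacency

namespace AdjLists

variable {n : ℕ} {G : SimpleGraph (Fin n)} (A : AdjLists G)

/-- The position at which the adjacency list of `i` begins. -/
def off (i : ℕ) : ℕ := (((List.finRange n).take i).map fun w => (A.nbrs w).length).sum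

theorem take_finRange_succ (u : Fin n) :
    (List.finRange n).take (u + 1) = (List.finRange n).take u ++ [u] := by
  rw [List.take_add_one]
  simp

theorem off_succ (u : Fin n) : A.off (u + 1) = A.off u + (A.nbrs u).length := by
  rw [off, take_finRange_succ]
  simp [off]

theorem off_mono {i j : ℕ} (h : i ≤ j) : A.off i ≤ A.off j := by
  have hs : ((List.finRange n).take i).Sublist ((List.finRange n).take j) := by
    rw [← Nat.min_eq_left h, ← List.take_take]
    exact List.take_sublist _ _
  exact (hs.map fun w => (A.nbrs w).length).sum_le_sum (fun _ _ => Nat.zero_le _)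

/-- The list of vertices is split at `u`; the adjacency lists before that of `u` have `A.off u`
entries in all. -/
theorem flat_getElem? (u : Fin n) (j : ℕ) (hj : j < (A.nbrs u).length) :
    A.flat[A.off u + j]? = some (A.nbrs u)[j].val := by
  have h : List.finRange n =
      (List.finRange n).take u ++ u :: (List.finRange n).drop (u + 1) := by
    conv_lhs => rw [← List.take_append_drop (u + 1) (List.finRange n), take_finRange_succ]
    simp
  have hlen : (((List.finRange n).take u).flatMap fun w => (A.nbrs w).map Fin.val).length =
      A.off u := by
    simp [List.length_flatMap, off]
  rw [flat, h, List.flatMap_append, List.flatMap_cons, List.getElem?_append_right (by omega),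
    hlen, Nat.add_sub_cancel_left, List.getElem?_append_left (by simpa using hj)]
  simp [hj]

end AdjLists

end Adjacency

/-! ### The layers of a breadth first search -/

section Layers

variable {n : ℕ} {T : RTree (Fin n)} (A : AdjLists T.graph)

/-- The children of `u`, in the order of the adjacency list. -/
noncomputable def children (u : Fin n) : List (Fin n) :=
  (A.nbrs u).filter fun w => decide (w ≠ T.parent u)

/-- The vertices of depth `d`, in the order of a breadth first search. -/
noncomputable def layer : ℕ → List (Fin n)
  | 0 => [T.root]
  | d + 1 => (layer d).flatMap (children A)

/-- The vertices of depth less than `d`, in the order of a breadth first search. -/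
noncomputable def layersBelow : ℕ → List (Fin n)
  | 0 => []
  | d + 1 => layersBelow d ++ layer A d

theorem mem_children {u w : Fin n} : w ∈ children A u ↔ T.IsChild w u := by
  rw [children, List.mem_filter, A.mem_iff, RTree.isChild_iff_adj_ne]
  simp

theorem mem_layer {d : ℕ} {w : Fin n} : w ∈ layer A d ↔ T.depth w = d := by
  induction d generalizing w with
  | zero => simp [layer, RTree.depth_eq_zero]
  | succ d ih =>
    simp only [layer, List.mem_flatMap, mem_children]
    constructor
    · rintro ⟨u, hu, hw⟩
      rw [hw.depth, ih.1 hu]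
    · intro hw
      have hr : w ≠ T.root := by
        rintro rfl
        simp at hw
      refine ⟨T.parent w, ih.2 ?_, RTree.isChild_parent hr⟩
      rw [RTree.depth_parent hr] at hw
      omega

theorem nodup_layer (d : ℕ) : (layer A d).Nodup := by
  induction d with
  | zero => simp [layer]
  | succ d ih =>
    rw [layer, List.nodup_flatMap]
    refine ⟨fun u _ => (A.nodup u).filter _, ih.imp ?_⟩
    intro a b hab w hwa hwb
    rw [mem_children] at hwa hwb
    exact hab (hwa.2.symm.trans hwb.2)

theorem mem_layersBelow {d : ℕ} {w : Fin n} : w ∈ layersBelow A d ↔ T.depth w < d := by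
  induction d with
  | zero => simp [layersBelow]
  | succ d ih =>
    rw [layersBelow, List.mem_append, ih, mem_layer]
    omega

theorem nodup_layersBelow (d : ℕ) : (layersBelow A d).Nodup := by
  induction d with
  | zero => simp [layersBelow]
  | succ d ih =>
    rw [layersBelow, List.nodup_append]
    refine ⟨ih, nodup_layer A d, ?_⟩
    rintro a ha b hb rfl
    rw [mem_layersBelow] at ha
    rw [mem_layer] at hb
    omega

theorem layersBelow_perm : (layersBelow A (T.height + 1)).Perm (List.finRange n) := by
  rw [List.perm_ext_iff_of_nodup (nodup_layersBelow A _) (List.nodup_finRange n)]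
  intro w
  rw [mem_layersBelow]
  simpa using Nat.lt_succ_of_le (RTree.depth_le_height w)

theorem layersBelow_prefix {d e : ℕ} (h : d ≤ e) :
    ∃ r, layersBelow A e = layersBelow A d ++ r := by
  induction e, h using Nat.le_induction with
  | base => exact ⟨[], by simp⟩
  | succ e _ ih =>
    obtain ⟨r, hr⟩ := ih
    exact ⟨r ++ layer A e, by rw [layersBelow, hr, List.append_assoc]⟩

/-- The ancestors of a deepest vertex meet every layer. -/
theorem layer_ne_nil {d : ℕ} (h : d ≤ T.height) : layer A d ≠ [] := by
  obtain ⟨w, hw⟩ := RTree.exists_depth_eq_height (T := T)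
  have key : ∀ k w, T.depth w = d + k → ∃ x, T.depth x = d := by
    intro k
    induction k with
    | zero => exact fun w hw => ⟨w, hw⟩
    | succ k ih =>
      intro w hw
      have hr : w ≠ T.root := by
        rintro rfl
        simp at hw
      refine ih (T.parent w) ?_
      rw [RTree.depth_parent hr] at hw
      omega
  obtain ⟨x, hx⟩ := key (T.height - d) w (by omega)
  exact List.ne_nil_of_mem ((mem_layer A).2 hx)

theorem layer_eq_nil : layer A (T.height + 1) = [] := by
  rw [List.eq_nil_iff_forall_not_mem]
  intro w hw
  rw [mem_layer] at hw
  have := RTree.depth_le_height (T := T) w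
  omega

theorem sum_map_layersBelow (f : Fin n → ℕ) (d : ℕ) :
    ((layersBelow A d).map f).sum = ((List.range d).map fun e => ((layer A e).map f).sum).sum := by
  induction d with
  | zero => simp [layersBelow]
  | succ d ih => simp [layersBelow, List.range_succ, ih]

/-- A vertex has only one parent, so the lists of children are disjoint. -/
theorem length_flatMap_children_le (d : ℕ) :
    ((layersBelow A d).flatMap (children A)).length ≤ n := by
  have hn : ((layersBelow A d).flatMap (children A)).Nodup := by
    rw [List.nodup_flatMap]
    refine ⟨fun u _ => (A.nodup u).filter _, (nodup_layersBelow A d).imp ?_⟩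
    intro a b hab w hwa hwb
    rw [mem_children] at hwa hwb
    exact hab (hwa.2.symm.trans hwb.2)
  simpa using hn.length_le_card

theorem length_nbrs_le (u : Fin n) : (A.nbrs u).length ≤ (children A u).length + 1 := by
  have h : (A.nbrs u).length = (children A u).length +
      ((A.nbrs u).filter fun w => decide (w = T.parent u)).length := by
    rw [children, List.length_eq_length_filter_add (fun w => decide (w ≠ T.parent u))]
    simp
  rw [h]
  have : ((A.nbrs u).filter fun w => decide (w = T.parent u)).length ≤ 1 := by
    have hs : ((A.nbrs u).filter fun w => decide (w = T.parent u)) ⊆ [T.parent u] := by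
      intro w hw
      rw [List.mem_filter] at hw
      simpa using hw.2
    simpa using (((A.nodup u).filter _).subperm hs).length_le
  omega

/-- Each vertex has at most one neighbour that is not a child, and the lists of children are
disjoint. This bounds the number of entries that the search reads. -/
theorem sum_length_nbrs_le (d : ℕ) :
    ((layersBelow A d).map fun u => (A.nbrs u).length).sum ≤ 2 * n := by
  have h1 : ((layersBelow A d).map fun u => (A.nbrs u).length).sum ≤
      ((layersBelow A d).map fun u => (children A u).length + 1).sum :=
    List.sum_le_sum fun u _ => length_nbrs_le A u
  have h2 := length_flatMap_children_le A d
  have h3 : (layersBelow A d).length ≤ n := by simpa using (nodup_layersBelow A d).length_le_card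
  rw [List.length_flatMap] at h2
  rw [List.sum_map_add] at h1
  simp only [List.map_const', List.sum_replicate, smul_eq_mul, mul_one] at h1
  omega

/-- Each of the `T.height + 1` layers contributes a vertex. Hence a constant cost per level can be
charged to the vertices. -/
theorem height_lt (A : AdjLists T.graph) : T.height < n := by
  have h : ∀ d ≤ T.height + 1, d ≤ (layersBelow (T := T) A d).length := by
    intro d
    induction d with
    | zero => simp
    | succ d ih =>
      intro hd
      have := List.length_pos_iff.2 (layer_ne_nil A (d := d) (by omega))
      have := ih (by omega)
      rw [layersBelow, List.length_append]
      omega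
  have h1 := h (T.height + 1) le_rfl
  rw [(layersBelow_perm A).length_eq, List.length_finRange] at h1
  exact h1

/-- The levels, listed in the order of a breadth first search. -/
noncomputable def bfsLevels : LevelLists T where
  list i := if i ≤ T.height then layer A (T.height - i) else []
  nodup i := by
    split_ifs
    · exact nodup_layer A _
    · exact List.nodup_nil
  mem_iff i w := by
    have := RTree.level_add_depth (T := T) w
    split_ifs
    · rw [mem_layer]
      omega
    · simp only [List.not_mem_nil, false_iff]
      omega

end Layers

end AHU

namespace AHU

open Cmd

/-! ### Registers of the program for one tree -/

section Registers

notation "vRoot" => (1 : ℕ)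
notation "vHeight" => (2 : ℕ)
notation "vSize" => (3 : ℕ)
notation "vLevel" => (4 : ℕ)
notation "vOldSize" => (5 : ℕ)
notation "vFresh" => (6 : ℕ)
notation "vTop" => (7 : ℕ)
notation "vZero" => (8 : ℕ)
notation "vHead" => (9 : ℕ)
notation "vTail" => (10 : ℕ)
notation "vStop" => (11 : ℕ)
notation "vCount" => (12 : ℕ)
notation "vDepth" => (13 : ℕ)
notation "vI" => (14 : ℕ)
notation "vJ" => (15 : ℕ)
notation "vEnd" => (16 : ℕ)
notation "vU" => (17 : ℕ)
notation "vP" => (18 : ℕ)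
notation "vW" => (19 : ℕ)
notation "vX" => (20 : ℕ)
notation "vY" => (21 : ℕ)
notation "vK" => (22 : ℕ)

notation "aOff" => (0 : ℕ)
notation "aFlat" => (1 : ℕ)
notation "aParent" => (2 : ℕ)
notation "aLvlStart" => (3 : ℕ)
notation "aLvlLen" => (4 : ℕ)
notation "aQueue" => (5 : ℕ)
notation "aTupEnd" => (6 : ℕ)
notation "aDepthStart" => (7 : ℕ)
notation "aDepthLen" => (8 : ℕ)
notation "aVerts" => (9 : ℕ)
notation "aOld" => (10 : ℕ)
notation "aInt" => (11 : ℕ)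
notation "aTupLen" => (12 : ℕ)
notation "aTupData" => (13 : ℕ)
notation "aListed" => (14 : ℕ)
notation "aNode" => (15 : ℕ)
notation "aLastKey" => (16 : ℕ)
notation "aLastChild" => (17 : ℕ)
notation "aNext" => (18 : ℕ)
notation "aBucket" => (19 : ℕ)
notation "aLink" => (20 : ℕ)

/-- The layout of the data of one tree. -/
def treeLayout : Layout where
  height := vHeight
  lvlStart := aLvlStart
  lvlLen := aLvlLen
  lvlData := aQueue
  size := vSize
  verts := aVerts
  tupStart := aOff
  tupLen := aTupLen
  tupData := aTupData
  int := aInt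

end Registers

/-! ### Lists stored in slices of arrays -/

section Slice

open Layout

theorem isSlice_iff {s : Mem} {a p : ℕ} {xs : List ℕ} :
    IsSlice s a p xs ↔ ∀ j x, xs[j]? = some x → s.arr a (p + j) = x := by
  constructor
  · intro h j x hx
    rw [List.getElem?_eq_some_iff] at hx
    obtain ⟨hj, rfl⟩ := hx
    exact h j hj
  · intro h j hj
    exact h j _ (List.getElem?_eq_getElem hj)

theorem isSlice_nil (s : Mem) (a p : ℕ) : IsSlice s a p [] := by simp [IsSlice]

theorem isSlice_congr {s s' : Mem} {a p : ℕ} {xs : List ℕ} (h : IsSlice s a p xs)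
    (hs : s'.arr a = s.arr a) : IsSlice s' a p xs := by
  intro j hj
  rw [hs]
  exact h j hj

theorem isSlice_push {s s' : Mem} {a p q x : ℕ} {xs : List ℕ} (h : IsSlice s a p xs)
    (hq : q = p + xs.length) (hs : s'.arr a = Function.update (s.arr a) q x) :
    IsSlice s' a p (xs ++ [x]) := by
  subst hq
  intro j hj
  rw [hs]
  by_cases hj' : j = xs.length
  · subst hj'
    simp
  · rw [List.length_append, List.length_singleton] at hj
    rw [Function.update_of_ne (by omega), List.getElem_append_left (by omega)]
    exact h j (by omega)

theorem isSlice_get {s : Mem} {a p q x : ℕ} {xs ys : List ℕ} (h : IsSlice s a p (xs ++ x :: ys))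
    (hq : q = p + xs.length) : s.arr a q = x := by
  rw [hq]
  exact isSlice_iff.1 h _ _ (by simp)

theorem isSlice_mid {s : Mem} {a p q : ℕ} {xs ys zs : List ℕ} (h : IsSlice s a p (xs ++ ys ++ zs))
    (hq : q = p + xs.length) : IsSlice s a q ys := by
  rw [isSlice_iff] at h ⊢
  intro j x hx
  have hj : j < ys.length := (List.getElem?_eq_some_iff.1 hx).1
  rw [hq, add_assoc]
  apply h
  rw [List.append_assoc, List.getElem?_append_right (by omega), Nat.add_sub_cancel_left,
    List.getElem?_append_left hj, hx]

theorem isSlice_update_of_disjoint {s s' : Mem} {a p q x : ℕ} {xs : List ℕ} (h : IsSlice s a p xs)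
    (hq : q < p ∨ p + xs.length ≤ q) (hs : s'.arr a = Function.update (s.arr a) q x) :
    IsSlice s' a p xs := by
  intro j hj
  rw [hs, Function.update_of_ne (by omega)]
  exact h j hj

end Slice

/-! ### Breadth first search -/

section BfsProgram

/-- Enqueue the children of `vU`, running through its adjacency list. -/
def visitNbrs : Cmd :=
  .loop (.lt vJ vEnd) (block
    [.load vW aFlat vJ,
      .ite (.eq vW vP) nop (block
        [.store aParent vW vU, .store aQueue vTail vW, .succ vTail]),
      .succ vJ])

/-- Treat the vertices of one layer. -/
def visitLayer : Cmd :=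
  .loop (.lt vHead vStop) (.seq (block
    [.load vU aQueue vHead, .load vP aParent vU, .load vJ aOff vU, .store aTupEnd vU vJ,
      .copy vX vU, .succ vX, .load vEnd aOff vX])
    (.seq visitNbrs (block [.succ vCount, .succ vHead])))

/-- Breadth first search, layer by layer. -/
def bfs : Cmd :=
  .seq (block
    [.store aQueue vZero vRoot, .store aParent vRoot vRoot, .const vTail 1, .const vFresh 1])
    (.loop (.lt vHead vTail) (.seq (block
      [.store aDepthStart vDepth vHead, .copy vStop vTail, .const vCount 0])
      (.seq visitLayer (block [.store aDepthLen vDepth vCount, .succ vDepth]))))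

/-- Record the layers as levels. -/
def recordLevels : Cmd :=
  .seq (block [.copy vHeight vDepth, .pred vHeight])
    (.loop (.lt vZero vDepth) (block
      [.pred vDepth, .load vX aDepthStart vDepth, .store aLvlStart vI vX,
        .load vX aDepthLen vDepth, .store aLvlLen vI vX, .succ vI]))

/-- Compute parents, height and levels. -/
def preprocess : Cmd := .seq bfs recordLevels

end BfsProgram

section Bfs

open Layout

variable {n : ℕ} {T : RTree (Fin n)} (A : AdjLists T.graph)

/-- The memory holds the adjacency lists. -/
structure HoldsAdj (s : Mem) : Prop where
  off : ∀ i ≤ n, s.arr aOff i = A.off i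
  flat : ∀ (u : Fin n), IsSlice s aFlat (A.off u) ((A.nbrs u).map Fin.val)

/-- The vertices `Q` have been enqueued, and their parents are known. -/
structure HoldsQueue (T : RTree (Fin n)) (s : Mem) (Q : List (Fin n)) : Prop where
  queue : IsSlice s aQueue 0 (Q.map Fin.val)
  tail : s.var vTail = Q.length
  parent : ∀ x ∈ Q, s.arr aParent x = (T.parent x).val

variable {A}

theorem HoldsAdj.congr {s s' : Mem} (h : HoldsAdj A s) (h0 : s'.arr aOff = s.arr aOff)
    (h1 : s'.arr aFlat = s.arr aFlat) : HoldsAdj A s' :=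
  ⟨fun i hi => by rw [h0, h.off i hi], fun u => isSlice_congr (h.flat u) h1⟩

theorem HoldsQueue.congr {s s' : Mem} {Q : List (Fin n)} (h : HoldsQueue T s Q)
    (h1 : s'.arr aQueue = s.arr aQueue) (h2 : s'.var vTail = s.var vTail)
    (h3 : s'.arr aParent = s.arr aParent) : HoldsQueue T s' Q :=
  ⟨isSlice_congr h.queue h1, h2.trans h.tail, fun x hx => by rw [h3, h.parent x hx]⟩

theorem HoldsQueue.push {s s' : Mem} {Q : List (Fin n)} (h : HoldsQueue T s Q) {w : Fin n}
    (h1 : s'.arr aQueue = Function.update (s.arr aQueue) (s.var vTail) w)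
    (h2 : s'.var vTail = s.var vTail + 1)
    (h3 : s'.arr aParent = Function.update (s.arr aParent) w (T.parent w)) :
    HoldsQueue T s' (Q ++ [w]) := by
  refine ⟨?_, ?_, ?_⟩
  · rw [List.map_append]
    exact isSlice_push h.queue (by simp [h.tail]) h1
  · rw [h2, h.tail]
    simp
  · intro x hx
    rw [h3, Function.update_apply]
    split_ifs with hxw
    · rw [Fin.ext hxw]
    · rcases List.mem_append.1 hx with hx | hx
      · exact h.parent x hx
      · rw [List.mem_singleton] at hx
        exact absurd (congrArg Fin.val hx) hxw

/-- A neighbour other than the parent is a child, so that `u` is the right entry for its parent.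
Each entry costs `11` steps and one test. -/
theorem visitNbrs_spec {s : Mem} {u : Fin n} {Q : List (Fin n)} (hA : HoldsAdj A s)
    (hQ : HoldsQueue T s Q) (hJ : s.var vJ = A.off u) (hEnd : s.var vEnd = A.off (u + 1))
    (hU : s.var vU = u) (hP : s.var vP = T.parent u) :
    Ends visitNbrs s (12 * (A.nbrs u).length + 1) fun s' =>
      HoldsQueue T s' (Q ++ children A u) ∧ Unchanged visitNbrs s s' := by
  have := Ends.loop (b := .lt vJ vEnd) (c := block
    [.load vW aFlat vJ,
      .ite (.eq vW vP) nop (block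
        [.store aParent vW vU, .store aQueue vTail vW, .succ vTail]),
      .succ vJ]) (A.nbrs u)
    (fun pre _ s' => HoldsQueue T s' (Q ++ pre.filter fun w => decide (w ≠ T.parent u)) ∧
      s'.var vJ = A.off u + pre.length) (fun _ => 11) (s₀ := s) ?_ ?_ ?_
  · refine Ends.unchanged (this.mono ?_ ?_)
    · simp
      omega
    · rintro s' ⟨⟨h, -⟩, -⟩
      exact h
  · exact ⟨by simpa using hQ, by simpa using hJ⟩
  · rintro pre w post s' hl hu ⟨hI, hJ'⟩
    have hlen := congrArg List.length hl
    rw [List.length_append, List.length_cons] at hlen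
    have hEnd' : s'.var vEnd = A.off (u + 1) := (hu.var vEnd (by decide)).trans hEnd
    have hU' : s'.var vU = u := (hu.var vU (by decide)).trans hU
    have hP' : s'.var vP = T.parent u := (hu.var vP (by decide)).trans hP
    have hw : s'.arr aFlat (s'.var vJ) = w := by
      rw [hu.arr aFlat (by decide), hJ']
      refine isSlice_get (xs := pre.map Fin.val) (ys := post.map Fin.val) (p := A.off u) ?_
        (by simp)
      have := hA.flat u
      rw [hl] at this
      simpa using this
    refine ⟨?_, ?_⟩
    · simp only [Test.eval, hJ', hEnd', A.off_succ, decide_eq_true_eq]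
      omega
    · refine Ends.simple_le (by decide) (by decide) ?_
      rw [List.filter_append, List.length_append, List.length_singleton, ← add_assoc, ← hJ']
      by_cases hwp : w = T.parent u
      · refine ⟨?_, by simp [block, Cmd.eval, Test.eval, hw, hP', hwp]⟩
        rw [List.filter_singleton, decide_eq_false (by simpa using hwp)]
        simp only [List.append_nil, cond_false]
        exact hI.congr (by simp [block, Cmd.eval, Test.eval, hw, hP', hwp])
          (by simp [block, Cmd.eval, Test.eval, hw, hP', hwp])
          (by simp [block, Cmd.eval, Test.eval, hw, hP', hwp])
      · have hne : (w : ℕ) ≠ T.parent u := fun h => hwp (Fin.ext h)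
        have hpw : T.parent w = u := by
          refine ((mem_children A).1 (List.mem_filter.2 ⟨?_, by simpa using hwp⟩)).2
          rw [hl]
          simp
        refine ⟨?_, by simp [block, Cmd.eval, Test.eval, hw, hP', hne]⟩
        rw [List.filter_singleton, decide_eq_true hwp]
        rw [cond_true, ← List.append_assoc]
        exact hI.push (by simp [block, Cmd.eval, Test.eval, hw, hP', hne])
          (by simp [block, Cmd.eval, Test.eval, hw, hP', hne])
          (by simp [block, Cmd.eval, Test.eval, hw, hP', hne, hpw, hU'])
  · rintro s' hu ⟨-, hJ'⟩
    have hEnd' : s'.var vEnd = A.off (u + 1) := (hu.var vEnd (by decide)).trans hEnd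
    simp only [Test.eval, hJ', hEnd', A.off_succ, decide_eq_false_iff_not]
    omega

/-- During the treatment of a layer the queue contains the whole layer, followed by the children of
its treated vertices. On the way `aTupEnd` is set to the beginning of the block in which the tuple
of the vertex will be stored. -/
theorem visitLayer_spec {s : Mem} {d : ℕ} (hA : HoldsAdj A s)
    (hQ : HoldsQueue T s (layersBelow A (d + 1))) (hHead : s.var vHead = (layersBelow A d).length)
    (hStop : s.var vStop = (layersBelow A (d + 1)).length) (hCount : s.var vCount = 0)
    (hEnd : ∀ x ∈ layersBelow A d, s.arr aTupEnd x = A.off x) :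
    Ends visitLayer s (((layer A d).map fun u => 12 * (A.nbrs u).length + 20).sum + 1) fun s' =>
      (HoldsQueue T s' (layersBelow A (d + 2)) ∧
      s'.var vHead = (layersBelow A (d + 1)).length ∧ s'.var vCount = (layer A d).length ∧
      ∀ x ∈ layersBelow A (d + 1), s'.arr aTupEnd x = A.off x) ∧ Unchanged visitLayer s s' := by
  have := Ends.loop (b := .lt vHead vStop) (c := .seq (block
    [.load vU aQueue vHead, .load vP aParent vU, .load vJ aOff vU, .store aTupEnd vU vJ,
      .copy vX vU, .succ vX, .load vEnd aOff vX])
    (.seq visitNbrs (block [.succ vCount, .succ vHead]))) (layer A d)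
    (fun pre _ s' => HoldsQueue T s' (layersBelow A (d + 1) ++ pre.flatMap (children A)) ∧
      s'.var vHead = (layersBelow A d).length + pre.length ∧ s'.var vCount = pre.length ∧
      ∀ x ∈ layersBelow A d ++ pre, s'.arr aTupEnd x = A.off x)
    (fun u => 12 * (A.nbrs u).length + 19) (s₀ := s) ?_ ?_ ?_
  · refine Ends.unchanged (this.mono le_rfl ?_)
    rintro s' ⟨⟨h1, h2, h3, h4⟩, -⟩
    refine ⟨?_, ?_, h3, ?_⟩
    · rw [layersBelow]
      exact h1
    · rw [h2, layersBelow, List.length_append]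
    · rw [layersBelow]
      exact h4
  · refine ⟨by simpa using hQ, by simpa using hHead, by simpa using hCount, by simpa using hEnd⟩
  · rintro pre u post s' hl hu ⟨h1, h2, h3, h4⟩
    have hlen := congrArg List.length hl
    rw [List.length_append, List.length_cons] at hlen
    have hStop' : s'.var vStop = (layersBelow A (d + 1)).length :=
      (hu.var vStop (by decide)).trans hStop
    have hA' : HoldsAdj A s' := hA.congr (hu.arr aOff (by decide)) (hu.arr aFlat (by decide))
    have hu' : s'.arr aQueue (s'.var vHead) = u := by
      have := h1.queue
      rw [layersBelow, hl] at this
      refine isSlice_get (xs := (layersBelow A d ++ pre).map Fin.val) (p := 0)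
        (ys := (post ++ pre.flatMap (children A)).map Fin.val) ?_ (by simp [h2])
      simpa using this
    rw [h2] at hu'
    have hp : s'.arr aParent u = (T.parent u).val := by
      refine h1.parent u ?_
      rw [layersBelow, hl]
      simp
    refine ⟨?_, ?_⟩
    · simp only [Test.eval, h2, hStop', layersBelow, List.length_append, decide_eq_true_eq]
      omega
    · refine (Ends.seq (N := 13) (N' := 12 * (A.nbrs u).length + 1 + 3 + 1) (R := fun s₁ =>
        HoldsAdj A s₁ ∧ HoldsQueue T s₁ (layersBelow A (d + 1) ++ pre.flatMap (children A)) ∧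
        s₁.var vJ = A.off u ∧ s₁.var vEnd = A.off (u + 1) ∧ s₁.var vU = u ∧
        s₁.var vP = T.parent u ∧ s₁.var vHead = (layersBelow A d).length + pre.length ∧
        s₁.var vCount = pre.length ∧
        ∀ x ∈ layersBelow A d ++ (pre ++ [u]), s₁.arr aTupEnd x = A.off x) ?_ ?_).mono
        (by omega) (fun _ h => h)
      · refine Ends.simple_le (by decide) (by decide) ?_
        refine ⟨hA'.congr ?_ ?_, h1.congr ?_ ?_ ?_, ?_, ?_, ?_, ?_, ?_, ?_, ?_⟩
        all_goals try simp [block, Cmd.eval, hu', hp, h2, h3, hA'.off u u.2.le, hA'.off (u + 1) u.2]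
        intro x hx
        rw [Function.update_apply]
        split_ifs with hxu
        · rw [hxu]
        · refine h4 x ?_
          simp only [List.mem_append]
          rcases hx with hx | hx | hx
          · exact Or.inl hx
          · exact Or.inr hx
          · exact absurd (congrArg Fin.val hx) hxu
      · rintro s₁ ⟨g1, g2, g3, g4, g5, g6, g7, g8, g9⟩
        refine (Ends.seq (N' := 3) (visitNbrs_spec g1 g2 g3 g4 g5 g6) ?_).mono le_rfl
          (fun _ h => h)
        rintro s₂ ⟨k1, k2⟩
        have e7 := k2.var vHead (by decide)
        have e8 := k2.var vCount (by decide)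
        have e9 := k2.arr aTupEnd (by decide)
        refine Ends.simple_le (by decide) (by decide) ?_
        rw [List.flatMap_append, ← List.append_assoc, List.flatMap_singleton]
        refine ⟨k1.congr ?_ ?_ ?_, ?_, ?_, ?_⟩
        all_goals try simp [block, Cmd.eval, e7, e8, g7, g8, add_assoc]
        rw [e9]
        simpa using g9
  · rintro s' hu ⟨-, h2, -⟩
    have hStop' : s'.var vStop = (layersBelow A (d + 1)).length :=
      (hu.var vStop (by decide)).trans hStop
    simp only [Test.eval, h2, hStop', layersBelow, List.length_append, decide_eq_false_iff_not]
    omega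

/-- Every layer up to the height is nonempty and the next one is empty, so the head of the queue
meets the tail exactly after `T.height + 1` rounds. -/
theorem bfs_spec {s : Mem} (hA : HoldsAdj A s) (hroot : s.var vRoot = T.root)
    (hzero : s.var vZero = 0) (hhead : s.var vHead = 0) (hdepth : s.var vDepth = 0) :
    Ends bfs s (70 * n) fun s' =>
      (HoldsQueue T s' (layersBelow A (T.height + 1)) ∧ s'.var vDepth = T.height + 1 ∧
      s'.var vFresh = 1 ∧ (∀ d ≤ T.height, s'.arr aDepthStart d = (layersBelow A d).length ∧
        s'.arr aDepthLen d = (layer A d).length) ∧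
      ∀ x : Fin n, s'.arr aTupEnd x = A.off x) ∧ Unchanged bfs s s' := by
  refine Ends.unchanged ?_
  refine (Ends.seq (N := 7) (N' := 59 * n) (R := fun s₁ => HoldsAdj A s₁ ∧
    HoldsQueue T s₁ (layersBelow A 1) ∧ s₁.var vFresh = 1 ∧ s₁.var vHead = 0 ∧
    s₁.var vDepth = 0) ?_ ?_).mono ?_ (fun _ h => h)
  · refine Ends.simple_le (by decide) (by decide) ?_
    refine ⟨hA.congr ?_ ?_, ⟨?_, ?_, ?_⟩, ?_, ?_, ?_⟩
    all_goals simp [block, Cmd.eval, layersBelow, layer, hzero, hhead, hdepth, hroot, IsSlice]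
  · rintro s₁ ⟨g1, g2, g3, g4, g5⟩
    refine (Ends.loopNat (T.height + 1) (fun d s' => HoldsQueue T s' (layersBelow A (d + 1)) ∧
      s'.var vHead = (layersBelow A d).length ∧ s'.var vDepth = d ∧
      (∀ e < d, s'.arr aDepthStart e = (layersBelow A e).length ∧
        s'.arr aDepthLen e = (layer A e).length) ∧
      ∀ x ∈ layersBelow A d, s'.arr aTupEnd x = A.off x)
      (fun d => ((layer A d).map fun u => 12 * (A.nbrs u).length + 20).sum + 11) ?_ ?_ ?_).mono
      ?_ ?_
    · exact ⟨g2, by simpa [layersBelow] using g4, g5, by simp, by simp [layersBelow]⟩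
    · rintro d s' hd hu ⟨h1, h2, h3, h4, h5⟩
      have hA' : HoldsAdj A s' := g1.congr (hu.arr aOff (by decide)) (hu.arr aFlat (by decide))
      refine ⟨?_, ?_⟩
      · have := List.length_pos_iff.2 (layer_ne_nil A (d := d) (by omega))
        simp only [Test.eval, h2, h1.tail, layersBelow, List.length_append, decide_eq_true_eq]
        omega
      · refine (Ends.seq (N := 5)
          (N' := ((layer A d).map fun u => 12 * (A.nbrs u).length + 20).sum + 1 + 3 + 1)
          (R := fun s₂ => HoldsAdj A s₂ ∧
          HoldsQueue T s₂ (layersBelow A (d + 1)) ∧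
          s₂.var vHead = (layersBelow A d).length ∧
          s₂.var vStop = (layersBelow A (d + 1)).length ∧ s₂.var vCount = 0 ∧
          s₂.var vDepth = d ∧ (∀ x ∈ layersBelow A d, s₂.arr aTupEnd x = A.off x) ∧
          (∀ e < d + 1, s₂.arr aDepthStart e = (layersBelow A e).length) ∧
          (∀ e < d, s₂.arr aDepthLen e = (layer A e).length)) ?_ ?_).mono ?_
          (fun _ h => h)
        · refine Ends.simple_le (by decide) (by decide) ?_
          refine ⟨hA'.congr ?_ ?_, h1.congr ?_ ?_ ?_, ?_, ?_, ?_, ?_, ?_, ?_, ?_⟩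
          all_goals try simp [block, Cmd.eval, h2, h3, h1.tail]
          · exact h5
          · intro e he
            rw [Function.update_apply]
            split_ifs with hed
            · rw [hed]
            · exact (h4 e (by omega)).1
          · exact fun e he => (h4 e he).2
        · rintro s₂ ⟨k1, k2, k3, k4, k5, k6, k7, k8, k9⟩
          refine (Ends.seq (N' := 3) (visitLayer_spec k1 k2 k3 k4 k5 k7) ?_).mono le_rfl
            (fun _ h => h)
          rintro s₃ ⟨⟨m1, m2, m3, m4⟩, m5⟩
          have e6 := (m5.var vDepth (by decide)).trans k6
          have e8 := m5.arr aDepthStart (by decide)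
          have e9 := m5.arr aDepthLen (by decide)
          refine Ends.simple_le (by decide) (by decide) ?_
          refine ⟨m1.congr ?_ ?_ ?_, ?_, ?_, ?_, ?_⟩
          all_goals try simp [block, Cmd.eval, m2, m3, e6, e8, e9]
          · intro e he
            refine ⟨k8 e (by omega), ?_⟩
            rw [Function.update_apply]
            split_ifs with hed
            · rw [hed]
            · exact k9 e (by omega)
          · exact m4
        · omega
    · rintro s' hu ⟨h1, h2, -⟩
      rw [layersBelow, layer_eq_nil, List.append_nil] at h1
      simp only [Test.eval, h2, h1.tail, decide_eq_false_iff_not]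
      omega
    · have hh := height_lt A
      -- The `12` steps per entry of an adjacency list give `24 * n`, the `20` steps per vertex give
      -- `20 * n`, and `12` is the overhead of a layer.
      have hs : ((List.range (T.height + 1)).map fun d =>
          ((layer A d).map fun u => 12 * (A.nbrs u).length + 20).sum + 11 + 1).sum ≤
          24 * n + 20 * n + 12 * (T.height + 1) := by
        have e1 : ((List.range (T.height + 1)).map fun d =>
            ((layer A d).map fun u => 12 * (A.nbrs u).length + 20).sum + 11 + 1) =
            ((List.range (T.height + 1)).map fun d =>
            ((layer A d).map fun u => 12 * (A.nbrs u).length + 20).sum + 12) := rfl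
        rw [e1, List.sum_map_add, ← sum_map_layersBelow, List.sum_map_add, List.sum_map_mul_left]
        have e2 := sum_length_nbrs_le A (T.height + 1)
        have e3 := (layersBelow_perm A).length_eq
        rw [List.length_finRange] at e3
        simp only [List.map_const', List.sum_replicate, smul_eq_mul, e3, List.length_range]
        omega
      omega
    · rintro s' ⟨⟨h1, h2, h3, h4, h5⟩, h6⟩
      rw [layersBelow, layer_eq_nil, List.append_nil] at h1
      refine ⟨h1, h3, (h6.var vFresh (by decide)).trans g3, fun d hd => h4 d (by omega), ?_⟩
      intro x
      refine h5 x ?_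
      rw [mem_layersBelow]
      exact Nat.lt_succ_of_le (RTree.depth_le_height x)
  · have := height_lt A
    omega

variable (A) in
/-- The memory holds the adjacency lists, the parents and the levels. -/
structure Prepared (s : Mem) : Prop where
  adj : HoldsAdj A s
  parent : ∀ x : Fin n, s.arr aParent x = (T.parent x).val
  levels : treeLayout.HoldsLevels s T (bfsLevels A)

/-- The layers stand one after the other in the queue, which therefore serves as the array of the
level lists. Only starts and lengths have to be copied in reverse order, since levels count from the
bottom. -/
theorem recordLevels_spec {s : Mem} (hA : HoldsAdj A s)
    (hQ : HoldsQueue T s (layersBelow A (T.height + 1))) (hD : s.var vDepth = T.height + 1)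
    (hI : s.var vI = 0) (hZ : s.var vZero = 0)
    (hL : ∀ d ≤ T.height, s.arr aDepthStart d = (layersBelow A d).length ∧
        s.arr aDepthLen d = (layer A d).length) :
    Ends recordLevels s (20 * n) fun s' => Prepared A s' ∧ Unchanged recordLevels s s' := by
  have hn := height_lt A
  refine Ends.unchanged ?_
  refine Ends.seq_le (N := 3) (N' := 12 * (T.height + 1) + 1) (R := fun s₁ =>
    s₁.var vDepth = T.height + 1 ∧ s₁.var vI = 0 ∧ s₁.var vZero = 0 ∧
    s₁.var vHeight = T.height ∧ s₁.arr = s.arr) ?_ ?_ (by omega)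
  · refine Ends.simple_le (by decide) (by decide) ?_
    simp [block, Cmd.eval, hD, hI, hZ]
  · rintro s₁ ⟨g1, g2, g3, g4, g5⟩
    refine (Ends.loopNat (T.height + 1) (fun i s' => s'.var vDepth + i = T.height + 1 ∧
      s'.var vI = i ∧ ∀ e < i, s'.arr aLvlStart e = (layersBelow A (T.height - e)).length ∧
        s'.arr aLvlLen e = (layer A (T.height - e)).length) (fun _ => 11) ?_ ?_ ?_).mono ?_ ?_
    · exact ⟨by simpa using g1, g2, by simp⟩
    · rintro i s' hi hu ⟨h1, h2, h3⟩
      have hz : s'.var vZero = 0 := (hu.var vZero (by decide)).trans g3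
      have hs : s'.arr aDepthStart = s.arr aDepthStart :=
        (hu.arr aDepthStart (by decide)).trans (by rw [g5])
      have hl : s'.arr aDepthLen = s.arr aDepthLen :=
        (hu.arr aDepthLen (by decide)).trans (by rw [g5])
      refine ⟨?_, ?_⟩
      · simp only [Test.eval, hz, decide_eq_true_eq]
        omega
      · refine Ends.simple_le (by decide) (by decide) ?_
        have hd : s'.var vDepth - 1 = T.height - i := by omega
        obtain ⟨l1, l2⟩ := hL (T.height - i) (by omega)
        simp only [block, Cmd.eval, hs, hl, hd, h2, Mem.setVar_var, Mem.setArr_var,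
          Mem.setVar_arr, Mem.setArr_arr]
        simp only [Nat.reduceEqDiff, if_true, if_false, true_and, l1, l2]
        refine ⟨by omega, ?_⟩
        intro e he
        rw [Function.update_apply, Function.update_apply]
        split_ifs with hei
        · rw [hei]
          exact ⟨rfl, rfl⟩
        · exact h3 e (by omega)
    · rintro s' hu ⟨h1, -⟩
      have hz : s'.var vZero = 0 := (hu.var vZero (by decide)).trans g3
      simp only [Test.eval, hz, decide_eq_false_iff_not]
      omega
    · simp
      omega
    · rintro s' ⟨⟨-, -, h3⟩, hu⟩
      have harr : ∀ a, a ≠ aLvlStart → a ≠ aLvlLen → s'.arr a = s.arr a := by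
        intro a h1 h2
        rw [hu.arr a, g5]
        simp [block, Cmd.writesArr, h1, h2]
      have hQ' := hQ.queue
      refine ⟨hA.congr (harr _ (by decide) (by decide)) (harr _ (by decide) (by decide)),
        ?_, ?_, ?_⟩
      · intro x
        rw [harr _ (by decide) (by decide)]
        refine hQ.parent x ?_
        rw [mem_layersBelow]
        exact Nat.lt_succ_of_le (RTree.depth_le_height x)
      · exact (hu.var vHeight (by decide)).trans g4
      · intro i hi
        obtain ⟨l1, l2⟩ := h3 i (by omega)
        simp only [treeLayout, bfsLevels, hi, if_true]
        refine ⟨l2, ?_⟩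
        obtain ⟨r, hr⟩ := layersBelow_prefix A (d := T.height - i + 1) (e := T.height + 1)
          (by omega)
        refine isSlice_congr ?_ (harr aQueue (by decide) (by decide))
        rw [hr, layersBelow, List.map_append, List.map_append] at hQ'
        exact isSlice_mid hQ' (by simp [l1])

theorem preprocess_spec {s : Mem} (hA : HoldsAdj A s) (hroot : s.var vRoot = T.root)
    (hvar : ∀ x ≥ 2, s.var x = 0) :
    Ends preprocess s (91 * n) fun s' =>
      (Prepared A s' ∧ s'.var vFresh = 1 ∧ ∀ x : Fin n, s'.arr aTupEnd x = A.off x) ∧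
        Unchanged preprocess s s' := by
  have hn := height_lt A
  refine Ends.unchanged ?_
  refine Ends.seq_le (bfs_spec hA hroot (hvar _ (by decide)) (hvar _ (by decide))
    (hvar _ (by decide))) (N' := 20 * n) ?_ (by omega)
  rintro s₁ ⟨⟨h1, h2, h3, h4, h5⟩, hu⟩
  refine (recordLevels_spec (hA.congr (hu.arr _ (by decide)) (hu.arr _ (by decide))) h1 h2
    ((hu.var vI (by decide)).trans (hvar _ (by decide)))
    ((hu.var vZero (by decide)).trans (hvar _ (by decide))) h4).mono le_rfl ?_
  rintro s₂ ⟨g1, g2⟩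
  exact ⟨g1, (g2.var vFresh (by decide)).trans h3,
    fun x => by rw [g2.arr aTupEnd (by decide), h5]⟩

end Bfs

end AHU

namespace AHU

open Cmd

/-! ### Creating the labels -/

section CreateProgram

/-- Save the current list of vertices. -/
def saveList : Cmd :=
  .seq (block [.copy vOldSize vSize, .const vI 0])
    (.loop (.lt vI vOldSize) (block [.load vX aVerts vI, .store aOld vI vX, .succ vI]))

/-- List the leaves of the level. -/
def listLeaves : Cmd :=
  .seq (block [.const vSize 0, .const vI 0, .load vJ aLvlStart vLevel, .load vStop aLvlLen vLevel])
    (.loop (.lt vI vStop) (block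
      [.load vW aQueue vJ, .load vX aOff vW, .succ vX, .copy vY vW, .succ vY, .load vEnd aOff vY,
        .ite (.lt vX vEnd) nop (block
          [.const vK 1, .store aListed vW vK, .store aVerts vSize vW, .succ vSize]),
        .succ vJ, .succ vI]))

/-- Append the integer labels of the saved list to the labels of the parents. -/
def appendInts : Cmd :=
  .seq (.const vI 0)
    (.loop (.lt vI vOldSize) (block
      [.load vW aOld vI, .load vK aInt vW, .load vP aParent vW, .load vX aListed vP,
        .ite (.eq vX vZero) (block
          [.const vX 1, .store aListed vP vX, .store aVerts vSize vP, .succ vSize]) nop,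
        .load vX aTupEnd vP, .store aTupData vX vK, .succ vX, .store aTupEnd vP vX,
        .load vX aTupLen vP, .succ vX, .store aTupLen vP vX, .succ vI]))

/-- `CreateLabels`. -/
def create : Cmd := .seq saveList (.seq listLeaves appendInts)

end CreateProgram

section Create

open Layout

variable {n : ℕ} {T : RTree (Fin n)} (A : AdjLists T.graph)

theorem isLeaf_iff (w : Fin n) : T.IsLeaf w ↔ (A.nbrs w).length ≤ 1 := by
  have h : T.graph.neighborSet w = ((A.nbrs w).toFinset : Set (Fin n)) := by
    ext x
    simp [A.mem_iff]
  rw [RTree.IsLeaf, h, Set.encard_coe_eq_coe_finsetCard, List.toFinset_card_of_nodup (A.nodup w)]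
  norm_cast

/-- The entries come from distinct children, hence from distinct neighbours. So the label fits into
the block between the offsets of `v` and of its successor. -/
theorem IsLevelList.length_lab_le {i : ℕ} {K : List (Fin n × ℕ)} (hK : IsLevelList T i K)
    (hi : i ≤ T.height) {L : List (Fin n × ℕ)} (hL : L.Sublist K) (v : Fin n) :
    (lab T L v).length ≤ (A.nbrs v).length := by
  classical
  have hnd : ((L.filter fun q => decide (T.parent q.1 = v)).map Prod.fst).Nodup :=
    hK.nodup.sublist (List.Sublist.map _ (List.filter_sublist.trans hL))
  have hs : ((L.filter fun q => decide (T.parent q.1 = v)).map Prod.fst) ⊆ A.nbrs v := by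
    intro c hc
    obtain ⟨q, hq, rfl⟩ := List.mem_map.1 hc
    rw [List.mem_filter, decide_eq_true_eq] at hq
    rw [A.mem_iff, ← hq.2]
    exact (RTree.isChild_iff.1 (hK.isChild hi (hL.subset hq.1)).1).1
  have := (hnd.subperm hs).length_le
  rw [List.length_map] at this
  rw [lab, List.length_map]
  convert this

/-- The data that do not change within an iteration. -/
structure Base (i : ℕ) (s : Mem) : Prop where
  prepared : Prepared A s
  level : s.var vLevel = i
  zero : s.var vZero = 0

/-- The nodes from `vFresh` on have not been used. -/
structure FreshNodes (s : Mem) : Prop where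
  pos : 1 ≤ s.var vFresh
  lastKey : ∀ u ≥ s.var vFresh, s.arr aLastKey u = 0
  next : ∀ u ≥ s.var vFresh, s.arr aNext u = 0
  bucket : ∀ u ≥ s.var vFresh, s.arr aBucket u = 0

/-- The vertices `O` have been listed, and the list `L` has been treated. -/
structure Labelled (i : ℕ) (O : List (Fin n)) (L : List (Fin n × ℕ)) (s : Mem) : Prop where
  size : s.var vSize = O.length
  verts : IsSlice s aVerts 0 (O.map Fin.val)
  listed : ∀ v : Fin n, i ≤ T.level v → (s.arr aListed v = 0 ↔ v ∉ O)
  tupLen : ∀ v : Fin n, i ≤ T.level v → s.arr aTupLen v = (lab T L v).length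
  tupEnd : ∀ v : Fin n, i ≤ T.level v → s.arr aTupEnd v = A.off v + (lab T L v).length
  tupData : ∀ v : Fin n, i ≤ T.level v → IsSlice s aTupData (A.off v) (lab T L v)

/-- The list `K` has been saved. -/
structure Saved (K : List (Fin n × ℕ)) (s : Mem) : Prop where
  size : s.var vOldSize = K.length
  verts : IsSlice s aOld 0 (K.map fun q => q.1.val)
  ints : ∀ q ∈ K, s.arr aInt q.1 = q.2

/-- The memory before iteration `i`. -/
structure LoopInv (i : ℕ) (K : List (Fin n × ℕ)) (s : Mem) : Prop where
  base : Base A i s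
  nodes : FreshNodes s
  ints : treeLayout.HoldsInts s K
  listed : ∀ v : Fin n, i ≤ T.level v → s.arr aListed v = 0
  tupLen : ∀ v : Fin n, i ≤ T.level v → s.arr aTupLen v = 0
  tupEnd : ∀ v : Fin n, i ≤ T.level v → s.arr aTupEnd v = A.off v

/-- The memory after the labels of level `i` have been created. -/
structure Created (i : ℕ) (K : List (Fin n × ℕ)) (s : Mem) : Prop where
  base : Base A i s
  nodes : FreshNodes s
  saved : Saved K s
  labelled : Labelled A i (created (bfsLevels A) i K) K s

variable {A} {i : ℕ} {K : List (Fin n × ℕ)}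

/-- The registers on which the property depends are listed explicitly, so that every use is a single
`decide`. -/
theorem Prepared.of_unchanged {c : Cmd} {s s' : Mem} (h : Prepared A s) (hu : Unchanged c s s')
    (hc : c.avoids [vHeight]
      [aOff, aFlat, aParent, aLvlStart, aLvlLen, aQueue] = true) : Prepared A s' := by
  obtain ⟨hv, ha⟩ := hu.of_avoids hc
  simp only [List.mem_cons, List.not_mem_nil, or_false, forall_eq_or_imp, forall_eq] at hv ha
  obtain ⟨h0, h1, h2, h3, h4, h5⟩ := ha
  refine ⟨h.adj.congr h0 h1, fun x => ?_, ?_, fun i hi => ?_⟩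
  · rw [h2, h.parent]
  · exact hv.trans h.levels.1
  · have := h.levels.2 i hi
    simp only [treeLayout] at this ⊢
    rw [h3, h4]
    exact ⟨this.1, isSlice_congr this.2 h5⟩

theorem Base.of_unchanged {c : Cmd} {s s' : Mem} (h : Base A i s) (hu : Unchanged c s s')
    (hc : c.avoids [vHeight] [aOff, aFlat, aParent, aLvlStart, aLvlLen, aQueue] = true)
    (hc' : c.avoids [vLevel, vZero] [] = true) : Base A i s' := by
  have hv := (hu.of_avoids hc').1
  exact ⟨h.prepared.of_unchanged hu hc, (hv _ (by simp)).trans h.level,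
    (hv _ (by simp)).trans h.zero⟩

theorem FreshNodes.of_unchanged {c : Cmd} {s s' : Mem} (h : FreshNodes s) (hu : Unchanged c s s')
    (hc : c.avoids [vFresh] [aLastKey, aNext, aBucket] = true) : FreshNodes s' := by
  obtain ⟨hv, ha⟩ := hu.of_avoids hc
  simp only [List.mem_cons, List.not_mem_nil, or_false, forall_eq_or_imp, forall_eq] at hv ha
  obtain ⟨h1, h2, h3⟩ := ha
  obtain ⟨g1, g2, g3, g4⟩ := h
  rw [← hv] at g1 g2 g3 g4
  exact ⟨g1, by rwa [h1], by rwa [h2], by rwa [h3]⟩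

theorem Saved.of_unchanged {c : Cmd} {s s' : Mem} (h : Saved K s) (hu : Unchanged c s s')
    (hc : c.avoids [vOldSize] [aOld, aInt] = true) : Saved K s' := by
  obtain ⟨hv, ha⟩ := hu.of_avoids hc
  exact ⟨(hv _ (by simp)).trans h.size, isSlice_congr h.verts (ha _ (by simp)),
    fun q hq => by rw [ha aInt (by simp), h.ints q hq]⟩

theorem saveList_spec {s : Mem} (h : treeLayout.HoldsInts s K) :
    Ends saveList s (7 * K.length + 8) fun s' => Saved K s' ∧ Unchanged saveList s s' := by
  refine Ends.unchanged ?_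
  refine Ends.seq_le (N := 3) (N' := 7 * K.length + 1) (R := fun s₁ =>
    s₁.var vOldSize = K.length ∧ s₁.var vI = 0 ∧ s₁.arr = s.arr) ?_ ?_ (by omega)
  · refine Ends.simple_le (by decide) (by decide) ?_
    have := h.1
    simp only [treeLayout] at this
    simp [block, Cmd.eval, this]
  · rintro s₁ ⟨g1, g2, g3⟩
    refine (Ends.loop K (fun pre _ s' => s'.var vI = pre.length ∧
      IsSlice s' aOld 0 (pre.map fun q => q.1.val)) (fun _ => 6) ?_ ?_ ?_).mono ?_ ?_
    · exact ⟨g2, isSlice_nil _ _ _⟩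
    · rintro pre q post s' hl hu ⟨h1, h2⟩
      have hlen := congrArg List.length hl
      rw [List.length_append, List.length_cons] at hlen
      have hsz : s'.var vOldSize = K.length := (hu.var vOldSize (by decide)).trans g1
      have hq : s'.arr aVerts pre.length = q.1 := by
        rw [hu.arr aVerts (by decide), g3]
        refine isSlice_get (xs := pre.map fun q => q.1.val) (p := 0)
          (ys := post.map fun q => q.1.val) ?_ (by simp)
        have := h.2.1
        rw [hl] at this
        simpa [treeLayout] using this
      refine ⟨?_, ?_⟩
      · simp only [Test.eval, h1, hsz, decide_eq_true_eq]
        omega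
      · refine Ends.simple_le (by decide) (by decide) ?_
        refine ⟨by simp [block, Cmd.eval, h1], ?_⟩
        rw [List.map_append]
        exact isSlice_push h2 (q := pre.length) (by simp) (by simp [block, Cmd.eval, h1, hq])
    · rintro s' hu ⟨h1, -⟩
      have hsz : s'.var vOldSize = K.length := (hu.var vOldSize (by decide)).trans g1
      simp [Test.eval, h1, hsz]
    · simp
      omega
    · rintro s' ⟨⟨-, h2⟩, hu⟩
      refine ⟨(hu.var vOldSize (by decide)).trans g1, h2, fun q hq => ?_⟩
      rw [hu.arr aInt (by decide), g3]
      exact h.2.2 q hq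

theorem Labelled.congr {s s' : Mem} {O : List (Fin n)} {L : List (Fin n × ℕ)}
    (h : Labelled A i O L s) (hs : s'.var vSize = s.var vSize) (hv : s'.arr aVerts = s.arr aVerts)
    (hl : s'.arr aListed = s.arr aListed) (h1 : s'.arr aTupLen = s.arr aTupLen)
    (h2 : s'.arr aTupEnd = s.arr aTupEnd) (h3 : s'.arr aTupData = s.arr aTupData) :
    Labelled A i O L s' := by
  refine ⟨hs.trans h.size, isSlice_congr h.verts hv, ?_, ?_, ?_, fun v hi =>
    isSlice_congr (h.tupData v hi) h3⟩
  · rw [hl]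
    exact h.listed
  · rw [h1]
    exact h.tupLen
  · rw [h2]
    exact h.tupEnd

theorem Labelled.push {s s' : Mem} {O : List (Fin n)} {L : List (Fin n × ℕ)}
    (h : Labelled A i O L s) {w : Fin n} (hs : s'.var vSize = s.var vSize + 1)
    (hv : s'.arr aVerts = Function.update (s.arr aVerts) (s.var vSize) w)
    (hl : s'.arr aListed = Function.update (s.arr aListed) w 1)
    (h1 : s'.arr aTupLen = s.arr aTupLen)
    (h2 : s'.arr aTupEnd = s.arr aTupEnd) (h3 : s'.arr aTupData = s.arr aTupData) :
    Labelled A i (O ++ [w]) L s' := by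
  refine ⟨?_, ?_, ?_, ?_, ?_, fun v hi => isSlice_congr (h.tupData v hi) h3⟩
  · rw [hs, h.size]
    simp
  · rw [List.map_append]
    exact isSlice_push h.verts (by simp [h.size]) hv
  · intro v hi
    rw [hl, Function.update_apply]
    split_ifs with hvw
    · simp [Fin.ext hvw]
    · have : v ≠ w := fun h => hvw (congrArg Fin.val h)
      simp [h.listed v hi, this]
  · rw [h1]
    exact h.tupLen
  · rw [h2]
    exact h.tupEnd

/-- No array is cleared between iterations. Marks, lengths and ends of tuples still have their
initial values on level `i` and above, and the invariants speak of these levels only. -/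
theorem listLeaves_spec {s : Mem} (hi : i ≤ T.height) (hb : Base A i s)
    (h1 : ∀ v : Fin n, i ≤ T.level v → s.arr aListed v = 0)
    (h2 : ∀ v : Fin n, i ≤ T.level v → s.arr aTupLen v = 0)
    (h3 : ∀ v : Fin n, i ≤ T.level v → s.arr aTupEnd v = A.off v) :
    Ends listLeaves s (26 * ((bfsLevels A).list i).length + 9) fun s' =>
      Labelled A i (leaves T ((bfsLevels A).list i)) [] s' ∧ Unchanged listLeaves s s' := by
  classical
  refine Ends.unchanged ?_
  set W := (bfsLevels A).list i with hW
  have hlev := hb.prepared.levels.2 i hi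
  simp only [treeLayout] at hlev
  refine Ends.seq_le (N := 7) (N' := 26 * W.length + 1) (R := fun s₁ =>
    s₁.var vSize = 0 ∧ s₁.var vI = 0 ∧ s₁.var vJ = s.arr aLvlStart i ∧
    s₁.var vStop = W.length ∧ s₁.arr = s.arr) ?_ ?_ (by omega)
  · refine Ends.simple_le (by decide) (by decide) ?_
    simp [block, Cmd.eval, hb.level, hlev.1, hW]
  · rintro s₁ ⟨g1, g2, g3, g4, g5⟩
    refine (Ends.loop W (fun pre _ s' => s'.var vI = pre.length ∧
      s'.var vJ = s.arr aLvlStart i + pre.length ∧ Labelled A i (leaves T pre) [] s')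
      (fun _ => 25) ?_ ?_ ?_).mono ?_ ?_
    · refine ⟨g2, by simpa using g3, by simpa [leaves] using g1, isSlice_nil _ _ _, ?_, ?_, ?_, ?_⟩
      · intro v hv
        simp [g5, h1 v hv, leaves]
      · intro v hv
        simp [g5, h2 v hv]
      · intro v hv
        simp [g5, h3 v hv]
      · intro v hv
        exact isSlice_nil _ _ _
    · rintro pre w post s' hl hu ⟨k1, k2, k3⟩
      have hlen := congrArg List.length hl
      rw [List.length_append, List.length_cons] at hlen
      have hst : s'.var vStop = W.length := (hu.var vStop (by decide)).trans g4
      have hw : s'.arr aQueue (s'.var vJ) = w := by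
        rw [hu.arr aQueue (by decide), g5, k2]
        refine isSlice_get (xs := pre.map Fin.val) (ys := post.map Fin.val) ?_
          (p := s.arr aLvlStart i) (by simp)
        have := hlev.2
        rw [← hW, hl] at this
        simpa using this
      have hoff : s'.arr aOff = s.arr aOff := by rw [hu.arr aOff (by decide), g5]
      have ho1 : s'.arr aOff w = A.off w := by rw [hoff, hb.prepared.adj.off w w.2.le]
      have ho2 : s'.arr aOff (w + 1) = A.off w + (A.nbrs w).length := by
        rw [hoff, hb.prepared.adj.off _ w.2, A.off_succ]
      refine ⟨?_, ?_⟩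
      · simp only [Test.eval, k1, hst, decide_eq_true_eq]
        omega
      · refine Ends.simple_le (by decide) (by decide) ?_
        rw [leaves, List.filter_append, List.length_append, List.length_singleton, ← add_assoc,
          ← k2, ← k1]
        by_cases hleaf : T.IsLeaf w
        · have hd := (isLeaf_iff A w).1 hleaf
          have hd' : ¬ 1 < (A.nbrs w).length := by omega
          rw [List.filter_singleton, decide_eq_true hleaf, cond_true]
          refine ⟨?_, ?_, k3.push (w := w) ?_ ?_ ?_ ?_ ?_ ?_⟩
          all_goals simp [block, Cmd.eval, Test.eval, hw, ho1, ho2, hd']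
        · have hd := mt (isLeaf_iff A w).2 hleaf
          have hd' : 1 < (A.nbrs w).length := by omega
          rw [List.filter_singleton, decide_eq_false hleaf, cond_false, List.append_nil]
          refine ⟨?_, ?_, k3.congr ?_ ?_ ?_ ?_ ?_ ?_⟩
          all_goals simp [block, Cmd.eval, Test.eval, hw, ho1, ho2, hd']
    · rintro s' hu ⟨k1, -⟩
      have hst : s'.var vStop = W.length := (hu.var vStop (by decide)).trans g4
      simp [Test.eval, k1, hst]
    · simp
      omega
    · rintro s' ⟨⟨-, -, h⟩, -⟩
      exact h

/-- The entry goes to the first free cell in the block of the parent. Blocks of different vertices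
do not overlap, so no other label is disturbed. -/
theorem Labelled.append {s s' : Mem} {O : List (Fin n)} {L : List (Fin n × ℕ)}
    (hK : IsLevelList T i K) (hi : i ≤ T.height) {q : Fin n × ℕ}
    (hL : (L ++ [q]).Sublist K)
    (h : Labelled A i O L s) (hp : i ≤ T.level (T.parent q.1)) (hs : s'.var vSize = s.var vSize)
    (hv : s'.arr aVerts = s.arr aVerts) (hl : s'.arr aListed = s.arr aListed)
    (h1 : s'.arr aTupLen = Function.update (s.arr aTupLen) (T.parent q.1)
      (s.arr aTupLen (T.parent q.1) + 1))
    (h2 : s'.arr aTupEnd = Function.update (s.arr aTupEnd) (T.parent q.1)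
      (s.arr aTupEnd (T.parent q.1) + 1))
    (h3 : s'.arr aTupData = Function.update (s.arr aTupData) (s.arr aTupEnd (T.parent q.1)) q.2) :
    Labelled A i O (L ++ [q]) s' := by
  set p := T.parent q.1 with hpq
  -- Even with the new entry the label fits into its block, so the cell written to lies inside it.
  have hroom := hK.length_lab_le A hi hL p
  rw [lab_concat, ← hpq, if_pos rfl, List.length_append, List.length_singleton] at hroom
  rw [h.tupEnd p hp] at h2 h3
  rw [h.tupLen p hp] at h1
  refine ⟨hs.trans h.size, isSlice_congr h.verts hv, ?_, ?_, ?_, ?_⟩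
  · rw [hl]
    exact h.listed
  · intro v hiv
    rw [h1, lab_concat, ← hpq, Function.update_apply]
    by_cases hvp : v = p
    · simp [hvp]
    · rw [if_neg (fun h => hvp (Fin.ext h)), if_neg (Ne.symm hvp)]
      exact h.tupLen v hiv
  · intro v hiv
    rw [h2, lab_concat, ← hpq, Function.update_apply]
    by_cases hvp : v = p
    · simp [hvp, add_assoc]
    · rw [if_neg (fun h => hvp (Fin.ext h)), if_neg (Ne.symm hvp)]
      exact h.tupEnd v hiv
  · intro v hiv
    rw [lab_concat, ← hpq]
    by_cases hvp : v = p
    · rw [hvp, if_pos rfl]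
      exact isSlice_push (h.tupData p hp) rfl h3
    · rw [if_neg (Ne.symm hvp)]
      refine isSlice_update_of_disjoint (h.tupData v hiv) ?_ h3
      have hroomv := hK.length_lab_le A hi ((List.sublist_append_left L [q]).trans hL) v
      rcases lt_or_gt_of_ne (fun h => hvp (Fin.ext h) : v.val ≠ p.val) with hlt | hlt
      · right
        have := A.off_mono (show v.val + 1 ≤ p.val by omega)
        rw [A.off_succ] at this
        omega
      · left
        have := A.off_mono (show p.val + 1 ≤ v.val by omega)
        rw [A.off_succ] at this
        omega

/-- The marks in `aListed` replace the search for the parent in the list by one access. -/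
theorem appendInts_spec {s : Mem} (hi : i ≤ T.height) (hK : IsLevelList T i K) (hb : Base A i s)
    (hS : Saved K s) {O : List (Fin n)} (hO : Labelled A i O [] s) :
    Ends appendInts s (35 * K.length + 3) fun s' =>
      Labelled A i (parentOrder T O K) K s' ∧ Unchanged appendInts s s' := by
  refine Ends.unchanged ?_
  refine Ends.seq_le (N := 1) (N' := 35 * K.length + 1) (R := fun s₁ =>
    s₁.var vI = 0 ∧ s₁.var vOldSize = K.length ∧ s₁.var vZero = 0 ∧ Labelled A i O [] s₁ ∧
    s₁.arr = s.arr) ?_ ?_ (by omega)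
  · refine Ends.simple_le (by decide) (by decide) ?_
    refine ⟨?_, ?_, ?_, hO.congr ?_ ?_ ?_ ?_ ?_ ?_, ?_⟩
    all_goals simp [Cmd.eval, hb.zero, hS.size]
  · rintro s₁ ⟨g1, g2, g3, g4, g5⟩
    refine (Ends.loop K (fun pre _ s' => s'.var vI = pre.length ∧
      Labelled A i (parentOrder T O pre) pre s') (fun _ => 34) ?_ ?_ ?_).mono ?_ ?_
    · exact ⟨g1, g4⟩
    · rintro pre q post s' hl hu ⟨k1, k2⟩
      have hlen := congrArg List.length hl
      rw [List.length_append, List.length_cons] at hlen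
      have hqK : q ∈ K := by
        rw [hl]
        simp
      have hsub : (pre ++ [q]).Sublist K := by
        rw [hl]
        simp
      have hsz : s'.var vOldSize = K.length := (hu.var vOldSize (by decide)).trans g2
      have hz : s'.var vZero = 0 := (hu.var vZero (by decide)).trans g3
      have hw : s'.arr aOld pre.length = q.1 := by
        rw [hu.arr aOld (by decide), g5]
        refine isSlice_get (xs := pre.map fun q => q.1.val) (p := 0)
          (ys := post.map fun q => q.1.val) ?_ (by simp)
        have := hS.verts
        rw [hl] at this
        simpa using this
      have hk : s'.arr aInt q.1 = q.2 := by
        rw [hu.arr aInt (by decide), g5, hS.ints q hqK]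
      have hpar : s'.arr aParent q.1 = (T.parent q.1).val := by
        rw [hu.arr aParent (by decide), g5, hb.prepared.parent]
      have hlp : i ≤ T.level (T.parent q.1) := (hK.isChild hi hqK).2.ge
      have hlist := k2.listed _ hlp
      refine ⟨?_, ?_⟩
      · simp only [Test.eval, k1, hsz, decide_eq_true_eq]
        omega
      · refine Ends.simple_le (by decide) (by decide) ?_
        rw [parentOrder_concat, List.length_append, List.length_singleton, ← k1]
        rw [← k1] at hw
        split_ifs with hmem
        · have hne : s'.arr aListed (T.parent q.1) ≠ 0 := fun h => hlist.1 h hmem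
          refine ⟨?_, Labelled.append hK hi hsub k2 hlp ?_ ?_ ?_ ?_ ?_ ?_⟩
          all_goals simp [block, Cmd.eval, Test.eval, hw, hk, hpar, hz, hne]
        · have heq : s'.arr aListed (T.parent q.1) = 0 := hlist.2 hmem
          -- An auxiliary memory in which the parent has just been listed; it agrees with the actual
          -- one in all that matters for `Labelled`.
          have hpush := k2.push (w := T.parent q.1) (s' := (block [.const vX 1,
            .store aListed vP vX, .store aVerts vSize vP, .succ vSize]).eval
              (s'.setVar vP (T.parent q.1))) (by simp [block, Cmd.eval])
              (by simp [block, Cmd.eval]) (by simp [block, Cmd.eval]) (by simp [block, Cmd.eval])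
              (by simp [block, Cmd.eval]) (by simp [block, Cmd.eval])
          refine ⟨?_, Labelled.append hK hi hsub hpush hlp ?_ ?_ ?_ ?_ ?_ ?_⟩
          all_goals simp [block, Cmd.eval, Test.eval, hw, hk, hpar, hz, heq]
    · rintro s' hu ⟨k1, -⟩
      have hsz : s'.var vOldSize = K.length := (hu.var vOldSize (by decide)).trans g2
      simp [Test.eval, k1, hsz]
    · simp
      omega
    · rintro s' ⟨⟨-, h⟩, -⟩
      exact h

theorem create_spec {s : Mem} (hi : i ≤ T.height) (hK : IsLevelList T i K)
    (h : LoopInv A i K s) :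
    Ends create s (42 * K.length + 26 * ((bfsLevels A).list i).length + 22)
      fun s' => Created A i K s' := by
  refine (Ends.seq_le (Q := fun s' => Labelled A i (created (bfsLevels A) i K) K s' ∧ Saved K s')
    (saveList_spec h.ints) (N' := 35 * K.length + 26 * ((bfsLevels A).list i).length + 13)
    ?_ (by omega)).unchanged.mono le_rfl ?_
  · rintro s₁ ⟨hS, hu⟩
    have hb := h.base.of_unchanged hu (by decide) (by decide)
    refine Ends.seq_le (listLeaves_spec hi hb ?_ ?_ ?_) (N' := 35 * K.length + 3) ?_ (by omega)
    · rw [hu.arr _ (by decide)]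
      exact h.listed
    · rw [hu.arr _ (by decide)]
      exact h.tupLen
    · rw [hu.arr _ (by decide)]
      exact h.tupEnd
    rintro s₂ ⟨hL, hu₂⟩
    have hS₂ := hS.of_unchanged hu₂ (by decide)
    refine (appendInts_spec hi hK (hb.of_unchanged hu₂ (by decide) (by decide)) hS₂ hL).mono
      le_rfl ?_
    rintro s₃ ⟨hL₃, hu₃⟩
    exact ⟨hL₃, hS₂.of_unchanged hu₃ (by decide)⟩
  · rintro s' ⟨⟨hL, hS⟩, hu⟩
    exact ⟨h.base.of_unchanged hu (by decide) (by decide), h.nodes.of_unchanged hu (by decide),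
      hS, hL⟩

theorem Labelled.holdsTuples {s : Mem} {O : List (Fin n)} (h : Labelled A i O K s)
    (hA : HoldsAdj A s) (hO : ∀ v ∈ O, i ≤ T.level v) :
    treeLayout.HoldsTuples s (O.map fun v => (v, lab T K v)) := by
  refine ⟨?_, ?_, ?_⟩
  · simpa [treeLayout] using h.size
  · simpa [treeLayout, List.map_map, Function.comp_def] using h.verts
  · intro q hq
    obtain ⟨v, hv, rfl⟩ := List.mem_map.1 hq
    simp only [treeLayout]
    refine ⟨h.tupLen v (hO v hv), ?_⟩
    rw [hA.off v v.2.le]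
    exact h.tupData v (hO v hv)

end Create

end AHU

namespace AHU

universe u

/-! ### Stable sorting -/

section StableSort

variable {α : Type u} (key : α → List ℕ)

/-- A sorted list is determined by its order within each class of equal keys. In this way the list
left by the machine is recognized as the value of a sorting function, which `Executes` asks for. -/
theorem eq_of_filter_key_eq {l m : List α} (hl : l.Pairwise fun a b => key a ≤ key b)
    (hm : m.Pairwise fun a b => key a ≤ key b)
    (h : ∀ c, l.filter (fun a => decide (key a = c)) = m.filter fun a => decide (key a = c)) :
    l = m := by
  induction l generalizing m with
  | nil =>
    cases m with
    | nil => rfl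
    | cons b m =>
      have := h (key b)
      simp at this
  | cons a l ih =>
    cases m with
    | nil =>
      have := h (key a)
      simp at this
    | cons b m =>
      rw [List.pairwise_cons] at hl hm
      have hab : key a = key b := by
        have key_mem : ∀ {x : α} {p q : List α}, p.filter (fun a => decide (key a = key x)) =
            q.filter (fun a => decide (key a = key x)) → x ∈ p → x ∈ q := by
          intro x p q hpq hx
          have : x ∈ p.filter (fun a => decide (key a = key x)) := List.mem_filter.2 ⟨hx, by simp⟩
          rw [hpq] at this
          exact (List.mem_filter.1 this).1
        apply le_antisymm
        · rcases List.mem_cons.1 (key_mem (h (key b)).symm (List.mem_cons_self ..)) with h1 | h1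
          · rw [h1]
          · exact hl.1 b h1
        · rcases List.mem_cons.1 (key_mem (h (key a)) (List.mem_cons_self ..)) with h1 | h1
          · rw [h1]
          · exact hm.1 a h1
      have h1 := h (key a)
      rw [List.filter_cons_of_pos (by simp), List.filter_cons_of_pos (by simp [hab])] at h1
      obtain ⟨rfl, -⟩ := List.cons.inj h1
      congr 1
      refine ih hl.2 hm.2 fun c => ?_
      have h2 := h c
      by_cases hc : key a = c
      · rw [List.filter_cons_of_pos (by simpa using hc),
          List.filter_cons_of_pos (by simpa using hc)] at h2
        exact (List.cons.inj h2).2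
      · rwa [List.filter_cons_of_neg (by simpa using hc),
          List.filter_cons_of_neg (by simpa using hc)] at h2

/-- The new element stops before the first one with an equal key and passes only smaller keys, so
the order within a class is that of `a :: l`. -/
theorem filter_orderedInsert_key (a : α) (l : List α) (hl : l.Pairwise fun a b => key a ≤ key b)
    (c : List ℕ) :
    (l.orderedInsert (fun a b => key a ≤ key b) a).filter (fun a => decide (key a = c)) =
      (a :: l).filter fun a => decide (key a = c) := by
  induction l with
  | nil => rfl
  | cons b l ih =>
    rw [List.pairwise_cons] at hl
    by_cases hab : key a ≤ key b
    · rw [List.orderedInsert_cons_of_le (r := fun a b => key a ≤ key b) l hab]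
    · rw [List.orderedInsert_of_not_le (r := fun a b => key a ≤ key b) l hab]
      have ih := ih hl.2
      simp only [List.filter_cons] at ih ⊢
      rw [ih]
      by_cases hb : key b = c
      · have ha : key a ≠ c := fun ha => hab (by rw [ha, hb])
        simp [ha]
      · simp [hb]

theorem pairwise_insertionSort_key (l : List α) :
    (l.insertionSort fun a b => key a ≤ key b).Pairwise fun a b => key a ≤ key b := by
  have : Std.Total (fun a b : α => key a ≤ key b) := ⟨fun a b => le_total _ _⟩
  have : IsTrans α (fun a b : α => key a ≤ key b) := ⟨fun a b c => le_trans⟩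
  exact List.pairwise_insertionSort _ l

theorem filter_insertionSort_key (l : List α) (c : List ℕ) :
    (l.insertionSort fun a b => key a ≤ key b).filter (fun a => decide (key a = c)) =
      l.filter fun a => decide (key a = c) := by
  induction l with
  | nil => rfl
  | cons a l ih =>
    rw [List.insertionSort_cons,
      filter_orderedInsert_key key a _ (pairwise_insertionSort_key key l),
      List.filter_cons, ih, List.filter_cons]

/-- The stable sorting routine. -/
def stableSort (V : Type u) : LexSort V where
  sort L := L.insertionSort fun a b => a.2 ≤ b.2
  perm L := List.perm_insertionSort _ L
  sorted L := pairwise_insertionSort_key Prod.snd L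

end StableSort

/-! ### Distribution into buckets -/

section Buckets

variable {α : Type u} {β : Type*} [DecidableEq β] (f : α → β)

theorem flatMap_filter_perm {O : List α} (hO : O.Nodup) {l : List β} (hl : l.Nodup)
    (h : ∀ v ∈ O, f v ∈ l) : (l.flatMap fun u => O.filter fun v => decide (f v = u)).Perm O := by
  rw [List.perm_ext_iff_of_nodup _ hO]
  · intro v
    simp only [List.mem_flatMap, List.mem_filter, decide_eq_true_eq]
    exact ⟨fun ⟨u, _, hv, _⟩ => hv, fun hv => ⟨f v, h v hv, hv, rfl⟩⟩
  · rw [List.nodup_flatMap]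
    refine ⟨fun u _ => hO.filter _, hl.imp ?_⟩
    intro a b hab v hva hvb
    simp only [List.mem_filter, decide_eq_true_eq] at hva hvb
    exact hab (hva.2.symm.trans hvb.2)

theorem pairwise_flatMap_filter (lb : β → List ℕ) (O : List α) {l : List β}
    (hl : l.Pairwise fun a b => lb a < lb b) :
    (l.flatMap fun u => O.filter fun v => decide (f v = u)).Pairwise
      fun a b => lb (f a) ≤ lb (f b) := by
  rw [List.pairwise_flatMap]
  constructor
  · intro u _
    refine List.pairwise_of_forall_mem_list ?_
    intro a ha b hb
    simp only [List.mem_filter, decide_eq_true_eq] at ha hb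
    rw [ha.2, hb.2]
  · refine hl.imp ?_
    intro u w huw a ha b hb
    simp only [List.mem_filter, decide_eq_true_eq] at ha hb
    rw [ha.2, hb.2]
    exact huw.le

/-- The labels of the buckets are distinct, so elements with label `c` all come from one bucket,
which keeps the order of `O`. -/
theorem filter_flatMap_filter (lb : β → List ℕ) {O : List α} {l : List β}
    (hl : l.Pairwise fun a b => lb a < lb b) (h : ∀ v ∈ O, f v ∈ l) (c : List ℕ) :
    (l.flatMap fun u => O.filter fun v => decide (f v = u)).filter
      (fun v => decide (lb (f v) = c)) = O.filter fun v => decide (lb (f v) = c) := by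
  induction l generalizing O with
  | nil =>
    have : O = [] := List.eq_nil_iff_forall_not_mem.2 fun v hv => by simpa using h v hv
    simp [this]
  | cons u l ih =>
    rw [List.pairwise_cons] at hl
    rw [List.flatMap_cons, List.filter_append, List.filter_filter]
    -- The later buckets contain nothing of bucket `u`, whose elements may be removed from `O`
    -- before the induction hypothesis is applied.
    have hrest : (l.flatMap fun w => O.filter fun v => decide (f v = w)) =
        l.flatMap fun w =>
          (O.filter fun v => decide (f v ≠ u)).filter fun v => decide (f v = w) := by
      refine List.flatMap_congr fun w hw => ?_
      rw [List.filter_filter]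
      refine List.filter_congr fun v _ => ?_
      by_cases hv : f v = w
      · have : f v ≠ u := fun hu => absurd (hl.1 w hw) (by rw [← hv, hu]; exact lt_irrefl _)
        rw [decide_eq_true hv, decide_eq_true this, Bool.and_self]
      · simp [hv]
    rw [hrest, ih hl.2, List.filter_filter]
    · by_cases hc : lb u = c
      · have h2 : (O.filter fun v => decide (lb (f v) = c) && decide (f v ≠ u)) = [] := by
          rw [List.filter_eq_nil_iff]
          intro v hv
          have : f v = u ∨ f v ∈ l := by simpa using h v hv
          rcases this with h1 | h1
          · simp [h1]
          · have := (hl.1 _ h1).ne'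
            rw [hc] at this
            simp [this]
        rw [h2, List.append_nil]
        refine List.filter_congr fun v hv => ?_
        have : f v = u ∨ f v ∈ l := by simpa using h v hv
        rcases this with h1 | h1
        · simp [h1]
        · have := (hl.1 _ h1).ne'
          rw [hc] at this
          simp [this]
      · have h1 : (O.filter fun v => decide (lb (f v) = c) && decide (f v = u)) = [] := by
          rw [List.filter_eq_nil_iff]
          intro v _ hv
          simp only [Bool.and_eq_true, decide_eq_true_eq] at hv
          exact hc (by rw [← hv.2, hv.1])
        rw [h1, List.nil_append]
        refine List.filter_congr fun v _ => ?_
        by_cases hv : f v = u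
        · simp [hv, hc]
        · simp [hv]
    · intro v hv
      simp only [List.mem_filter, decide_eq_true_eq] at hv
      have := h v hv.1
      rw [List.mem_cons] at this
      exact this.resolve_left hv.2

end Buckets

/-! ### Linked lists -/

section Chain

/-- The linked list that starts with `x`, with pointers `f` and end marker `0`, is `l`. -/
def Chain (f : ℕ → ℕ) : ℕ → List ℕ → Prop
  | x, [] => x = 0
  | x, y :: l => x = y ∧ y ≠ 0 ∧ Chain f (f y) l

theorem Chain.congr {f g : ℕ → ℕ} {l : List ℕ} (hfg : ∀ y ∈ l, g y = f y) :
    ∀ {x : ℕ}, Chain f x l → Chain g x l := by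
  induction l with
  | nil => exact fun h => h
  | cons y l ih =>
    rintro x ⟨h1, h2, h3⟩
    refine ⟨h1, h2, ?_⟩
    rw [hfg y (by simp)]
    exact ih (fun z hz => hfg z (by simp [hz])) h3

/-- Two new cells `b`, `c` are spliced in after `a`. The updates come in the order of the three
stores in `buildTrie`. -/
theorem Chain.insert {f : ℕ → ℕ} {X Y : List ℕ} {a b c : ℕ} (hb : b ≠ 0) (hc : c ≠ 0)
    (hbc : b ≠ c) : ∀ {x : ℕ}, Chain f x (X ++ a :: Y) → (X ++ a :: Y).Nodup →
      b ∉ X ++ a :: Y → c ∉ X ++ a :: Y →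
      Chain (Function.update (Function.update (Function.update f b c) c (f a)) a b) x
        (X ++ a :: b :: c :: Y) := by
  induction X with
  | nil =>
    rintro x ⟨rfl, hx, h⟩ hnd hbn hcn
    simp only [List.nil_append, List.nodup_cons, List.mem_cons, not_or] at hnd hbn hcn
    refine ⟨rfl, hx, ?_⟩
    rw [Function.update_self]
    refine ⟨rfl, hb, ?_⟩
    rw [Function.update_of_ne hbn.1, Function.update_of_ne hbc, Function.update_self]
    refine ⟨rfl, hc, ?_⟩
    rw [Function.update_of_ne hcn.1, Function.update_self]
    refine h.congr fun y hy => ?_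
    have h1 : y ≠ x := fun e => hnd.1 (e ▸ hy)
    have h2 : y ≠ c := fun e => hcn.2 (e ▸ hy)
    have h3 : y ≠ b := fun e => hbn.2 (e ▸ hy)
    rw [Function.update_of_ne h1, Function.update_of_ne h2, Function.update_of_ne h3]
  | cons y X ih =>
    rintro x ⟨rfl, hx, h⟩ hnd hbn hcn
    simp only [List.cons_append, List.nodup_cons, List.mem_cons, not_or] at hnd hbn hcn
    refine ⟨rfl, hx, ?_⟩
    rw [Function.update_of_ne (fun e => hnd.1 (by simp [e])), Function.update_of_ne (Ne.symm hcn.1),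
      Function.update_of_ne (Ne.symm hbn.1)]
    exact ih h hnd.2 hbn.2 hcn.2

end Chain

/-! ### Tries with a linked list of their nodes -/

section Trie

/-- If `m` does not properly extend `l`, the appended number is irrelevant. If it does, its next
entry cannot be `B`, because `m` is below `l ++ [B]`, so it is less than `k`. -/
theorem lt_append_singleton_of_lt {B k : ℕ} : ∀ {l m : List ℕ}, m < l ++ [B] →
    (∀ j r, m = l ++ j :: r → j = B ∨ j < k) → m < l ++ [k] := by
  intro l
  induction l with
  | nil =>
    intro m h hj
    cases m with
    | nil => exact List.nil_lt_cons _ _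
    | cons j r =>
      simp only [List.nil_append] at h ⊢
      rcases hj j r rfl with rfl | hjk
      · rw [List.cons_lt_cons_iff] at h
        rcases h with h | h
        · exact absurd h (lt_irrefl _)
        · exact absurd h.2 (List.not_lt_nil _)
      · exact List.cons_lt_cons_iff.2 (Or.inl hjk)
  | cons a l ih =>
    intro m h hj
    cases m with
    | nil => exact List.nil_lt_cons _ _
    | cons b m =>
      rw [List.cons_append, List.cons_lt_cons_iff] at h ⊢
      rcases h with h | ⟨rfl, h⟩
      · exact Or.inl h
      · exact Or.inr ⟨rfl, ih h fun j r hm => hj j r (by rw [hm]; rfl)⟩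

theorem append_lt_append_left (l : List ℕ) {m m' : List ℕ} (h : m < m') : l ++ m < l ++ m' := by
  induction l with
  | nil => exact h
  | cons a l ih => exact List.cons_lt_cons_iff.2 (Or.inr ⟨rfl, ih⟩)

/-- A trie whose nodes carry the labels `lb`. A node `u` in `ids` comes with a token `u + 1`, whose
label is that of `u` followed by `B`, a number that exceeds all keys. The linked list `toks` of
nodes and tokens is ordered by decreasing labels. The last child of a node has the largest key. -/
structure Trie (B : ℕ) (next lastKey lastChild : ℕ → ℕ) (top fresh bound : ℕ) (ids toks : List ℕ)
    (lb : ℕ → List ℕ) : Prop where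
  chain : Chain next (top + 1) toks
  sorted : toks.Pairwise fun a b => lb b < lb a
  top_mem : top ∈ ids
  lb_top : lb top = []
  mem : ∀ u ∈ ids, u ∈ toks ∧ u + 1 ∈ toks ∧ lb (u + 1) = lb u ++ [B]
  range : ∀ x ∈ toks, top ≤ x ∧ x < fresh
  last : ∀ u ∈ ids, lastKey u ≠ 0 → lastChild u ∈ ids ∧ lb (lastChild u) = lb u ++ [lastKey u - 1]
  le_bound : ∀ u ∈ ids, lastKey u ≤ bound
  ext : ∀ u ∈ ids, ∀ x ∈ toks, ∀ j r, lb x = lb u ++ j :: r → j = B ∨ j < lastKey u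

variable {B : ℕ} {next lastKey lastChild : ℕ → ℕ} {top fresh bound : ℕ} {ids toks : List ℕ}
  {lb : ℕ → List ℕ}

theorem Trie.nodup (h : Trie B next lastKey lastChild top fresh bound ids toks lb) :
    toks.Nodup :=
  h.sorted.imp fun {a b} hab e => absurd hab (by rw [e]; exact lt_irrefl _)

theorem Trie.lb_inj (h : Trie B next lastKey lastChild top fresh bound ids toks lb) {x y : ℕ}
    (hx : x ∈ toks) (hy : y ∈ toks) (hxy : lb x = lb y) : x = y := by
  have hnd : (toks.map lb).Nodup := by
    rw [List.Nodup, List.pairwise_map]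
    exact h.sorted.imp fun h => h.ne'
  exact List.inj_on_of_nodup_map hnd hx hy hxy

theorem trie_single (B : ℕ) {next lastKey lastChild : ℕ → ℕ} {top : ℕ} (hpos : 1 ≤ top)
    (h1 : next (top + 1) = top) (h2 : next top = 0) (h3 : lastKey top = 0) :
    Trie B next lastKey lastChild top (top + 2) 0 [top] [top + 1, top]
      fun x => if x = top then [] else [B] where
  chain := ⟨rfl, by omega, h1, by omega, h2⟩
  sorted := by simp
  top_mem := by simp
  lb_top := by simp
  mem := by simp
  range := by
    intro x hx
    simp only [List.mem_cons, List.not_mem_nil, or_false] at hx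
    omega
  last := by simp [h3]
  le_bound := by simp [h3]
  ext := by
    intro u hu x hx j r hj
    simp only [List.mem_cons, List.not_mem_nil, or_false] at hu hx
    subst hu
    rcases hx with rfl | rfl
    · simp at hj
      exact Or.inl hj.1.symm
    · simp at hj

/-- The key `k` exceeds all keys at `u`, so among the descendants of `u` the new node and its token
have the largest labels. In decreasing order they follow the token `u + 1` directly, and their place
is found without a search. -/
theorem Trie.insert (h : Trie B next lastKey lastChild top fresh bound ids toks lb)
    {u k : ℕ} (hpos : 1 ≤ top) (hu : u ∈ ids) (hk : lastKey u ≠ k + 1) (hb : bound ≤ k + 1)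
    (hkB : k < B) (hfresh : lastKey fresh = 0) :
    ∃ toks' lb', (∀ x ∈ toks, lb' x = lb x) ∧ lb' fresh = lb u ++ [k] ∧
      toks'.length = toks.length + 2 ∧
      Trie B (Function.update (Function.update (Function.update next (fresh + 1) fresh) fresh
          (next (u + 1))) (u + 1) (fresh + 1))
        (Function.update lastKey u (k + 1)) (Function.update lastChild u fresh)
        top (fresh + 2) (k + 1) (ids ++ [fresh]) toks' lb' := by
  obtain ⟨X, Y, hXY⟩ := List.append_of_mem (h.mem u hu).2.1
  -- `lastKey` is the key plus one, and `0` for a node without children; so the keys used at `u` are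
  -- all less than `k`.
  have hlk : lastKey u ≤ k := by
    have := h.le_bound u hu
    omega
  have hnotmem : ∀ x ≥ fresh, x ∉ toks := fun x hx hm => by
    have := (h.range x hm).2
    omega
  have hne : ∀ x ∈ toks, x ≠ fresh ∧ x ≠ fresh + 1 := fun x hx => by
    have := (h.range x hx).2
    omega
  set lb' : ℕ → List ℕ := fun x =>
    if x = fresh then lb u ++ [k] else if x = fresh + 1 then lb u ++ [k, B] else lb x with hlb'
  have hlb : ∀ x ∈ toks, lb' x = lb x := fun x hx => by
    simp [hlb', (hne x hx).1, (hne x hx).2]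
  have hlb1 : lb' fresh = lb u ++ [k] := by simp [hlb']
  have hlb2 : lb' (fresh + 1) = lb u ++ [k, B] := by simp [hlb']
  have hut := (h.mem u hu).1
  have hu1 := (h.mem u hu).2.1
  have hufresh : u ≠ fresh := (hne u hut).1
  have hmem' : ∀ x, x ∈ X ++ (u + 1) :: (fresh + 1) :: fresh :: Y ↔
      x ∈ toks ∨ x = fresh + 1 ∨ x = fresh := by
    intro x
    rw [hXY]
    simp only [List.mem_append, List.mem_cons]
    tauto
  refine ⟨X ++ (u + 1) :: (fresh + 1) :: fresh :: Y, lb', hlb, hlb1, by rw [hXY]; simp; omega, ?_⟩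
  have hc := h.chain
  have hnd := h.nodup
  have hs := h.sorted
  have hr := h.range u hut
  rw [hXY] at hc hnd hs
  refine ⟨?_, ?_, ?_, ?_, ?_, ?_, ?_, ?_, ?_⟩
  · exact hc.insert (by omega) (by omega) (by omega) hnd
      (by rw [← hXY]; exact hnotmem _ (by omega)) (by rw [← hXY]; exact hnotmem _ (by omega))
  · have hX : ∀ x ∈ X, lb' x = lb x := fun x hx => hlb x (by rw [hXY]; simp [hx])
    have hY : ∀ y ∈ Y, lb' y = lb y := fun y hy => hlb y (by rw [hXY]; simp [hy])
    have hU : lb' (u + 1) = lb u ++ [B] := by rw [hlb _ hu1, (h.mem u hu).2.2]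
    have l1 : lb u ++ [k, B] < lb u ++ [B] :=
      append_lt_append_left _ (List.cons_lt_cons_iff.2 (Or.inl hkB))
    have l2 : lb u ++ [k] < lb u ++ [k, B] :=
      append_lt_append_left _ (List.cons_lt_cons_iff.2 (Or.inr ⟨rfl, List.nil_lt_cons _ _⟩))
    rw [List.pairwise_append, List.pairwise_cons] at hs
    obtain ⟨s1, ⟨s2, s3⟩, s4⟩ := hs
    -- A label behind the token that extends `lb u` goes on with a key less than `k`: the only
    -- alternative is `B`, which the label of the token excludes.
    have hYlt : ∀ y ∈ Y, lb y < lb u ++ [k] := by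
      intro y hy
      have hyt : y ∈ toks := by
        rw [hXY]
        simp [hy]
      refine lt_append_singleton_of_lt (B := B) ?_ ?_
      · rw [← (h.mem u hu).2.2]
        exact s2 y hy
      · intro j r hj
        rcases h.ext u hu y hyt j r hj with h1 | h1
        · exact Or.inl h1
        · exact Or.inr (by omega)
    have hXgt : ∀ x ∈ X, lb u ++ [B] < lb x := fun x hx => by
      rw [← (h.mem u hu).2.2]
      exact s4 x hx (u + 1) (by simp)
    rw [List.pairwise_append]
    refine ⟨?_, ?_, ?_⟩
    · refine s1.imp_of_mem ?_
      intro a b ha hb hab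
      rw [hX a ha, hX b hb]
      exact hab
    · rw [List.pairwise_cons, List.pairwise_cons, List.pairwise_cons]
      refine ⟨?_, ?_, ?_, ?_⟩
      · intro y hy
        rw [hU]
        simp only [List.mem_cons] at hy
        rcases hy with rfl | rfl | hy
        · rw [hlb2]
          exact l1
        · rw [hlb1]
          exact l2.trans l1
        · rw [hY y hy]
          exact (hYlt y hy).trans (l2.trans l1)
      · intro y hy
        rw [hlb2]
        rcases List.mem_cons.1 hy with rfl | hy
        · rw [hlb1]
          exact l2
        · rw [hY y hy]
          exact (hYlt y hy).trans l2
      · intro y hy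
        rw [hlb1, hY y hy]
        exact hYlt y hy
      · refine s3.imp_of_mem ?_
        intro a b ha hb hab
        rw [hY a ha, hY b hb]
        exact hab
    · intro x hx y hy
      rw [hX x hx]
      simp only [List.mem_cons] at hy
      rcases hy with rfl | rfl | rfl | hy
      · rw [hU]
        exact hXgt x hx
      · rw [hlb2]
        exact l1.trans (hXgt x hx)
      · rw [hlb1]
        exact (l2.trans l1).trans (hXgt x hx)
      · rw [hY y hy]
        exact s4 x hx y (by simp [hy])
  · simp [h.top_mem]
  · rw [hlb _ (h.mem _ h.top_mem).1, h.lb_top]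
  · intro x hx
    rw [hmem', hmem']
    rcases List.mem_append.1 hx with hx | hx
    · obtain ⟨m1, m2, m3⟩ := h.mem x hx
      exact ⟨Or.inl m1, Or.inl m2, by rw [hlb _ m1, hlb _ m2, m3]⟩
    · rw [List.mem_singleton] at hx
      subst hx
      exact ⟨by simp, by simp, by rw [hlb1, hlb2]; simp⟩
  · intro x hx
    rw [hmem'] at hx
    rcases hx with hx | rfl | rfl
    · have := h.range x hx
      omega
    · omega
    · omega
  · intro x hx hx0
    rcases List.mem_append.1 hx with hx | hx
    · by_cases hxu : x = u
      · subst hxu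
        rw [Function.update_self, Function.update_self, hlb1, hlb _ hut]
        simp
      · rw [Function.update_of_ne hxu] at hx0
        rw [Function.update_of_ne hxu, Function.update_of_ne hxu]
        obtain ⟨m1, m2⟩ := h.last x hx hx0
        exact ⟨by simp [m1], by rw [hlb _ (h.mem _ m1).1, hlb _ (h.mem _ hx).1, m2]⟩
    · rw [List.mem_singleton] at hx
      subst hx
      rw [Function.update_of_ne hufresh.symm] at hx0
      exact absurd hfresh hx0
  · intro x hx
    rw [Function.update_apply]
    split_ifs with hxu
    · exact le_rfl
    · rcases List.mem_append.1 hx with hx | hx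
      · exact (h.le_bound x hx).trans hb
      · rw [List.mem_singleton] at hx
        rw [hx, hfresh]
        omega
  · have hle : ∀ v, lastKey v ≤ Function.update lastKey u (k + 1) v := by
      intro v
      rw [Function.update_apply]
      split_ifs with hv
      · rw [hv]
        omega
      · exact le_rfl
    -- No old label begins with `lb u ++ [k]`, since `ext` would give `k = B` or `k < lastKey u`.
    have hnew : ∀ x ∈ toks, ∀ j r, lb x ≠ lb u ++ [k] ++ j :: r ∧ lb x ≠ lb u ++ [k] := by
      intro x hx j r
      constructor
      · intro e
        have := h.ext u hu x hx k (j :: r) (by rw [e]; simp)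
        omega
      · intro e
        have := h.ext u hu x hx k [] e
        omega
    intro v hv x hx j r hj
    rw [hmem'] at hx
    rcases List.mem_append.1 hv with hv | hv
    · have hvt := (h.mem v hv).1
      rw [hlb v hvt] at hj
      -- The label of the old node `v` ends somewhere in a new label. Beyond `lb u` is impossible by
      -- `hnew`; if it ends with `lb u`, the next entry is `k`; if it ends earlier, the next entry
      -- belongs to `lb u` and `ext` applies.
      have main : ∀ z, lb u ++ k :: z = lb v ++ j :: r → z = [] ∨ z = [B] →
          j = B ∨ j < Function.update lastKey u (k + 1) v := by
        intro z hz hzB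
        rw [List.append_eq_append_iff] at hz
        rcases hz with ⟨a, ha, hb⟩ | ⟨a, ha, hb⟩
        · cases a with
          | nil =>
            rw [List.append_nil] at ha
            rw [List.nil_append] at hb
            have : v = u := h.lb_inj hvt hut ha
            subst this
            right
            rw [Function.update_self, (List.cons.inj hb).1.symm]
            omega
          | cons b a =>
            rw [List.cons_append] at hb
            obtain ⟨rfl, hb⟩ := List.cons.inj hb
            exfalso
            have := (hnew v hvt 0 []).2
            cases a with
            | nil => exact this ha
            | cons c a => exact (hnew v hvt c a).1 (by rw [ha]; simp)
        · cases a with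
          | nil =>
            rw [List.append_nil] at ha
            rw [List.nil_append] at hb
            have : u = v := h.lb_inj hut hvt ha
            subst this
            right
            rw [Function.update_self, (List.cons.inj hb).1]
            omega
          | cons b a =>
            rw [List.cons_append] at hb
            obtain ⟨rfl, hb⟩ := List.cons.inj hb
            rcases h.ext v hv u hut j a ha with h1 | h1
            · exact Or.inl h1
            · exact Or.inr (h1.trans_le (hle v))
      rcases hx with hx | rfl | rfl
      · rw [hlb x hx] at hj
        rcases h.ext v hv x hx j r hj with h1 | h1
        · exact Or.inl h1
        · exact Or.inr (h1.trans_le (hle v))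
      · rw [hlb2] at hj
        exact main [B] hj (Or.inr rfl)
      · rw [hlb1] at hj
        exact main [] hj (Or.inl rfl)
    · rw [List.mem_singleton] at hv
      subst hv
      rw [hlb1] at hj
      rcases hx with hx | rfl | rfl
      · rw [hlb x hx] at hj
        exact absurd hj (hnew x hx j r).1
      · rw [hlb2] at hj
        simp only [List.append_assoc, List.singleton_append, List.append_cancel_left_eq,
          List.cons.injEq, true_and] at hj
        exact Or.inl hj.1.symm
      · rw [hlb1] at hj
        have := congrArg List.length hj
        simp at this

end Trie

end AHU

namespace AHU

open Cmd

/-! ### Sorting the labels -/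

section SortProgram

/-- Start a trie, with all vertices at its top node. -/
def initNodes : Cmd :=
  .seq (block
    [.copy vTop vFresh, .copy vX vFresh, .succ vX, .store aNext vX vTop, .succ vFresh,
      .succ vFresh, .const vI 0])
    (.loop (.lt vI vSize) (block [.load vW aVerts vI, .store aNode vW vTop, .succ vI]))

/-- Move the vertices down the trie, following the saved list. -/
def buildTrie : Cmd :=
  .seq (.const vI 0)
    (.loop (.lt vI vOldSize) (block
      [.load vW aOld vI, .load vK aInt vW, .succ vK, .load vP aParent vW, .load vU aNode vP,
        .load vX aLastKey vU,
        .ite (.eq vX vK) (.load vW aLastChild vU) (block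
          [.copy vW vFresh, .succ vFresh, .copy vX vFresh, .succ vFresh, .store aLastKey vU vK,
            .store aLastChild vU vW, .succ vU, .load vY aNext vU, .store aNext vX vW,
            .store aNext vW vY, .store aNext vU vX]),
        .store aNode vP vW, .succ vI]))

/-- Put the vertices into the buckets of their nodes. -/
def fillBuckets : Cmd :=
  .seq (.const vI 0)
    (.loop (.lt vI vSize) (block
      [.load vW aVerts vI, .load vU aNode vW, .load vX aBucket vU, .store aLink vW vX, .succ vW,
        .store aBucket vU vW, .succ vI]))

/-- List the vertices of the bucket that begins with `vY`, from back to front. -/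
def emptyBucket : Cmd :=
  .loop (.lt vZero vY) (block [.pred vY, .pred vI, .store aVerts vI vY, .load vY aLink vY])

/-- List the vertices of all buckets, from back to front. -/
def collect : Cmd :=
  .seq (block [.copy vX vTop, .succ vX, .copy vI vSize])
    (.loop (.lt vZero vX) (.seq (.load vY aBucket vX) (.seq emptyBucket (.load vX aNext vX))))

/-- `LEXsort`. -/
def lexSort : Cmd := .seq initNodes (.seq buildTrie (.seq fillBuckets collect))

end SortProgram

section Sorting

open Layout

variable {n : ℕ} {T : RTree (Fin n)} {A : AdjLists T.graph} {i : ℕ} {K : List (Fin n × ℕ)}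

theorem isSlice_cons {s s' : Mem} {a q x : ℕ} {xs : List ℕ} (h : IsSlice s a (q + 1) xs)
    (hs : s'.arr a = Function.update (s.arr a) q x) : IsSlice s' a q (x :: xs) := by
  intro j hj
  rw [hs]
  cases j with
  | zero => simp
  | succ j =>
    rw [Function.update_of_ne (by omega), List.getElem_cons_succ]
    have := h j (by simpa using hj)
    rwa [show q + 1 + j = q + (j + 1) by omega] at this

/-- The memory holds a trie, in which the label of the node of each vertex in `O` is the one that
the list `L` produces; the list of the nodes and tokens is `toks`. -/
structure HoldsTrie (T : RTree (Fin n)) (B bound : ℕ) (O : List (Fin n)) (L : List (Fin n × ℕ))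
    (ids toks : List ℕ) (lb : ℕ → List ℕ) (s : Mem) : Prop where
  trie : Trie B (s.arr aNext) (s.arr aLastKey) (s.arr aLastChild) (s.var vTop) (s.var vFresh) bound
    ids toks lb
  fresh : FreshNodes s
  top_pos : 1 ≤ s.var vTop
  bucket : ∀ u ≥ s.var vTop, s.arr aBucket u = 0
  mem : ∀ v ∈ O, s.arr aNode v ∈ ids
  label : ∀ v ∈ O, lb (s.arr aNode v) = lab T L v

/-- Each level takes its nodes from the unused ones, whose entries are still zero, so no trie ever
has to be erased. -/
theorem initNodes_spec {s : Mem} {O : List (Fin n)} (B : ℕ) (hF : FreshNodes s)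
    (hsize : s.var vSize = O.length) (hverts : IsSlice s aVerts 0 (O.map Fin.val)) :
    Ends initNodes s (7 * O.length + 16) fun s' =>
      (∃ ids toks lb, HoldsTrie T B 0 O [] ids toks lb s' ∧ toks.length = 2) ∧
        Unchanged initNodes s s' := by
  refine Ends.unchanged ?_
  have h7 := hF.pos
  refine Ends.seq_le (N := 13) (N' := 7 * O.length + 1) (R := fun s₁ =>
    s₁.var vTop = s.var vFresh ∧ s₁.var vFresh = s.var vFresh + 2 ∧ s₁.var vI = 0 ∧
    s₁.var vSize = O.length ∧
    s₁.arr aNext = Function.update (s.arr aNext) (s.var vFresh + 1) (s.var vFresh) ∧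
    ∀ a ≠ aNext, s₁.arr a = s.arr a) ?_ ?_ (by omega)
  · refine Ends.simple_le (by decide) (by decide) ?_
    simp +contextual [block, Cmd.eval, hsize]
  · rintro s₁ ⟨g1, g2, g3, g4, g5, g6⟩
    refine (Ends.loop O (fun pre _ s' => s'.var vI = pre.length ∧
      ∀ v ∈ pre, s'.arr aNode v = s.var vFresh) (fun _ => 6) ?_ ?_ ?_).mono ?_ ?_
    · exact ⟨g3, by simp⟩
    · rintro pre w post s' hl hu ⟨k1, k2⟩
      have hlen := congrArg List.length hl
      rw [List.length_append, List.length_cons] at hlen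
      have hsz : s'.var vSize = O.length := (hu.var vSize (by decide)).trans g4
      have htop : s'.var vTop = s.var vFresh := (hu.var vTop (by decide)).trans g1
      have hw : s'.arr aVerts pre.length = w := by
        rw [hu.arr aVerts (by decide), g6 _ (by decide)]
        refine isSlice_get (xs := pre.map Fin.val) (p := 0) (ys := post.map Fin.val) ?_ (by simp)
        rw [hl] at hverts
        simpa using hverts
      refine ⟨?_, ?_⟩
      · simp only [Test.eval, k1, hsz, decide_eq_true_eq]
        omega
      · refine Ends.simple_le (by decide) (by decide) ?_
        refine ⟨by simp [block, Cmd.eval, k1], ?_⟩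
        intro v hv
        simp only [block, Cmd.eval, Mem.setVar_var, Mem.setArr_var, Mem.setVar_arr, Mem.setArr_arr,
          k1, hw, htop]
        simp only [Nat.reduceEqDiff, if_true, if_false, Function.update_apply]
        split_ifs with hvw
        · rfl
        · rcases List.mem_append.1 hv with hv | hv
          · exact k2 v hv
          · rw [List.mem_singleton] at hv
            exact absurd (congrArg Fin.val hv) hvw
    · rintro s' hu ⟨k1, -⟩
      have hsz : s'.var vSize = O.length := (hu.var vSize (by decide)).trans g4
      simp [Test.eval, k1, hsz]
    · simp
      omega
    · rintro s' ⟨⟨-, k2⟩, hu⟩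
      have e1 : s'.var vTop = s.var vFresh := (hu.var vTop (by decide)).trans g1
      have e2 : s'.var vFresh = s.var vFresh + 2 := (hu.var vFresh (by decide)).trans g2
      have e3 := (hu.arr aNext (by decide)).trans g5
      have e4 := (hu.arr aLastKey (by decide)).trans (g6 _ (by decide))
      have e5 := (hu.arr aBucket (by decide)).trans (g6 _ (by decide))
      refine ⟨[s.var vFresh], [s.var vFresh + 1, s.var vFresh],
        fun x => if x = s.var vFresh then [] else [B], ⟨?_, ⟨?_, ?_, ?_, ?_⟩, ?_, ?_, ?_, ?_⟩, rfl⟩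
      · rw [e1, e2]
        refine trie_single B h7 ?_ ?_ ?_
        · simp [e3]
        · rw [e3, Function.update_of_ne (by omega)]
          exact hF.next _ le_rfl
        · rw [e4]
          exact hF.lastKey _ le_rfl
      · rw [e2]
        omega
      · intro u hu
        rw [e4]
        exact hF.lastKey u (by omega)
      · intro u hu
        rw [e3, Function.update_of_ne (by omega)]
        exact hF.next u (by omega)
      · intro u hu
        rw [e5]
        exact hF.bucket u (by omega)
      · rw [e1]
        exact h7
      · intro u hu
        rw [e5]
        exact hF.bucket u (by omega)
      · intro v hv
        rw [k2 v hv]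
        simp
      · intro v hv
        rw [k2 v hv]
        simp

/-- As keys arrive in nondecreasing order, an existing child with this key can only be the last one,
and `aLastChild` leads to it. -/
theorem HoldsTrie.follow {B bound : ℕ} {O : List (Fin n)} {L : List (Fin n × ℕ)} {ids toks : List ℕ}
    {lb : ℕ → List ℕ} {s s' : Mem} {q : Fin n × ℕ}
    (h : HoldsTrie T B bound O L ids toks lb s) (hq : T.parent q.1 ∈ O)
    (hkey : s.arr aLastKey (s.arr aNode (T.parent q.1)) = q.2 + 1)
    (h1 : s'.var vTop = s.var vTop) (h2 : s'.var vFresh = s.var vFresh)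
    (h3 : ∀ a ≠ aNode, s'.arr a = s.arr a)
    (h4 : s'.arr aNode = Function.update (s.arr aNode) (T.parent q.1)
      (s.arr aLastChild (s.arr aNode (T.parent q.1)))) :
    HoldsTrie T B bound O (L ++ [q]) ids toks lb s' := by
  obtain ⟨l1, l2⟩ := h.trie.last _ (h.mem _ hq) (by omega)
  rw [hkey, Nat.add_sub_cancel, h.label _ hq] at l2
  refine ⟨?_, ⟨?_, ?_, ?_, ?_⟩, ?_, ?_, ?_, ?_⟩
  · rw [h3 _ (by decide), h3 _ (by decide), h3 _ (by decide), h1, h2]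
    exact h.trie
  · rw [h2]
    exact h.fresh.pos
  · rw [h2, h3 _ (by decide)]
    exact h.fresh.lastKey
  · rw [h2, h3 _ (by decide)]
    exact h.fresh.next
  · rw [h2, h3 _ (by decide)]
    exact h.fresh.bucket
  · rw [h1]
    exact h.top_pos
  · rw [h1, h3 _ (by decide)]
    exact h.bucket
  · intro v hv
    rw [h4, Function.update_apply]
    split_ifs
    · exact l1
    · exact h.mem v hv
  · intro v hv
    rw [h4, Function.update_apply, lab_concat]
    by_cases hvp : v = T.parent q.1
    · rw [if_pos (congrArg Fin.val hvp), if_pos hvp.symm, l2, hvp]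
    · rw [if_neg (fun h => hvp (Fin.ext h)), if_neg (Ne.symm hvp)]
      exact h.label v hv

theorem HoldsTrie.extend {B bound : ℕ} {O : List (Fin n)} {L : List (Fin n × ℕ)}
    {ids toks : List ℕ} {lb : ℕ → List ℕ} {s s' : Mem} {q : Fin n × ℕ}
    (h : HoldsTrie T B bound O L ids toks lb s) (hq : T.parent q.1 ∈ O) (hb : bound ≤ q.2 + 1)
    (hB : q.2 < B) (hkey : s.arr aLastKey (s.arr aNode (T.parent q.1)) ≠ q.2 + 1)
    (h1 : s'.var vTop = s.var vTop) (h2 : s'.var vFresh = s.var vFresh + 2)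
    (h3 : s'.arr aBucket = s.arr aBucket)
    (h4 : s'.arr aNode = Function.update (s.arr aNode) (T.parent q.1) (s.var vFresh))
    (h5 : s'.arr aLastKey = Function.update (s.arr aLastKey) (s.arr aNode (T.parent q.1)) (q.2 + 1))
    (h6 : s'.arr aLastChild = Function.update (s.arr aLastChild) (s.arr aNode (T.parent q.1))
      (s.var vFresh))
    (h7 : s'.arr aNext = Function.update (Function.update (Function.update (s.arr aNext)
      (s.var vFresh + 1) (s.var vFresh)) (s.var vFresh)
      (s.arr aNext (s.arr aNode (T.parent q.1) + 1))) (s.arr aNode (T.parent q.1) + 1)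
      (s.var vFresh + 1)) :
    ∃ ids' toks' lb', HoldsTrie T B (q.2 + 1) O (L ++ [q]) ids' toks' lb' s' ∧
      toks'.length = toks.length + 2 := by
  have hu := h.mem _ hq
  set u := s.arr aNode (T.parent q.1) with hudef
  obtain ⟨m1, m2, -⟩ := h.trie.mem u hu
  have hr := h.trie.range _ m2
  obtain ⟨toks', lb', k1, k2, k3, k4⟩ := h.trie.insert h.top_pos hu hkey hb hB
    (h.fresh.lastKey _ le_rfl)
  refine ⟨ids ++ [s.var vFresh], toks', lb', ⟨?_, ⟨?_, ?_, ?_, ?_⟩, ?_, ?_, ?_, ?_⟩, k3⟩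
  · rw [h1, h2, h5, h6, h7]
    exact k4
  · rw [h2]
    omega
  · intro x hx
    rw [h5, Function.update_of_ne (by omega)]
    exact h.fresh.lastKey x (by omega)
  · intro x hx
    rw [h7, Function.update_of_ne (by omega), Function.update_of_ne (by omega),
      Function.update_of_ne (by omega)]
    exact h.fresh.next x (by omega)
  · intro x hx
    rw [h3]
    exact h.fresh.bucket x (by omega)
  · rw [h1]
    exact h.top_pos
  · rw [h1, h3]
    exact h.bucket
  · intro v hv
    rw [h4, Function.update_apply]
    split_ifs
    · simp
    · simp [h.mem v hv]
  · intro v hv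
    rw [h4, Function.update_apply, lab_concat]
    by_cases hvp : v = T.parent q.1
    · rw [if_pos (congrArg Fin.val hvp), if_pos hvp.symm, k2, hvp, hudef, h.label _ hq]
    · rw [if_neg (fun h => hvp (Fin.ext h)), if_neg (Ne.symm hvp),
        k1 _ (h.trie.mem _ (h.mem v hv)).1]
      exact h.label v hv

/-- The bound `b` of the trie exceeds none of the remaining keys plus one, as `K` is sorted; hence a
single comparison with `aLastKey` decides whether the child exists. Each pair creates at most one
node and one token. -/
theorem buildTrie_spec {s : Mem} {O : List (Fin n)} {B : ℕ} (hB : ∀ q ∈ K, q.2 < B)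
    (hsort : K.Pairwise fun a b => a.2 ≤ b.2) (hO : ∀ q ∈ K, T.parent q.1 ∈ O)
    (hpar : ∀ x : Fin n, s.arr aParent x = (T.parent x).val) (hS : Saved K s)
    {ids toks : List ℕ} {lb : ℕ → List ℕ} (hT : HoldsTrie T B 0 O [] ids toks lb s) :
    Ends buildTrie s (42 * K.length + 3) fun s' =>
      (∃ ids' toks' lb' b, HoldsTrie T B b O K ids' toks' lb' s' ∧
        toks'.length ≤ toks.length + 2 * K.length) ∧ Unchanged buildTrie s s' := by
  refine Ends.unchanged ?_
  refine Ends.seq_le (N := 1) (N' := 42 * K.length + 1) (R := fun s₁ => s₁ = s.setVar vI 0)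
    ?_ ?_ (by omega)
  · exact Ends.simple_le (by decide) (by decide) rfl
  · rintro _ rfl
    refine (Ends.loop K (fun pre post s' => s'.var vI = pre.length ∧
      ∃ ids' toks' lb' b, HoldsTrie T B b O pre ids' toks' lb' s' ∧
        toks'.length ≤ toks.length + 2 * pre.length ∧ ∀ q ∈ post, b ≤ q.2 + 1)
      (fun _ => 41) ?_ ?_ ?_).mono ?_ ?_
    · refine ⟨by simp, ids, toks, lb, 0, ⟨hT.trie, ?_, hT.top_pos, hT.bucket, hT.mem, hT.label⟩,
        by simp, by simp⟩
      exact ⟨hT.fresh.pos, hT.fresh.lastKey, hT.fresh.next, hT.fresh.bucket⟩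
    · rintro pre q post s' hl hu ⟨k1, ids', toks', lb', b, k2, k3, k4⟩
      have hlen := congrArg List.length hl
      rw [List.length_append, List.length_cons] at hlen
      have hqK : q ∈ K := by
        rw [hl]
        simp
      have hsz : s'.var vOldSize = K.length :=
        (hu.var vOldSize (by decide)).trans (by simp [hS.size])
      have hw : s'.arr aOld (s'.var vI) = q.1 := by
        rw [hu.arr aOld (by decide), k1]
        refine isSlice_get (xs := pre.map fun q => q.1.val) (p := 0)
          (ys := post.map fun q => q.1.val) ?_ (by simp)
        have := hS.verts
        rw [hl] at this
        exact isSlice_congr (s := s) (by simpa using this) rfl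
      have hk : s'.arr aInt q.1 = q.2 := by
        rw [hu.arr aInt (by decide)]
        exact hS.ints q hqK
      have hp : s'.arr aParent q.1 = (T.parent q.1).val := by
        rw [hu.arr aParent (by decide)]
        exact hpar q.1
      have hbq := k4 q (by simp)
      have hpost : ∀ r ∈ post, q.2 ≤ r.2 := by
        rw [hl, List.pairwise_append, List.pairwise_cons] at hsort
        exact hsort.2.1.1
      refine ⟨?_, ?_⟩
      · simp only [Test.eval, k1, hsz, decide_eq_true_eq]
        omega
      · refine Ends.simple_le (by decide) (by decide) ?_
        rw [List.length_append, List.length_singleton, ← k1]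
        by_cases hkey : s'.arr aLastKey (s'.arr aNode (T.parent q.1)) = q.2 + 1
        · refine ⟨by simp [block, Cmd.eval, Test.eval, hw, hk, hp, hkey], ids', toks', lb', b,
            k2.follow (hO q hqK) hkey ?_ ?_ ?_ ?_, by omega, fun r hr => k4 r (by simp [hr])⟩
          all_goals simp +contextual [block, Cmd.eval, Test.eval, hw, hk, hp, hkey]
        · obtain ⟨ids'', toks'', lb'', e1, e2⟩ := k2.extend (s' := (block
            [.load vW aOld vI, .load vK aInt vW, .succ vK, .load vP aParent vW, .load vU aNode vP,
            .load vX aLastKey vU,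
            .ite (.eq vX vK) (.load vW aLastChild vU) (block
              [.copy vW vFresh, .succ vFresh, .copy vX vFresh, .succ vFresh, .store aLastKey vU vK,
                .store aLastChild vU vW, .succ vU, .load vY aNext vU, .store aNext vX vW,
                .store aNext vW vY, .store aNext vU vX]),
            .store aNode vP vW, .succ vI]).eval s') (hO q hqK) hbq (hB q hqK) hkey
            (by simp [block, Cmd.eval, Test.eval, hw, hk, hp, hkey])
            (by simp [block, Cmd.eval, Test.eval, hw, hk, hp, hkey])
            (by simp [block, Cmd.eval, Test.eval, hw, hk, hp, hkey])
            (by simp [block, Cmd.eval, Test.eval, hw, hk, hp, hkey])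
            (by simp [block, Cmd.eval, Test.eval, hw, hk, hp, hkey])
            (by simp [block, Cmd.eval, Test.eval, hw, hk, hp, hkey])
            (by simp [block, Cmd.eval, Test.eval, hw, hk, hp, hkey])
          refine ⟨by simp [block, Cmd.eval, Test.eval, hw, hk, hp, hkey], ids'', toks'', lb'',
            _, e1,
            by omega, fun r hr => ?_⟩
          have := hpost r hr
          omega
    · rintro s' hu ⟨k1, -⟩
      have hsz : s'.var vOldSize = K.length :=
        (hu.var vOldSize (by decide)).trans (by simp [hS.size])
      simp [Test.eval, k1, hsz]
    · simp
      omega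
    · rintro s' ⟨⟨-, ids', toks', lb', b, k2, k3, -⟩, -⟩
      exact ⟨ids', toks', lb', b, k2, k3⟩

/-- The bucket of node `u` contains the vertices of `O` at that node, the last ones first. -/
def HoldsBucket (s : Mem) (O : List (Fin n)) (u : ℕ) : Prop :=
  Chain (fun x => s.arr aLink (x - 1)) (s.arr aBucket u)
    ((O.filter fun v : Fin n => decide (s.arr aNode v = u)).reverse.map fun v => v.val + 1)

/-- A bucket is a stack, so its order is reversed. Links point to `v + 1`, because `0` ends a list.
The second conclusion keeps the buckets of unused nodes empty for later levels. -/
theorem fillBuckets_spec {s : Mem} {O : List (Fin n)} (hO : O.Nodup)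
    (hsize : s.var vSize = O.length) (hverts : IsSlice s aVerts 0 (O.map Fin.val))
    (hb : ∀ u ≥ s.var vTop, s.arr aBucket u = 0) :
    Ends fillBuckets s (15 * O.length + 3) fun s' =>
      ((∀ u ≥ s.var vTop, HoldsBucket s' O u) ∧
        ∀ u, (∀ v ∈ O, s.arr aNode v ≠ u) → s'.arr aBucket u = s.arr aBucket u) ∧
      Unchanged fillBuckets s s' := by
  refine Ends.unchanged ?_
  refine Ends.seq_le (N := 1) (N' := 15 * O.length + 1) (R := fun s₁ => s₁ = s.setVar vI 0)
    ?_ ?_ (by omega)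
  · exact Ends.simple_le (by decide) (by decide) rfl
  · rintro _ rfl
    refine (Ends.loop O (fun pre _ s' => s'.var vI = pre.length ∧
      (∀ u ≥ s.var vTop, HoldsBucket s' pre u) ∧
      ∀ u, (∀ v ∈ O, s.arr aNode v ≠ u) → s'.arr aBucket u = s.arr aBucket u)
      (fun _ => 14) ?_ ?_ ?_).mono ?_ ?_
    · refine ⟨by simp, fun u hu => ?_, fun u _ => rfl⟩
      simpa [HoldsBucket, Chain] using hb u hu
    · rintro pre w post s' hl hu ⟨k1, k2, k3⟩
      have hlen := congrArg List.length hl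
      rw [List.length_append, List.length_cons] at hlen
      have hsz : s'.var vSize = O.length := (hu.var vSize (by decide)).trans (by simp [hsize])
      have hnode : s'.arr aNode = s.arr aNode := hu.arr aNode (by decide)
      have hw : s'.arr aVerts (s'.var vI) = w := by
        rw [hu.arr aVerts (by decide), k1]
        refine isSlice_get (xs := pre.map Fin.val) (p := 0) (ys := post.map Fin.val) ?_ (by simp)
        rw [hl] at hverts
        exact isSlice_congr (s := s) (by simpa using hverts) rfl
      have hwpre : w ∉ pre := by
        rw [hl, List.nodup_append] at hO
        exact fun h => hO.2.2 w h w (by simp) rfl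
      refine ⟨?_, ?_⟩
      · simp only [Test.eval, k1, hsz, decide_eq_true_eq]
        omega
      · refine Ends.simple_le (by decide) (by decide) ?_
        rw [List.length_append, List.length_singleton, ← k1]
        set s₂ := (block
          [.load vW aVerts vI, .load vU aNode vW, .load vX aBucket vU, .store aLink vW vX, .succ vW,
          .store aBucket vU vW, .succ vI]).eval s' with hs₂
        have e1 : s₂.arr aBucket =
            Function.update (s'.arr aBucket) (s'.arr aNode w) (w + 1) := by
          simp [hs₂, block, Cmd.eval, hw]
        have e2 : s₂.arr aLink =
            Function.update (s'.arr aLink) w (s'.arr aBucket (s'.arr aNode w)) := by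
          simp [hs₂, block, Cmd.eval, hw]
        have e3 : s₂.arr aNode = s'.arr aNode := by
          simp [hs₂, block, Cmd.eval, hw]
        refine ⟨by simp [hs₂, block, Cmd.eval], ?_, ?_⟩
        · intro u hu'
          have hold : Chain (fun x => s₂.arr aLink (x - 1)) (s'.arr aBucket u)
              ((pre.filter fun v : Fin n => decide (s'.arr aNode v = u)).reverse.map
                fun v => v.val + 1) := by
            refine (k2 u hu').congr fun y hy => ?_
            simp only [List.mem_map, List.mem_reverse, List.mem_filter] at hy
            obtain ⟨v, ⟨hv, -⟩, rfl⟩ := hy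
            rw [Nat.add_sub_cancel, e2, Function.update_of_ne]
            intro hvw
            exact hwpre (Fin.ext hvw ▸ hv)
          rw [HoldsBucket, e3, List.filter_append, e1]
          by_cases hwu : s'.arr aNode w = u
          · rw [List.filter_singleton, decide_eq_true hwu, cond_true, List.reverse_append,
              List.map_append, hwu, Function.update_self]
            refine ⟨rfl, Nat.succ_ne_zero _, ?_⟩
            have : s₂.arr aLink w = s'.arr aBucket u := by rw [e2, Function.update_self, hwu]
            change Chain _ (s₂.arr aLink w) _
            rw [this]
            exact hold
          · rw [List.filter_singleton, decide_eq_false hwu, cond_false, List.append_nil,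
              Function.update_of_ne (Ne.symm hwu)]
            exact hold
        · intro u hu'
          have : u ≠ s'.arr aNode w := by
            rw [hnode]
            exact (hu' w (by rw [hl]; simp)).symm
          rw [e1, Function.update_of_ne this]
          exact k3 u hu'
    · rintro s' hu ⟨k1, -⟩
      have hsz : s'.var vSize = O.length := (hu.var vSize (by decide)).trans (by simp [hsize])
      simp [Test.eval, k1, hsz]
    · simp
      omega
    · rintro s' ⟨⟨-, k⟩, -⟩
      exact k

/-- Writing from back to front undoes the reversal of the bucket. -/
theorem emptyBucket_spec {s : Mem} {l : List (Fin n)} {W : List ℕ} (hz : s.var vZero = 0)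
    (hch : Chain (fun x => s.arr aLink (x - 1)) (s.var vY) (l.map fun v => v.val + 1))
    (hW : IsSlice s aVerts (s.var vI) W) (hI : l.length ≤ s.var vI) :
    Ends emptyBucket s (8 * l.length + 1) fun s' =>
      (IsSlice s' aVerts (s'.var vI) (l.reverse.map Fin.val ++ W) ∧
        s'.var vI + l.length = s.var vI) ∧ Unchanged emptyBucket s s' := by
  refine Ends.unchanged ?_
  refine (Ends.loop l (fun pre post s' =>
    Chain (fun x => s.arr aLink (x - 1)) (s'.var vY) (post.map fun v => v.val + 1) ∧
    IsSlice s' aVerts (s'.var vI) (pre.reverse.map Fin.val ++ W) ∧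
    s'.var vI + pre.length = s.var vI) (fun _ => 7) ?_ ?_ ?_).mono ?_ ?_
  · exact ⟨hch, by simpa using hW, by simp⟩
  · rintro pre w post s' hl hu ⟨⟨k1, -, k1'⟩, k2, k3⟩
    have hlen := congrArg List.length hl
    rw [List.length_append, List.length_cons] at hlen
    have hz' : s'.var vZero = 0 := (hu.var vZero (by decide)).trans hz
    have hlink : s'.arr aLink = s.arr aLink := hu.arr aLink (by decide)
    obtain ⟨m, hm⟩ : ∃ m, s'.var vI = m + 1 := ⟨s'.var vI - 1, by omega⟩
    rw [hm] at k2 k3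
    refine ⟨by simp [Test.eval, hz', k1], ?_⟩
    refine Ends.simple_le (by decide) (by decide) ?_
    refine ⟨?_, ?_, ?_⟩
    · simpa [block, Cmd.eval, k1, hlink] using k1'
    · rw [List.reverse_append, List.map_append]
      have : ((block [.pred vY, .pred vI, .store aVerts vI vY, .load vY aLink vY]).eval s').var vI
          = m := by simp [block, Cmd.eval, hm]
      rw [this]
      exact isSlice_cons k2 (by simp [block, Cmd.eval, hm, k1])
    · simp [block, Cmd.eval, hm]
      omega
  · rintro s' hu ⟨k1, -⟩
    have hz' : s'.var vZero = 0 := (hu.var vZero (by decide)).trans hz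
    have : s'.var vY = 0 := k1
    simp [Test.eval, hz', this]
  · simp
    omega
  · rintro s' ⟨⟨-, k⟩, -⟩
    exact k

/-- The positions are filled from the end, whence `toks.reverse`: a list of nodes by decreasing
labels yields the vertices by increasing ones. Tokens are visited as well, at constant cost. -/
theorem collect_spec {s : Mem} {O : List (Fin n)} {toks : List ℕ} (hO : O.Nodup)
    (hz : s.var vZero = 0) (hsize : s.var vSize = O.length)
    (hch : Chain (s.arr aNext) (s.var vTop + 1) toks) (hnd : toks.Nodup)
    (hb : ∀ u ∈ toks, HoldsBucket s O u) (hmem : ∀ v ∈ O, s.arr aNode v ∈ toks) :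
    Ends collect s (8 * O.length + 8 * toks.length + 8) fun s' =>
      IsSlice s' aVerts 0 ((toks.reverse.flatMap fun u =>
        O.filter fun v : Fin n => decide (s.arr aNode v = u)).map Fin.val) ∧
        Unchanged collect s s' := by
  refine Ends.unchanged ?_
  set F : ℕ → List (Fin n) := fun u => O.filter fun v : Fin n => decide (s.arr aNode v = u) with hF
  have htot : (toks.flatMap F).length = O.length :=
    (flatMap_filter_perm (fun v : Fin n => s.arr aNode v) hO hnd hmem).length_eq
  refine Ends.seq_le (N := 5) (N' := 8 * O.length + 8 * toks.length + 1) (R := fun s₁ =>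
    s₁.var vX = s.var vTop + 1 ∧ s₁.var vI = O.length ∧ s₁.var vZero = 0 ∧ s₁.arr = s.arr)
    ?_ ?_ (by omega)
  · refine Ends.simple_le (by decide) (by decide) ?_
    simp [block, Cmd.eval, hsize, hz]
  · rintro s₁ ⟨g1, g2, g3, g4⟩
    refine (Ends.loop toks (fun pre post s' => Chain (s.arr aNext) (s'.var vX) post ∧
      IsSlice s' aVerts (s'.var vI) ((pre.reverse.flatMap F).map Fin.val) ∧
      s'.var vI + (pre.flatMap F).length = O.length) (fun u => 8 * (F u).length + 6)
      ?_ ?_ ?_).mono ?_ ?_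
    · exact ⟨by rw [g1]; exact hch, isSlice_nil _ _ _, by simpa using g2⟩
    · rintro pre u post s' hl hu ⟨⟨k1, k0, k1'⟩, k2, k3⟩
      have hz' : s'.var vZero = 0 := (hu.var vZero (by decide)).trans g3
      have hn : s'.arr aNext = s.arr aNext := by rw [hu.arr aNext (by decide), g4]
      have hlk : s'.arr aLink = s.arr aLink := by rw [hu.arr aLink (by decide), g4]
      have hbk : s'.arr aBucket = s.arr aBucket := by rw [hu.arr aBucket (by decide), g4]
      refine ⟨by simp [Test.eval, hz', k1, Nat.pos_of_ne_zero k0], ?_⟩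
      refine Ends.seq_le (N := 1) (N' := 8 * (F u).length + 4)
        (R := fun s₂ => s₂ = s'.setVar vY (s.arr aBucket u)) ?_ ?_ (by omega)
      · refine Ends.simple_le (by decide) (by decide) ?_
        simp [Cmd.eval, k1, hbk]
      · rintro _ rfl
        have hroom : (F u).length + (pre.flatMap F).length ≤ O.length := by
          rw [← htot, hl]
          simp
          omega
        refine Ends.seq_le (N := 8 * (F u).reverse.length + 1) (N' := 1)
          (emptyBucket_spec (l := (F u).reverse)
            (W := (pre.reverse.flatMap F).map Fin.val) (by simpa using hz') ?_
            (isSlice_congr (s := s') (by simpa using k2) rfl)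
            (by simp; omega)) ?_ (by simp)
        · have := hb u (by rw [hl]; simp)
          simpa [hlk, HoldsBucket] using this
        · rintro s₃ ⟨⟨m1, m2⟩, m3⟩
          have mx : s₃.var vX = u := (m3.var vX (by decide)).trans (by simp [k1])
          have mn : s₃.arr aNext = s.arr aNext := (m3.arr aNext (by decide)).trans (by simp [hn])
          refine Ends.simple_le (by decide) (by decide) ?_
          refine ⟨?_, ?_, ?_⟩
          · simpa [Cmd.eval, mx, mn] using k1'
          · rw [List.reverse_reverse, ← List.map_append] at m1
            rw [List.reverse_append, List.flatMap_append, List.reverse_singleton,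
              List.flatMap_singleton]
            exact isSlice_congr (s := s₃) (by simpa [Cmd.eval] using m1) (by simp [Cmd.eval])
          · simp only [Mem.setVar_var, List.length_reverse] at m2
            simp [Cmd.eval] at m2 k3 ⊢
            omega
    · rintro s' hu ⟨k1, -⟩
      have hz' : s'.var vZero = 0 := (hu.var vZero (by decide)).trans g3
      have : s'.var vX = 0 := k1
      simp [Test.eval, hz', this]
    · have e1 : (toks.map fun u => 8 * (F u).length + 6 + 1) =
          toks.map fun u => 8 * (F u).length + 7 := rfl
      rw [e1, List.sum_map_add, List.sum_map_mul_left]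
      rw [List.length_flatMap] at htot
      simp only [List.map_const', List.sum_replicate, smul_eq_mul, htot]
      omega
    · rintro s' ⟨⟨-, k2, k3⟩, -⟩
      -- The buckets partition `O`, so the filling ends exactly at position `0`.
      have : s'.var vI = 0 := by omega
      rwa [this] at k2

end Sorting

end AHU

namespace AHU

open Cmd

section Sorting

open Layout

/-- Both sides are sorted and both keep the order of `O` among equal labels. -/
theorem map_flatMap_filter_eq_sort {α β : Type*} [DecidableEq β] (f : α → β) (lb : β → List ℕ)
    (g : α → List ℕ) {O : List α} {l : List β} (hl : l.Pairwise fun a b => lb a < lb b)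
    (h : ∀ v ∈ O, f v ∈ l) (hg : ∀ v ∈ O, lb (f v) = g v) :
    ((l.flatMap fun u => O.filter fun v => decide (f v = u)).map fun v => (v, g v)) =
      (stableSort α).sort (O.map fun v => (v, g v)) := by
  have hmem : ∀ v ∈ l.flatMap fun u => O.filter fun v => decide (f v = u), v ∈ O := by
    intro v hv
    simp only [List.mem_flatMap, List.mem_filter] at hv
    obtain ⟨u, -, hv, -⟩ := hv
    exact hv
  refine eq_of_filter_key_eq Prod.snd ?_ ((stableSort α).sorted _) fun c => ?_
  · rw [List.pairwise_map]
    refine (pairwise_flatMap_filter f lb O hl).imp_of_mem ?_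
    intro a b ha hb hab
    rwa [hg a (hmem a ha), hg b (hmem b hb)] at hab
  · refine Eq.trans ?_ (filter_insertionSort_key Prod.snd _ c).symm
    rw [List.filter_map, List.filter_map]
    congr 1
    have h1 := filter_flatMap_filter f lb hl h c
    rw [List.filter_congr (q := fun v => decide (g v = c)) fun v hv => by rw [hg v (hmem v hv)],
      List.filter_congr (l := O) (q := fun v => decide (g v = c)) fun v hv => by rw [hg v hv]] at h1
    exact h1

variable {n : ℕ} {T : RTree (Fin n)} (A : AdjLists T.graph) {i : ℕ} {K : List (Fin n × ℕ)}

/-- The sorted list of the vertices of level `i`, with their labels. -/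
noncomputable def sortedLabels (i : ℕ) (K : List (Fin n × ℕ)) : List (Fin n × List ℕ) :=
  (stableSort (Fin n)).sort (createLabels T K ((bfsLevels A).list i))

theorem sortedLabels_perm (i : ℕ) (K : List (Fin n × ℕ)) :
    (sortedLabels A i K).Perm (createLabels T K ((bfsLevels A).list i)) :=
  (stableSort (Fin n)).perm _

theorem map_lab_sortedLabels (i : ℕ) (K : List (Fin n × ℕ)) :
    (((sortedLabels A i K).map Prod.fst).map fun v => (v, lab T K v)) = sortedLabels A i K := by
  rw [List.map_map]
  conv_rhs => rw [← List.map_id (sortedLabels A i K)]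
  refine List.map_congr_left fun q hq => ?_
  exact Prod.ext rfl (snd_eq_lab (sortedLabels_perm A i K) hq).symm

/-- The memory after the labels of level `i` have been sorted. -/
structure SortedState (i : ℕ) (K : List (Fin n × ℕ)) (s : Mem) : Prop where
  base : Base A i s
  nodes : FreshNodes s
  labelled : Labelled A i ((sortedLabels A i K).map Prod.fst) K s
  node : ∀ v ∈ (sortedLabels A i K).map Prod.fst, ∀ w ∈ (sortedLabels A i K).map Prod.fst,
    s.arr aNode v = s.arr aNode w ↔ lab T K v = lab T K w

variable {A}

theorem lexSort_spec {s : Mem} (hi : i ≤ T.height) (hK : IsLevelList T i K)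
    (h : Created A i K s) :
    Ends lexSort s (58 * K.length + 30 * (created (bfsLevels A) i K).length + 49)
      fun s' => SortedState A i K s' := by
  set O := created (bfsLevels A) i K with hOdef
  have hO : O.Nodup := nodup_created _ i K
  -- `B` exceeds all keys. It occurs only in the labels of tokens and is never computed by the
  -- machine.
  obtain ⟨B, hB⟩ : ∃ B, ∀ q ∈ K, q.2 < B := by
    refine ⟨(K.map Prod.snd).sum + 1, fun q hq => ?_⟩
    have := List.single_le_sum (l := K.map Prod.snd) (by simp) q.2 (List.mem_map_of_mem hq)
    omega
  have hpO : ∀ q ∈ K, T.parent q.1 ∈ O := fun q hq =>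
    (hK.mem_created (bfsLevels A) hi _).2 (hK.isChild hi hq).2
  refine (Ends.seq_le (N := 7 * O.length + 16)
    (N' := 58 * K.length + 23 * O.length + 32)
    (Q := fun s' => ((∀ u ≥ s'.var vFresh, s'.arr aLastKey u = 0) ∧
      (∀ u ≥ s'.var vFresh, s'.arr aNext u = 0) ∧ (∀ u ≥ s'.var vFresh, s'.arr aBucket u = 0) ∧
      1 ≤ s'.var vFresh) ∧ IsSlice s' aVerts 0 ((sortedLabels A i K).map fun q => q.1.val) ∧
      ∀ v ∈ O, ∀ w ∈ O, s'.arr aNode v = s'.arr aNode w ↔ lab T K v = lab T K w)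
    (initNodes_spec (T := T) B h.nodes h.labelled.size h.labelled.verts) ?_
    (by omega)).unchanged.mono le_rfl ?_
  · rintro s₁ ⟨⟨ids, toks, lb, hT, hlen⟩, hu⟩
    refine Ends.seq_le (N := 42 * K.length + 3) (N' := 16 * K.length + 23 * O.length + 28)
      (buildTrie_spec hB hK.sorted hpO ?_ (h.saved.of_unchanged hu (by decide)) hT) ?_ (by omega)
    · intro x
      rw [hu.arr aParent (by decide)]
      exact h.base.prepared.parent x
    rintro s₂ ⟨⟨ids₂, toks₂, lb₂, b, hT₂, hlen₂⟩, hu₂⟩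
    have hsz₂ : s₂.var vSize = O.length := by
      rw [hu₂.var vSize (by decide), hu.var vSize (by decide)]
      exact h.labelled.size
    have hvt₂ : s₂.arr aVerts = s.arr aVerts := by
      rw [hu₂.arr aVerts (by decide), hu.arr aVerts (by decide)]
    have hz₂ : s₂.var vZero = 0 := by
      rw [hu₂.var vZero (by decide), hu.var vZero (by decide)]
      exact h.base.zero
    refine Ends.seq_le (N := 15 * O.length + 3) (N' := 16 * K.length + 8 * O.length + 24)
      (fillBuckets_spec hO hsz₂ (isSlice_congr h.labelled.verts hvt₂) hT₂.bucket) ?_ (by omega)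
    rintro s₃ ⟨⟨hb₃, hbk₃⟩, hu₃⟩
    have hmem : ∀ v ∈ O, s₂.arr aNode v ∈ toks₂ := fun v hv => (hT₂.trie.mem _ (hT₂.mem v hv)).1
    have hn₃ : s₃.arr aNode = s₂.arr aNode := hu₃.arr aNode (by decide)
    refine (collect_spec hO (toks := toks₂) ?_ ?_ ?_ hT₂.trie.nodup ?_ ?_).mono (by omega) ?_
    · rw [hu₃.var vZero (by decide), hz₂]
    · rw [hu₃.var vSize (by decide), hsz₂]
    · rw [hu₃.var vTop (by decide), hu₃.arr aNext (by decide)]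
      exact hT₂.trie.chain
    · exact fun u hu => hb₃ u (hT₂.trie.range u hu).1
    · rw [hn₃]
      exact hmem
    rintro s₄ ⟨hv₄, hu₄⟩
    have hf : s₄.var vFresh = s₂.var vFresh := by
      rw [hu₄.var vFresh (by decide), hu₃.var vFresh (by decide)]
    have hn₄ : s₄.arr aNode = s₂.arr aNode := by rw [hu₄.arr aNode (by decide), hn₃]
    refine ⟨⟨?_, ?_, ?_, ?_⟩, ?_, ?_⟩
    · rw [hf, hu₄.arr aLastKey (by decide), hu₃.arr aLastKey (by decide)]
      exact hT₂.fresh.lastKey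
    · rw [hf, hu₄.arr aNext (by decide), hu₃.arr aNext (by decide)]
      exact hT₂.fresh.next
    · intro u hu
      rw [hf] at hu
      -- Only buckets of nodes reached by vertices of `O` have been filled, and these nodes are
      -- below `vFresh`.
      rw [hu₄.arr aBucket (by decide), hbk₃ u]
      · exact hT₂.fresh.bucket u hu
      · rintro v hv rfl
        have := (hT₂.trie.range _ (hmem v hv)).2
        omega
    · rw [hf]
      exact hT₂.fresh.pos
    · have := map_flatMap_filter_eq_sort (fun v : Fin n => s₂.arr aNode v) lb₂ (lab T K) (O := O)
        (l := toks₂.reverse) (List.pairwise_reverse.2 hT₂.trie.sorted)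
        (fun v hv => List.mem_reverse.2 (hmem v hv)) hT₂.label
      rw [hn₃] at hv₄
      rw [sortedLabels, createLabels_eq_created, ← hOdef, ← this, List.map_map]
      exact hv₄
    · intro v hv w hw
      rw [hn₄, ← hT₂.label v hv, ← hT₂.label w hw]
      exact ⟨fun h => by rw [h], fun h => hT₂.trie.lb_inj (hmem v hv) (hmem w hw) h⟩
  · rintro s' ⟨⟨⟨f1, f2, f3, f4⟩, hv, hn⟩, hu⟩
    have hp := map_fst_perm_created (sortedLabels_perm A i K)
    refine ⟨h.base.of_unchanged hu (by decide) (by decide), ⟨f4, f1, f2, f3⟩, ?_, ?_⟩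
    · refine ⟨?_, ?_, ?_, ?_, ?_, ?_⟩
      · rw [hu.var vSize (by decide), h.labelled.size, hp.length_eq]
      · rw [List.map_map]
        exact hv
      · intro v hiv
        rw [hu.arr aListed (by decide), hp.mem_iff]
        exact h.labelled.listed v hiv
      · rw [hu.arr aTupLen (by decide)]
        exact h.labelled.tupLen
      · rw [hu.arr aTupEnd (by decide)]
        exact h.labelled.tupEnd
      · exact fun v hiv => isSlice_congr (h.labelled.tupData v hiv) (hu.arr aTupData (by decide))
    · intro v hv w hw
      exact hn v (hp.mem_iff.1 hv) w (hp.mem_iff.1 hw)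

end Sorting

/-! ### Condensing the labels -/

section Condense

open Layout

/-- `CondenseLabels`. -/
def condense : Cmd :=
  .seq (block [.const vI 0, .const vK 0, .load vW aVerts vI, .load vU aNode vW])
    (.loop (.lt vI vSize) (block
      [.load vW aVerts vI, .load vX aNode vW,
        .ite (.eq vX vU) nop (block [.succ vK, .copy vU vX]),
        .store aInt vW vK, .succ vI]))

variable {n : ℕ} {T : RTree (Fin n)} (A : AdjLists T.graph) {i : ℕ} {K : List (Fin n × ℕ)}

/-- The memory after the labels of level `i` have been condensed. -/
structure CondensedState (i : ℕ) (K : List (Fin n × ℕ)) (s : Mem) : Prop where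
  level : s.var vLevel = i
  ints : treeLayout.HoldsInts s K
  next : LoopInv A (i + 1) K (s.setVar vLevel (i + 1))

variable {A}

theorem condenseLabels_eq_condenseAux {V : Type*} (M : List (V × List ℕ)) :
    condenseLabels M = condenseAux 0 ((M.map Prod.snd).headD []) M := by
  cases M <;> rfl

/-- Equality of labels is tested on trie nodes, in one step. In the invariant, `D` is the part of
the result that has been stored and `p` is the previous label, whose node is in `vU`. -/
theorem condense_ints {s : Mem} {M : List (Fin n × List ℕ)} (hM : (M.map Prod.fst).Nodup)
    (hsize : s.var vSize = M.length) (hverts : IsSlice s aVerts 0 (M.map fun q => q.1.val))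
    (hnode : ∀ q ∈ M, ∀ r ∈ M, s.arr aNode q.1 = s.arr aNode r.1 ↔ q.2 = r.2) :
    Ends condense s (13 * M.length + 9) fun s' =>
      (∀ q ∈ condenseLabels M, s'.arr aInt q.1 = q.2) ∧ Unchanged condense s s' := by
  refine Ends.unchanged ?_
  refine Ends.seq_le (N := 7) (N' := 13 * M.length + 1) (R := fun s₁ =>
    s₁.var vI = 0 ∧ s₁.var vK = 0 ∧ s₁.var vU = s.arr aNode (s.arr aVerts 0) ∧
    s₁.var vSize = M.length ∧ s₁.arr = s.arr) ?_ ?_ (by omega)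
  · refine Ends.simple_le (by decide) (by decide) ?_
    simp [block, Cmd.eval, hsize]
  · rintro s₁ ⟨g1, g2, g3, g4, g5⟩
    refine (Ends.loop M (fun pre post s' => s'.var vI = pre.length ∧
      ∃ (p : List ℕ) (D : List (Fin n × ℕ)),
        condenseLabels M = D ++ condenseAux (s'.var vK) p post ∧
        D.map Prod.fst = pre.map Prod.fst ∧ (∀ q ∈ D, s'.arr aInt q.1 = q.2) ∧
        ∀ q ∈ M, s.arr aNode q.1 = s'.var vU ↔ q.2 = p) (fun _ => 12) ?_ ?_ ?_).mono ?_ ?_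
    · refine ⟨g1, (M.map Prod.snd).headD [], [], ?_, rfl, by simp, ?_⟩
      · rw [g2, condenseLabels_eq_condenseAux, List.nil_append]
      · intro q hq
        -- For an empty list `vU` is meaningless, but there is nothing to compare it with.
        cases M with
        | nil => simp at hq
        | cons r M =>
          have : s.arr aVerts 0 = r.1 := by
            simpa using hverts 0 (by simp)
          rw [g3, this]
          exact hnode q hq r (by simp)
    · rintro pre q post s' hl hu ⟨k1, p, D, k2, k3, k4, k5⟩
      have hlen := congrArg List.length hl
      rw [List.length_append, List.length_cons] at hlen
      have hqM : q ∈ M := by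
        rw [hl]
        simp
      have hsz : s'.var vSize = M.length := (hu.var vSize (by decide)).trans g4
      have hn : s'.arr aNode = s.arr aNode := by rw [hu.arr aNode (by decide), g5]
      have hw : s'.arr aVerts pre.length = q.1 := by
        rw [hu.arr aVerts (by decide), g5]
        refine isSlice_get (xs := pre.map fun q => q.1.val) (p := 0)
          (ys := post.map fun q => q.1.val) ?_ (by simp)
        rw [hl] at hverts
        simpa using hverts
      have hqD : ∀ r ∈ D, r.1 ≠ q.1 := by
        rw [hl, List.map_append, ← k3, List.nodup_append] at hM
        exact fun r hr => hM.2.2 r.1 (List.mem_map_of_mem hr) q.1 (by simp)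
      have hstore : ∀ (s₂ : Mem) (x : ℕ),
          s₂.arr aInt = Function.update (s'.arr aInt) q.1 x →
          ∀ r ∈ D ++ [(q.1, x)], s₂.arr aInt r.1 = r.2 := by
        intro s₂ x hs r hr
        rw [hs]
        rcases List.mem_append.1 hr with hr | hr
        · rw [Function.update_of_ne (fun e => hqD r hr (Fin.ext e))]
          exact k4 r hr
        · rw [List.mem_singleton] at hr
          simp [hr]
      refine ⟨?_, ?_⟩
      · simp only [Test.eval, k1, hsz, decide_eq_true_eq]
        omega
      · refine Ends.simple_le (by decide) (by decide) ?_
        rw [List.length_append, List.length_singleton, ← k1]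
        rw [← k1] at hw
        by_cases hq : s.arr aNode q.1 = s'.var vU
        · have hp := (k5 q hqM).1 hq
          refine ⟨by simp [block, Cmd.eval, Test.eval, hw, hn, hq], p, D ++ [(q.1, s'.var vK)],
            ?_, by simp [k3], hstore _ _ ?_, ?_⟩
          · rw [k2]
            obtain ⟨q1, q2⟩ := q
            simp only at hp
            simp [block, Cmd.eval, Test.eval, hw, hn, hq, condenseAux, hp]
          · simp [block, Cmd.eval, Test.eval, hw, hn, hq]
          · simpa [block, Cmd.eval, Test.eval, hw, hn, hq] using k5
        · have hp := mt (k5 q hqM).2 hq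
          refine ⟨by simp [block, Cmd.eval, Test.eval, hw, hn, hq], q.2,
            D ++ [(q.1, s'.var vK + 1)], ?_, by simp [k3], hstore _ _ ?_, ?_⟩
          · rw [k2]
            obtain ⟨q1, q2⟩ := q
            simp only at hp
            simp [block, Cmd.eval, Test.eval, hw, hn, hq, condenseAux, hp]
          · simp [block, Cmd.eval, Test.eval, hw, hn, hq]
          · intro r hr
            have := hnode r hr q hqM
            simpa [block, Cmd.eval, Test.eval, hw, hn, hq] using this
    · rintro s' hu ⟨k1, -⟩
      have hsz : s'.var vSize = M.length := (hu.var vSize (by decide)).trans g4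
      simp [Test.eval, k1, hsz]
    · simp
      omega
    · rintro s' ⟨⟨-, p, D, k2, k3, k4, -⟩, -⟩
      rw [k2, condenseAux, List.append_nil]
      exact k4

theorem condense_spec {s : Mem} (hi : i ≤ T.height) (hK : IsLevelList T i K)
    (h : SortedState A i K s) :
    Ends condense s (13 * (created (bfsLevels A) i K).length + 9)
      (CondensedState A i (condenseLabels (sortedLabels A i K))) := by
  have hp := map_fst_perm_created (sortedLabels_perm A i K)
  have hsorted : (sortedLabels A i K).Pairwise fun a b => a.2 ≤ b.2 := (stableSort _).sorted _
  have hlen : (sortedLabels A i K).length = (created (bfsLevels A) i K).length := by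
    rw [← hp.length_eq, List.length_map]
  have hfst := condenseLabels_map_fst hsorted
  have hmem : ∀ v, v ∈ (sortedLabels A i K).map Prod.fst ↔ T.level v = i := fun v => by
    rw [hp.mem_iff, hK.mem_created _ hi]
  -- The pairs of `K` have their parents on level `i`, so the vertices of higher levels have
  -- received nothing yet and the invariant holds for `i + 1`.
  have hnil : ∀ v, i + 1 ≤ T.level v → lab T K v = [] := fun v hv => by
    refine lab_eq_nil T (o := leaves T ((bfsLevels A).list i)) fun hm => ?_
    have := (hK.mem_created (bfsLevels A) hi v).1 hm
    omega
  have hvs := h.labelled.verts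
  rw [List.map_map] at hvs
  refine (condense_ints ?_ ?_ hvs ?_).mono (by omega) ?_
  · rw [hp.nodup_iff]
    exact nodup_created _ i K
  · rw [h.labelled.size, List.length_map]
  · intro q hq r hr
    rw [snd_eq_lab (sortedLabels_perm A i K) hq, snd_eq_lab (sortedLabels_perm A i K) hr]
    exact h.node _ (List.mem_map_of_mem hq) _ (List.mem_map_of_mem hr)
  · rintro s' ⟨k, hu⟩
    have hb := h.base.of_unchanged hu (by decide) (by decide)
    have hn := h.nodes.of_unchanged hu (by decide)
    have hints : treeLayout.HoldsInts s' (condenseLabels (sortedLabels A i K)) := by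
      refine ⟨?_, ?_, k⟩
      · rw [← List.length_map (f := Prod.fst), hfst]
        exact (hu.var vSize (by decide)).trans h.labelled.size
      · have := h.labelled.verts
        rw [← hfst, List.map_map] at this
        exact isSlice_congr this (hu.arr aVerts (by decide))
    refine ⟨hb.level, hints, ⟨⟨hb.prepared.adj.congr rfl rfl, hb.prepared.parent,
      hb.prepared.levels⟩, by simp,
      by simpa using hb.zero⟩, ⟨hn.pos, hn.lastKey, hn.next, hn.bucket⟩, hints, ?_, ?_, ?_⟩
    · intro v hv
      rw [Mem.setVar_arr, hu.arr aListed (by decide)]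
      refine (h.labelled.listed v (by omega)).2 fun hm => ?_
      have := (hmem v).1 hm
      omega
    · intro v hv
      rw [Mem.setVar_arr, hu.arr aTupLen (by decide), h.labelled.tupLen v (by omega), hnil v hv]
      rfl
    · intro v hv
      rw [Mem.setVar_arr, hu.arr aTupEnd (by decide), h.labelled.tupEnd v (by omega), hnil v hv]
      rfl

end Condense

end AHU

namespace AHU

open Cmd

/-! ### Two trees in one memory -/

section Registers

/-- The registers of the two trees, `b = 0` and `b = 1`. The registers that leave the remainder `4`
or `5` modulo `6` are common to both. -/
def reg (b x : ℕ) : ℕ := 6 * (x / 2) + x % 2 + 2 * b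

theorem reg_injective (b : ℕ) : Function.Injective (reg b) := by
  intro x y h
  simp only [reg] at h
  omega

theorem reg_zero_ne_reg_one (x y : ℕ) : reg 0 x ≠ reg 1 y := by
  simp only [reg]
  omega

theorem reg_zero_mod (x : ℕ) : reg 0 x % 6 < 4 := by
  simp only [reg]
  omega

theorem reg_one_mod (x : ℕ) : reg 1 x % 6 < 4 := by
  simp only [reg]
  omega

theorem AgreeOff.view_eq {f g : ℕ → ℕ} {s s' : Mem} (h : AgreeOff f s s')
    (hfg : ∀ x y, f x ≠ g y) : view g s' = view g s :=
  Mem.ext' (fun x => (h (g x) fun y => hfg y x).1) fun a => (h (g a) fun y => hfg y a).2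

/-- `s'` agrees with `s` in the common variables. -/
def AgreeCommon (s s' : Mem) : Prop := ∀ x, 4 ≤ x % 6 → s'.var x = s.var x

/-- Do `c` for both trees. -/
def both (c : Cmd) : Cmd := .seq (c.rename (reg 0)) (c.rename (reg 1))

/-- The two renamings have disjoint ranges, so either run leaves the view of the other tree as it
was. -/
theorem Ends.both {c : Cmd} {s : Mem} {N N' : ℕ} {Q Q' : Mem → Prop}
    (h : Ends c (view (reg 0) s) N Q) (h' : Ends c (view (reg 1) s) N' Q') :
    Ends (both c) s (N + N' + 1) fun s' =>
      (Q (view (reg 0) s') ∧ Q' (view (reg 1) s')) ∧ AgreeCommon s s' := by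
  refine Ends.seq (h.rename (reg_injective 0)) ?_
  rintro s₁ ⟨hQ, h1⟩
  rw [← h1.view_eq (g := reg 1) reg_zero_ne_reg_one] at h'
  refine (h'.rename (reg_injective 1)).mono le_rfl ?_
  rintro s₂ ⟨hQ', h2⟩
  rw [← h2.view_eq (g := reg 0) fun x y => (reg_zero_ne_reg_one y x).symm] at hQ
  refine ⟨⟨hQ, hQ'⟩, fun x hx => ?_⟩
  rw [(h2 x fun y e => ?_).1, (h1 x fun y e => ?_).1]
  · have := reg_zero_mod y
    omega
  · have := reg_one_mod y
    omega

/-- The layout with renamed registers. -/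
def Layout.rename (f : ℕ → ℕ) (l : Layout) : Layout where
  height := f l.height
  lvlStart := f l.lvlStart
  lvlLen := f l.lvlLen
  lvlData := f l.lvlData
  size := f l.size
  verts := f l.verts
  tupStart := f l.tupStart
  tupLen := f l.tupLen
  tupData := f l.tupData
  int := f l.int

theorem Layout.holdsTuples_rename {f : ℕ → ℕ} {l : Layout} {s : Mem} {n : ℕ}
    {L : List (Fin n × List ℕ)} (h : l.HoldsTuples (view f s) L) :
    (l.rename f).HoldsTuples s L := h

notation "cFlag" => (4 : ℕ)
notation "cI" => (5 : ℕ)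
notation "cW" => (10 : ℕ)
notation "dW" => (11 : ℕ)
notation "cX" => (16 : ℕ)
notation "dX" => (17 : ℕ)
notation "cY" => (22 : ℕ)
notation "dY" => (23 : ℕ)
notation "cZero" => (28 : ℕ)
notation "cOne" => (29 : ℕ)
notation "cBound" => (34 : ℕ)
notation "cOk" => (35 : ℕ)

end Registers

/-! ### Comparing the labels -/

section Compare

open Layout

/-- Compare the slices of length `cX` of the arrays `a` and `b` that begin at `cW` and `dW`. -/
def compareSlices (a b : ℕ) : Cmd :=
  .loop (.lt cZero cX) (block
    [.load cY a cW, .load dY b dW, .ite (.eq cY dY) (.copy cY cY) (.const cFlag 0), .succ cW,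
      .succ dW, .pred cX])

/-- `F` stands for the outcome of earlier comparisons. A mismatch clears the flag, which is never
set again, so the flag accumulates a conjunction. -/
theorem compareSlices_spec {a b : ℕ} {s : Mem} {xs ys : List ℕ} {F : Prop}
    (hx : IsSlice s a (s.var cW) xs) (hy : IsSlice s b (s.var dW) ys)
    (hlen : xs.length = ys.length) (hX : s.var cX = xs.length) (hz : s.var cZero = 0)
    (hF : s.var cFlag = 1 ↔ F) :
    Ends (compareSlices a b) s (13 * xs.length + 1) fun s' =>
      (s'.var cFlag = 1 ↔ F ∧ xs = ys) ∧ Unchanged (compareSlices a b) s s' := by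
  refine Ends.unchanged ?_
  have hzl : (xs.zip ys).length = xs.length := by simp [hlen]
  have hu1 : (xs.zip ys).map Prod.fst = xs := by
    rw [List.map_fst_zip]
    omega
  have hu2 : (xs.zip ys).map Prod.snd = ys := by
    rw [List.map_snd_zip]
    omega
  refine (Ends.loop (xs.zip ys) (fun pre post s' => s'.var cW = s.var cW + pre.length ∧
    s'.var dW = s.var dW + pre.length ∧ s'.var cX = post.length ∧
    (s'.var cFlag = 1 ↔ F ∧ ∀ q ∈ pre, q.1 = q.2)) (fun _ => 12) ?_ ?_ ?_).mono ?_ ?_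
  · exact ⟨rfl, rfl, by rw [hX, hzl], by simpa using hF⟩
  · rintro pre q post s' hl hu ⟨k1, k2, k3, k4⟩
    have hz' : s'.var cZero = 0 := (hu.var cZero (by simp [block, writesVar])).trans hz
    have ha : s'.arr a = s.arr a := hu.arr a (by simp [block, writesArr])
    have hb : s'.arr b = s.arr b := hu.arr b (by simp [block, writesArr])
    have h1 : s.arr a (s'.var cW) = q.1 := by
      refine isSlice_get (xs := pre.map Prod.fst) (ys := post.map Prod.fst) ?_ (by simp [k1])
        (p := s.var cW)
      rw [← hu1, hl] at hx
      simpa using hx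
    have h2 : s.arr b (s'.var dW) = q.2 := by
      refine isSlice_get (xs := pre.map Prod.snd) (ys := post.map Prod.snd) ?_ (by simp [k2])
        (p := s.var dW)
      rw [← hu2, hl] at hy
      simpa using hy
    refine ⟨by simp [Test.eval, hz', k3], ?_⟩
    refine Ends.simple_le rfl (Nat.le_of_eq rfl) ?_
    rw [List.length_append, List.length_singleton, ← add_assoc, ← add_assoc, ← k1, ← k2]
    have hall : (∀ r ∈ pre ++ [q], r.1 = r.2) ↔ (∀ r ∈ pre, r.1 = r.2) ∧ q.1 = q.2 := by
      simp only [List.mem_append, List.mem_singleton, or_imp, forall_and, forall_eq]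
    by_cases hq : q.1 = q.2
    · refine ⟨?_, ?_, ?_, ?_⟩
      · simp [block, Cmd.eval, Test.eval, ha, hb, h1, h2, hq]
      · simp [block, Cmd.eval, Test.eval, ha, hb, h1, h2, hq]
      · simp [block, Cmd.eval, Test.eval, ha, hb, h1, h2, hq, k3]
      · rw [hall, and_iff_left hq, ← k4]
        simp [block, Cmd.eval, Test.eval, ha, hb, h1, h2, hq]
    · refine ⟨?_, ?_, ?_, ?_⟩
      · simp [block, Cmd.eval, Test.eval, ha, hb, h1, h2, hq]
      · simp [block, Cmd.eval, Test.eval, ha, hb, h1, h2, hq]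
      · simp [block, Cmd.eval, Test.eval, ha, hb, h1, h2, hq, k3]
      · rw [hall]
        simp [block, Cmd.eval, Test.eval, ha, hb, h1, h2, hq]
  · rintro s' hu ⟨-, -, k3, -⟩
    have hz' : s'.var cZero = 0 := (hu.var cZero (by simp [block, writesVar])).trans hz
    simp [Test.eval, hz', k3]
  · simp [hlen]
    omega
  · rintro s' ⟨⟨-, -, -, k4⟩, -⟩
    rw [k4]
    refine and_congr_right fun _ => ?_
    constructor
    · exact fun h => hu1.symm.trans ((List.map_congr_left h).trans hu2)
    · intro h
      exact List.map_inj_left.1 (hu1.trans (h.trans hu2.symm))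

/-- Compare the labels of the lists laid out as `l` and `l'`. -/
def compare (l l' : Layout) : Cmd :=
  .seq (block [.const cFlag 0, .const cI 0, .const cZero 0])
    (.ite (.eq l.size l'.size)
      (.seq (.const cFlag 1)
        (.loop (.lt cI l.size) (.seq
          (block [.load cW l.verts cI, .load dW l'.verts cI, .load cX l.tupLen cW,
            .load dX l'.tupLen dW])
          (.seq (.ite (.eq cX dX)
              (.seq (block [.load cW l.tupStart cW, .load dW l'.tupStart dW])
                (compareSlices l.tupData l'.tupData))
              (.const cFlag 0))
            (.succ cI)))))
      (.copy cFlag cFlag))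

variable {n n' : ℕ} {l l' : Layout}

/-- Slices are scanned only if their lengths agree, so the cost is controlled by the labels of the
first list alone. -/
theorem compare_spec {s : Mem} {L : List (Fin n × List ℕ)} {L' : List (Fin n' × List ℕ)}
    (hl : l.size % 6 < 4) (hl' : l'.size % 6 < 4) (h : l.HoldsTuples s L)
    (h' : l'.HoldsTuples s L') :
    Ends (compare l l') s (13 * (L.map fun q => q.2.length).sum + 17 * L.length + 10)
      fun s' => (s'.var cFlag = 1 ↔ L.map Prod.snd = L'.map Prod.snd) ∧
        Unchanged (compare l l') s s' := by
  refine Ends.unchanged ?_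
  obtain ⟨h1, h2, h3⟩ := h
  obtain ⟨h1', h2', h3'⟩ := h'
  refine Ends.seq_le (N := 5) (N' := 13 * (L.map fun q => q.2.length).sum + 17 * L.length + 4)
    (R := fun s₁ => s₁.var l.size = L.length ∧ s₁.var l'.size = L'.length ∧ s₁.var cFlag = 0 ∧
      s₁.var cI = 0 ∧ s₁.var cZero = 0 ∧ s₁.arr = s.arr) ?_ ?_ (by omega)
  · refine Ends.simple_le rfl le_rfl ?_
    have e : ∀ x, x % 6 < 4 → x ≠ 4 ∧ x ≠ 5 ∧ x ≠ 28 := by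
      intro x hx
      omega
    simp [block, Cmd.eval, e _ hl, e _ hl', h1, h1']
  rintro s₁ ⟨g1, g2, g3, g4, g5, g6⟩
  refine Ends.ite ?_ ?_
  · intro hsz
    simp only [Test.eval, g1, g2, decide_eq_true_eq] at hsz
    have hu1 : (L.zip L').map Prod.fst = L := List.map_fst_zip (by omega)
    have hu2 : (L.zip L').map Prod.snd = L' := List.map_snd_zip (by omega)
    have hzl : (L.zip L').length = L.length := by simp [hsz]
    refine Ends.seq_le (N := 1)
      (N' := 13 * (L.map fun q => q.2.length).sum + 17 * L.length + 1) (R := fun s₂ =>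
        s₂ = s₁.setVar cFlag 1) (Ends.simple_le rfl le_rfl rfl) ?_ (by omega)
    rintro _ rfl
    refine (Ends.loop (L.zip L') (fun pre _ s' => s'.var cI = pre.length ∧
      (s'.var cFlag = 1 ↔ ∀ q ∈ pre, q.1.2 = q.2.2)) (fun q => 13 * q.1.2.length + 16)
      ?_ ?_ ?_).mono ?_ ?_
    · simp [g4]
    · rintro pre q post s' hp hu ⟨k1, k2⟩
      have hlen := congrArg List.length hp
      rw [List.length_append, List.length_cons, hzl] at hlen
      have hz : s'.var cZero = 0 := by
        rw [hu.var cZero (by simp [compareSlices, block, writesVar])]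
        simpa using g5
      have hsize : s'.var l.size = L.length := by
        rw [hu.var l.size (by simp [compareSlices, block, writesVar]; omega)]
        rw [Mem.setVar_var, if_neg (by omega), g1]
      have harr : s'.arr = s.arr := by
        funext a
        rw [hu.arr a (by simp [compareSlices, block, writesArr]), Mem.setVar_arr, g6]
      have hqm := List.mem_append_right pre (List.mem_cons_self (a := q) (l := post))
      rw [← hp] at hqm
      obtain ⟨m1, m2⟩ := h3 q.1 (List.of_mem_zip hqm).1
      obtain ⟨m1', m2'⟩ := h3' q.2 (List.of_mem_zip hqm).2
      have hw : s.arr l.verts pre.length = q.1.1 := by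
        refine isSlice_get (xs := pre.map fun q => q.1.1.val) (p := 0)
          (ys := post.map fun q => q.1.1.val) ?_ (by simp)
        rw [← hu1, hp] at h2
        simpa [Function.comp_def] using h2
      have hw' : s.arr l'.verts pre.length = q.2.1 := by
        refine isSlice_get (xs := pre.map fun q => q.2.1.val) (p := 0)
          (ys := post.map fun q => q.2.1.val) ?_ (by simp)
        rw [← hu2, hp] at h2'
        simpa [Function.comp_def] using h2'
      have hall : (∀ r ∈ pre ++ [q], r.1.2 = r.2.2) ↔
          (∀ r ∈ pre, r.1.2 = r.2.2) ∧ q.1.2 = q.2.2 := by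
        simp only [List.mem_append, List.mem_singleton, or_imp, forall_and, forall_eq]
      refine ⟨?_, ?_⟩
      · simp only [Test.eval, k1, hsize, decide_eq_true_eq]
        omega
      refine Ends.seq_le (N := 7) (N' := 13 * q.1.2.length + 8) (R := fun s₂ =>
        s₂.var cW = q.1.1 ∧ s₂.var dW = q.2.1 ∧ s₂.var cX = q.1.2.length ∧
        s₂.var dX = q.2.2.length ∧ s₂.var cI = pre.length ∧ s₂.var cFlag = s'.var cFlag ∧
        s₂.var cZero = 0 ∧ s₂.arr = s.arr) ?_ ?_ (by omega)
      · refine Ends.simple_le rfl le_rfl ?_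
        simp [block, Cmd.eval, harr, k1, hw, hw', m1, m1', hz]
      rintro s₂ ⟨f1, f2, f3, f4, f5, f6, f7, f8⟩
      refine Ends.seq_le (N := 13 * q.1.2.length + 6) (N' := 1) (R := fun s₃ =>
        s₃.var cI = pre.length ∧ (s₃.var cFlag = 1 ↔ ∀ r ∈ pre ++ [q], r.1.2 = r.2.2))
        ?_ ?_ (by omega)
      · refine Ends.ite ?_ ?_
        · intro hX
          simp only [Test.eval, f3, f4, decide_eq_true_eq] at hX
          refine Ends.seq_le (N := 3) (N' := 13 * q.1.2.length + 1) (R := fun s₃ =>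
            s₃.var cW = s.arr l.tupStart q.1.1 ∧ s₃.var dW = s.arr l'.tupStart q.2.1 ∧
            s₃.var cX = q.1.2.length ∧ s₃.var cI = pre.length ∧ s₃.var cFlag = s'.var cFlag ∧
            s₃.var cZero = 0 ∧ s₃.arr = s.arr) ?_ ?_ (by omega)
          · refine Ends.simple_le rfl le_rfl ?_
            simp [block, Cmd.eval, f1, f2, f3, f5, f6, f7, f8]
          rintro s₃ ⟨e1, e2, e3, e4, e5, e6, e7⟩
          refine (compareSlices_spec (xs := q.1.2) (ys := q.2.2) (F := ∀ r ∈ pre, r.1.2 = r.2.2)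
            ?_ ?_ hX e3 e6 (by rw [e5, k2])).mono le_rfl ?_
          · rw [e1]
            exact isSlice_congr m2 (by rw [e7])
          · rw [e2]
            exact isSlice_congr m2' (by rw [e7])
          · rintro s₄ ⟨n1, n2⟩
            rw [hall]
            exact ⟨(n2.var cI (by simp [compareSlices, block, writesVar])).trans e4, n1⟩
        · intro hX
          simp only [Test.eval, f3, f4, decide_eq_false_iff_not] at hX
          refine Ends.simple_le rfl (by simp [cost]) ?_
          have : q.1.2 ≠ q.2.2 := fun e => hX (by rw [e])
          rw [hall]
          simp [Cmd.eval, f5, this]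
      · rintro s₃ ⟨e1, e2⟩
        refine Ends.simple_le rfl le_rfl ?_
        simpa [Cmd.eval, e1] using e2
    · rintro s' hu ⟨k1, -⟩
      have hsize : s'.var l.size = L.length := by
        rw [hu.var l.size (by simp [compareSlices, block, writesVar]; omega)]
        rw [Mem.setVar_var, if_neg (by omega), g1]
      simp [Test.eval, k1, hsize, hsz]
    · have e : ((L.zip L').map fun q => 13 * q.1.2.length + 16 + 1) =
          ((L.zip L').map Prod.fst).map fun q => 13 * q.2.length + 17 := by
        rw [List.map_map]
        rfl
      rw [e, hu1, List.sum_map_add, List.sum_map_mul_left]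
      simp only [List.map_const', List.sum_replicate, smul_eq_mul]
      omega
    · rintro s' ⟨⟨-, k2⟩, -⟩
      have e : L.map Prod.snd = (L.zip L').map fun q => q.1.2 := by
        conv_lhs => rw [← hu1, List.map_map]
        rfl
      have e' : L'.map Prod.snd = (L.zip L').map fun q => q.2.2 := by
        conv_lhs => rw [← hu2, List.map_map]
        rfl
      rw [k2, e, e']
      exact List.map_inj_left.symm
  · intro hsz
    simp only [Test.eval, g1, g2, decide_eq_false_iff_not] at hsz
    refine Ends.simple_le rfl (by simp [cost]) ?_
    simp only [Cmd.eval, Mem.setVar_var, if_true, g3]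
    refine iff_of_false (by simp) fun e => hsz ?_
    simpa using congrArg List.length e

/-- The comparison assigns only to variables common to both trees. -/
theorem compare_view (b : ℕ) (hb : b < 2) {s s' : Mem}
    (hu : Unchanged (compare l l') s s') : view (reg b) s' = view (reg b) s := by
  have hv : ∀ x, x % 6 < 4 → (compare l l').writesVar x = false := by
    intro x hx
    have h : ∀ y, 4 ≤ y % 6 → (x == y) = false := fun y hy => by
      simp only [beq_eq_false_iff_ne]
      rintro rfl
      omega
    simp [compare, compareSlices, block, writesVar, h]
  refine Mem.ext' (fun x => hu.var _ (hv _ ?_)) fun a => hu.arr _ ?_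
  · simp only [reg]
    omega
  · simp [compare, compareSlices, block, writesArr]

end Compare

end AHU

namespace AHU

open Cmd

/-! ### The whole program -/

/-! ### Running times with recorded stages -/

section Traces

variable {σ : Type*} (R : Mem → σ → Prop)

/-- `c` takes `s` within `N` steps to a memory that satisfies `Q`; the memories at the commands
`skip` match the list `l`. -/
def Traces (c : Cmd) (s : Mem) (N : ℕ) (l : List σ) (Q : Mem → Prop) : Prop :=
  ∃ t ≤ N, ∃ τ s', Exec c s t τ s' ∧ List.Forall₂ R τ l ∧ Q s'

variable {R} {c d : Cmd} {s : Mem} {N N' M : ℕ} {l l' : List σ} {P Q : Mem → Prop}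

theorem Ends.traces (h : Ends c s N Q) : Traces R c s N [] Q := by
  obtain ⟨t, ht, s', he, hQ⟩ := h
  exact ⟨t, ht, [], s', he, .nil, hQ⟩

theorem traces_skip {x : σ} (h : R s x) : Traces R .skip s 1 [x] (· = s) :=
  ⟨1, le_rfl, [s], s, .skip s, .cons h .nil, rfl⟩

theorem Traces.mono (h : Traces R c s N l P) (hN : N ≤ M) (hQ : ∀ s', P s' → Q s') :
    Traces R c s M l Q := by
  obtain ⟨t, ht, τ, s', h1, hτ, hP⟩ := h
  exact ⟨t, ht.trans hN, τ, s', h1, hτ, hQ s' hP⟩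

theorem Traces.seq (h : Traces R c s N l P) (h' : ∀ s₁, P s₁ → Traces R d s₁ N' l' Q)
    (hM : N + N' + 1 ≤ M) : Traces R (.seq c d) s M (l ++ l') Q := by
  obtain ⟨t, ht, τ, s₁, h1, hτ, hR⟩ := h
  obtain ⟨t', ht', τ', s₂, h2, hτ', hQ⟩ := h' s₁ hR
  exact ⟨t + t' + 1, by omega, τ ++ τ', s₂, .seq h1 h2, List.rel_append hτ hτ', hQ⟩

theorem Traces.ite {b : Test} (h : Traces R (if b.eval s then c else d) s N l Q)
    (hM : N + 1 ≤ M) : Traces R (.ite b c d) s M l Q := by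
  obtain ⟨t, ht, τ, s', h1, hτ, hQ⟩ := h
  exact ⟨t + 1, by omega, τ, s', .ite h1, hτ, hQ⟩

theorem Traces.loop_true {b : Test} (hb : b.eval s = true) (h : Traces R c s N l P)
    (h' : ∀ s₁, P s₁ → Traces R (.loop b c) s₁ N' l' Q) (hM : N + N' + 1 ≤ M) :
    Traces R (.loop b c) s M (l ++ l') Q := by
  obtain ⟨t, ht, τ, s₁, h1, hτ, hR⟩ := h
  obtain ⟨t', ht', τ', s₂, h2, hτ', hQ⟩ := h' s₁ hR
  exact ⟨t + t' + 1, by omega, τ ++ τ', s₂, .loop_true hb h1 h2, List.rel_append hτ hτ', hQ⟩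

theorem Traces.loop_false {b : Test} (hb : b.eval s = false) (hQ : Q s) :
    Traces R (.loop b c) s 1 [] Q :=
  ⟨1, le_rfl, [], s, .loop_false hb, .nil, hQ⟩

end Traces

section Program

/-- Go on to the next level. -/
def advance : Cmd := .seq (both condense) (.seq .skip (both (.succ vLevel)))

/-- One iteration. -/
def iteration : Cmd :=
  .seq (both create) (.seq .skip (.seq (both lexSort) (.seq .skip
    (.seq (compare (treeLayout.rename (reg 0)) (treeLayout.rename (reg 1)))
      (.ite (.eq cFlag cOne) advance (block [.const cOk 0, .const cBound 0]))))))

/-- The iterations. -/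
def iterations : Cmd := .loop (.lt (reg 0 vLevel) cBound) iteration

/-- The program. -/
def program : Cmd :=
  .seq (both preprocess) (.seq .skip
    (.seq (.ite (.eq (reg 0 vHeight) (reg 1 vHeight))
        (.seq (block [.copy cBound (reg 0 vHeight), .succ cBound, .const cOk 1, .const cOne 1])
          iterations)
        (.const cOk 0))
      (.copy 0 cOk)))

variable {n n' : ℕ} {T : RTree (Fin n)} {T' : RTree (Fin n')} (A : AdjLists T.graph)
  (A' : AdjLists T'.graph)

/-- What the memory holds at a stage of the execution. -/
def AtStage (s : Mem) (x : Stage (Fin n) (Fin n')) : Prop :=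
  HoldsStage (bfsLevels A) (bfsLevels A') (treeLayout.rename (reg 0)) (treeLayout.rename (reg 1))
    (reg 0 vLevel) s x

variable {A A'} {i : ℕ} {K : List (Fin n × ℕ)} {K' : List (Fin n' × ℕ)}

theorem length_created (hK : IsLevelList T i K) (hi : i ≤ T.height) (lv : LevelLists T) :
    (created lv i K).length = (lv.list i).length := by
  refine List.Perm.length_eq ((List.perm_ext_iff_of_nodup (nodup_created lv i K) (lv.nodup i)).2 ?_)
  intro v
  rw [hK.mem_created lv hi, lv.mem_iff]

theorem length_sortedLabels (hK : IsLevelList T i K) (hi : i ≤ T.height) :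
    (sortedLabels A i K).length = ((bfsLevels A).list i).length := by
  rw [← length_created hK hi, ← (map_fst_perm_created (sortedLabels_perm A i K)).length_eq,
    List.length_map]

theorem length_condense (hK : IsLevelList T i K) (hi : i ≤ T.height) :
    (condenseLabels (sortedLabels A i K)).length = ((bfsLevels A).list i).length := by
  have hs : (sortedLabels A i K).Pairwise fun a b => a.2 ≤ b.2 := (stableSort _).sorted _
  rw [← length_sortedLabels hK hi, ← List.length_map (f := Prod.fst),
    condenseLabels_map_fst hs, List.length_map]

/-- Each vertex of the level below contributes one entry, to the label of its parent. -/
theorem sum_length_lab (hK : IsLevelList T i K) (hi : i ≤ T.height) :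
    ((sortedLabels A i K).map fun q => q.2.length).sum = K.length := by
  classical
  rw [((sortedLabels_perm A i K).map _).sum_eq, createLabels_eq_created, List.map_map]
  have := (flatMap_filter_perm (fun q : Fin n × ℕ => T.parent q.1) (O := K)
    (List.Nodup.of_map _ hK.nodup) (nodup_created (bfsLevels A) i K) fun q hq =>
      (hK.mem_created (bfsLevels A) hi _).2 (hK.isChild hi hq).2).length_eq
  rw [List.length_flatMap] at this
  rw [← this]
  refine congrArg List.sum (List.map_congr_left fun v _ => ?_)
  simp only [Function.comp_apply, lab, List.length_map]
  congr!

theorem create_atStage {s : Mem} (hK : IsLevelList T i K) (hi : i ≤ T.height)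
    (h : Created A i K s) :
    treeLayout.HoldsTuples s (createLabels T K ((bfsLevels A).list i)) := by
  rw [createLabels_eq_created]
  exact h.labelled.holdsTuples h.base.prepared.adj fun v hv =>
    ((hK.mem_created _ hi v).1 hv).ge

theorem sorted_atStage {s : Mem} (hK : IsLevelList T i K) (hi : i ≤ T.height)
    (h : SortedState A i K s) : treeLayout.HoldsTuples s (sortedLabels A i K) := by
  rw [← map_lab_sortedLabels A i K]
  refine h.labelled.holdsTuples h.base.prepared.adj fun v hv => ?_
  rw [(map_fst_perm_created (sortedLabels_perm A i K)).mem_iff] at hv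
  exact ((hK.mem_created _ hi v).1 hv).ge

/-- The stage is recorded between condensing and the increase of the level variable, while this
variable still has the value `i`. -/
theorem advance_traces {s : Mem} (hi : i ≤ T.height) (hi' : i ≤ T'.height)
    (hK : IsLevelList T i K) (hK' : IsLevelList T' i K')
    (h : SortedState A i K (view (reg 0) s)) (h' : SortedState A' i K' (view (reg 1) s)) :
    Traces (AtStage A A') advance s
      (13 * (((bfsLevels A).list i).length + ((bfsLevels A').list i).length) + 25)
      [.condensed i (condenseLabels (sortedLabels A i K)) (condenseLabels (sortedLabels A' i K'))]
      fun s' => (LoopInv A (i + 1) (condenseLabels (sortedLabels A i K)) (view (reg 0) s') ∧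
        LoopInv A' (i + 1) (condenseLabels (sortedLabels A' i K')) (view (reg 1) s')) ∧
        AgreeCommon s s' := by
  refine Traces.seq (l := [])
    ((condense_spec hi hK h).both (condense_spec hi' hK' h')).traces (N' := 5) ?_ ?_
  · rintro s₁ ⟨⟨h1, h1'⟩, g1⟩
    have hst : AtStage A A' s₁ (.condensed i _ _) := ⟨h1.level, h1.ints, h1'.ints⟩
    refine Traces.seq (l' := []) (traces_skip hst) (N' := 3) ?_ le_rfl
    rintro s₁ rfl
    have e : ∀ (b : ℕ) (L : Mem → Prop), (view (reg b) s₁).var vLevel = i →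
        L ((view (reg b) s₁).setVar vLevel (i + 1)) →
        Ends (.succ vLevel) (view (reg b) s₁) 1 L := by
      intro b L hl hL
      refine Ends.simple_le rfl le_rfl ?_
      rwa [Cmd.eval, hl]
    refine ((e 0 _ h1.level h1.next).both (e 1 _ h1'.level h1'.next)).traces.mono le_rfl ?_
    rintro s₂ ⟨h2, g2⟩
    exact ⟨h2, fun x hx => (g2 x hx).trans (g1 x hx)⟩
  · rw [length_created hK hi, length_created hK' hi']
    omega

/-- The state before an iteration that will be carried out. -/
structure Ready (A : AdjLists T.graph) (A' : AdjLists T'.graph) (h i : ℕ) (K : List (Fin n × ℕ))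
    (K' : List (Fin n' × ℕ)) (s : Mem) : Prop where
  inv : LoopInv A i K (view (reg 0) s)
  inv' : LoopInv A' i K' (view (reg 1) s)
  bound : s.var cBound = h + 1
  ok : s.var cOk = 1
  one : s.var cOne = 1

-- Each of the subroutines is linear in the lengths of `K`, `K'` and of the lists of level `i`. For
-- the comparison this uses `sum_length_lab`.
open Classical in
theorem iteration_traces {s : Mem} {h : ℕ} (hi : i ≤ T.height) (hi' : i ≤ T'.height)
    (hK : IsLevelList T i K) (hK' : IsLevelList T' i K') (hs : Ready A A' h i K K' s) :
    Traces (AtStage A A') iteration s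
      (113 * (K.length + K'.length) +
        86 * (((bfsLevels A).list i).length + ((bfsLevels A').list i).length) + 187)
      (.created i (createLabels T K ((bfsLevels A).list i))
          (createLabels T' K' ((bfsLevels A').list i)) ::
        .sorted i (sortedLabels A i K) (sortedLabels A' i K') ::
        if (sortedLabels A i K).map Prod.snd = (sortedLabels A' i K').map Prod.snd then
          [.condensed i (condenseLabels (sortedLabels A i K))
            (condenseLabels (sortedLabels A' i K'))]
        else [])
      fun s' =>
        if (sortedLabels A i K).map Prod.snd = (sortedLabels A' i K').map Prod.snd then
          Ready A A' h (i + 1) (condenseLabels (sortedLabels A i K))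
            (condenseLabels (sortedLabels A' i K')) s'
        else s'.var cOk = 0 ∧ s'.var cBound = 0 := by
  obtain ⟨h0, h0', hb, hok, hone⟩ := hs
  generalize hrest :
    (if (sortedLabels A i K).map Prod.snd = (sortedLabels A' i K').map Prod.snd then
    [Stage.condensed i (condenseLabels (sortedLabels A i K))
      (condenseLabels (sortedLabels A' i K'))] else []) = rest
  have hl := length_created hK hi (bfsLevels A)
  have hl' := length_created hK' hi' (bfsLevels A')
  refine Traces.seq (l := []) ((create_spec hi hK h0).both (create_spec hi' hK' h0')).traces
    (N' := 71 * (K.length + K'.length) +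
        60 * (((bfsLevels A).list i).length + ((bfsLevels A').list i).length) + 141) ?_ (by omega)
  rintro s₁ ⟨⟨h1, h1'⟩, g1⟩
  have hst : AtStage A A' s₁ (.created i _ _) :=
    ⟨h1.base.level, create_atStage hK hi h1, create_atStage hK' hi' h1'⟩
  refine Traces.seq (l := [_]) (traces_skip hst) (N' := 71 * (K.length + K'.length) +
        60 * (((bfsLevels A).list i).length + ((bfsLevels A').list i).length) + 139) ?_ (by omega)
  rintro _ rfl
  refine Traces.seq (l := []) ((lexSort_spec hi hK h1).both (lexSort_spec hi' hK' h1')).traces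
    (N' := 13 * (K.length + K'.length) +
        30 * (((bfsLevels A).list i).length + ((bfsLevels A').list i).length) + 39) ?_ (by omega)
  rintro s₂ ⟨⟨h2, h2'⟩, g2⟩
  have ht := sorted_atStage hK hi h2
  have ht' := sorted_atStage hK' hi' h2'
  have hst : AtStage A A' s₂ (.sorted i _ _) := ⟨h2.base.level, ht, ht'⟩
  refine Traces.seq (l := [_]) (traces_skip hst) (N' := 13 * (K.length + K'.length) +
        30 * (((bfsLevels A).list i).length + ((bfsLevels A').list i).length) + 37) ?_ (by omega)
  rintro _ rfl
  have hsum := sum_length_lab (A := A) hK hi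
  have hlen := length_sortedLabels (A := A) hK hi
  refine Traces.seq (l := []) (compare_spec (by decide) (by decide)
    (Layout.holdsTuples_rename ht) (Layout.holdsTuples_rename ht')).traces
    (N' := 13 * (((bfsLevels A).list i).length + ((bfsLevels A').list i).length) + 26) ?_ (by omega)
  rintro s₃ ⟨hflag, g3⟩
  have hcommon : ∀ x, 4 ≤ x % 6 →
      (compare (treeLayout.rename (reg 0)) (treeLayout.rename (reg 1))).writesVar x = false →
      s₃.var x = s.var x := fun x hx hc => by
    rw [g3.var x hc, g2 x hx, g1 x hx]
  have hone₃ := (hcommon cOne (by decide) (by decide)).trans hone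
  rw [← compare_view 0 (by decide) g3] at h2
  rw [← compare_view 1 (by decide) g3] at h2'
  refine Traces.ite (N := 13 * (((bfsLevels A).list i).length +
    ((bfsLevels A').list i).length) + 25) ?_ (by omega)
  simp only [Test.eval, hone₃, decide_eq_true_eq, hflag]
  rw [← hrest]
  split_ifs with heq
  · refine (advance_traces hi hi' hK hK' h2 h2').mono le_rfl ?_
    rintro s₄ ⟨⟨h4, h4'⟩, g4⟩
    refine ⟨h4, h4', ?_, ?_, ?_⟩
    · rw [g4 _ (by decide), hcommon _ (by decide) (by decide), hb]
    · rw [g4 _ (by decide), hcommon _ (by decide) (by decide), hok]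
    · rw [g4 _ (by decide), hone₃]
  -- After a mismatch the bound is `0`, which stops the loop in `iterations`.
  · refine (Ends.simple_le rfl ?_ ?_).traces
    · simp [block, cost]
    · simp [block, Cmd.eval]

/-- The list `K` of the next iteration has the length of level `i`, so its cost of `113` per pair is
charged to that level, which makes `199 = 113 + 86` per vertex. The number `189` covers the constant
cost of an iteration and the loop tests. -/
theorem iterations_traces (hh : T.height = T'.height) (k : ℕ) :
    ∀ (i : ℕ) (K : List (Fin n × ℕ)) (K' : List (Fin n' × ℕ)) (s : Mem), i + k = T.height + 1 →
      IsLevelList T i K → IsLevelList T' i K' → Ready A A' T.height i K K' s →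
      Traces (AtStage A A') iterations s
        (113 * (K.length + K'.length) + ∑ j ∈ Finset.range k,
          (199 * (((bfsLevels A).list (i + j)).length + ((bfsLevels A').list (i + j)).length) +
            189) + 1)
        (loop T T' (bfsLevels A) (bfsLevels A') (stableSort _) (stableSort _) k i K K').1
        fun s' => s'.var cOk =
          (loop T T' (bfsLevels A) (bfsLevels A') (stableSort _) (stableSort _) k i K
            K').2.toNat := by
  induction k with
  | zero =>
    intro i K K' s hk hK hK' hs
    refine (Traces.loop_false ?_ hs.ok).mono (by omega) fun _ h => h
    have : s.var (reg 0 vLevel) = i := hs.inv.base.level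
    simp only [Test.eval, this, hs.bound, decide_eq_false_iff_not]
    omega
  | succ k ih =>
    intro i K K' s hk hK hK' hs
    have hi : i ≤ T.height := by omega
    have hi' : i ≤ T'.height := by omega
    have hlev : s.var (reg 0 vLevel) = i := hs.inv.base.level
    have hit := iteration_traces hi hi' hK hK' hs
    have hloop := loop_succ (T := T) (T' := T') (lv := bfsLevels A) (lv' := bfsLevels A')
      (ls := stableSort _) (ls' := stableSort _) k i K K'
    simp only at hloop
    change _ = if (sortedLabels A i K).map Prod.snd = (sortedLabels A' i K').map Prod.snd then _
      else _ at hloop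
    rw [hloop, Finset.sum_range_succ']
    have htest : (Test.lt (reg 0 vLevel) cBound).eval s = true := by
      simp only [Test.eval, hlev, hs.bound, decide_eq_true_eq]
      omega
    by_cases heq : (sortedLabels A i K).map Prod.snd = (sortedLabels A' i K').map Prod.snd
    · simp only [if_pos heq] at hit ⊢
      refine Traces.loop_true (l := [_, _, _]) htest hit (fun s₁ hs₁ => ih (i + 1) _ _ s₁ (by omega)
        (hK.condense hi (sortedLabels_perm A i K) ((stableSort _).sorted _))
        (hK'.condense hi' (sortedLabels_perm A' i K') ((stableSort _).sorted _)) hs₁) ?_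
      have e := length_condense (A := A) hK hi
      have e' := length_condense (A := A') hK' hi'
      rw [sortedLabels] at e e'
      rw [e, e']
      simp only [add_zero, show ∀ j, i + 1 + j = i + (j + 1) by intro j; omega]
      omega
    · simp only [if_neg heq] at hit ⊢
      refine Traces.loop_true (l := [_, _]) (l' := []) htest hit (N' := 1) (fun s₁ hs₁ => ?_) ?_
      · refine Traces.loop_false ?_ hs₁.1
        simp [Test.eval, hs₁.2]
      · simp only [add_zero]
        omega

end Program

end AHU

namespace AHU

open Cmd

/-! ### The initial memory -/

section Input

open Layout

variable {n n' : ℕ} {T : RTree (Fin n)} {T' : RTree (Fin n')} {A : AdjLists T.graph}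
  {A' : AdjLists T'.graph}

/-- The input for one tree. -/
structure HoldsInput (A : AdjLists T.graph) (s : Mem) : Prop where
  root : s.var vRoot = T.root
  off : ∀ i, s.arr aOff i = A.offsets.getD i 0
  flat : ∀ i, s.arr aFlat i = A.flat.getD i 0
  var : ∀ x ≥ 2, s.var x = 0
  arr : ∀ a ≥ 2, ∀ x, s.arr a x = 0

theorem HoldsInput.holdsAdj {s : Mem} (h : HoldsInput A s) : HoldsAdj A s := by
  constructor
  · intro i hi
    rw [h.off, AdjLists.offsets, List.getD_eq_getElem?_getD, List.getElem?_map,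
      List.getElem?_range (by omega)]
    rfl
  · intro u j hj
    rw [List.length_map] at hj
    rw [h.flat, List.getD_eq_getElem?_getD, A.flat_getElem? u j hj]
    simp

/-- The arrays that preprocessing does not touch are still zero, and zero is the initial value
required of marks, lengths and unused nodes. -/
theorem HoldsInput.loopInv {s : Mem} (h : HoldsInput A s) :
    Ends preprocess s (91 * n) (LoopInv A 0 []) := by
  refine (preprocess_spec h.holdsAdj h.root h.var).mono le_rfl ?_
  rintro s' ⟨⟨h1, h2, h3⟩, hu⟩
  have hz : ∀ a ≥ 2, preprocess.writesArr a = false → ∀ x, s'.arr a x = 0 := fun a ha hw x => by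
    rw [hu.arr a hw, h.arr a ha]
  refine ⟨⟨h1, ?_, ?_⟩, ⟨?_, ?_, ?_, ?_⟩, ⟨?_, isSlice_nil _ _ _, by simp⟩, ?_, ?_, fun v _ => h3 v⟩
  · exact (hu.var vLevel (by decide)).trans (h.var _ (by decide))
  · exact (hu.var vZero (by decide)).trans (h.var _ (by decide))
  · rw [h2]
  · exact fun u _ => hz _ (by decide) (by decide) u
  · exact fun u _ => hz _ (by decide) (by decide) u
  · exact fun u _ => hz _ (by decide) (by decide) u
  · exact (hu.var vSize (by decide)).trans (h.var _ (by decide))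
  · exact fun v _ => hz _ (by decide) (by decide) v
  · exact fun v _ => hz _ (by decide) (by decide) v

theorem inputMem_var_eq_zero {x : ℕ} (hx : 4 ≤ x) : (inputMem T T' A A').var x = 0 :=
  List.getD_eq_default _ _ (by simpa using hx)

theorem inputMem_arr_eq_zero {a : ℕ} (ha : 4 ≤ a) (x : ℕ) : (inputMem T T' A A').arr a x = 0 := by
  change ([A.offsets, A.flat, A'.offsets, A'.flat].getD a []).getD x 0 = 0
  rw [List.getD_eq_default (l := [A.offsets, A.flat, A'.offsets, A'.flat]) _ (by simpa using ha)]
  rfl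

theorem le_reg (b : ℕ) {x : ℕ} (hx : 2 ≤ x) : 4 ≤ reg b x := by
  simp only [reg]
  omega

/-- The renamings send the registers `0` and `1` to `0`, `1` for the first tree and to `2`, `3` for
the second, which is where the input is stored; all other registers go to places that are initially
zero. -/
theorem holdsInput_fst : HoldsInput A (view (reg 0) (inputMem T T' A A')) :=
  ⟨rfl, fun _ => rfl, fun _ => rfl, fun _ hx =>
      inputMem_var_eq_zero (A := A) (A' := A') (le_reg 0 hx),
    fun _ ha => inputMem_arr_eq_zero (A := A) (A' := A') (le_reg 0 ha)⟩

theorem holdsInput_snd : HoldsInput A' (view (reg 1) (inputMem T T' A A')) :=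
  ⟨rfl, fun _ => rfl, fun _ => rfl, fun _ hx =>
      inputMem_var_eq_zero (A := A) (A' := A') (le_reg 1 hx),
    fun _ ha => inputMem_arr_eq_zero (A := A) (A' := A') (le_reg 1 ha)⟩

end Input

/-! ### Linear running time -/

section Main

variable {n n' : ℕ} {T : RTree (Fin n)} {T' : RTree (Fin n')}

theorem LevelLists.sum_length (lv : LevelLists T) :
    ∑ j ∈ Finset.range (T.height + 1), (lv.list j).length = n := by
  classical
  have h := Finset.card_eq_sum_card_fiberwise (s := (Finset.univ : Finset (Fin n)))
    (t := Finset.range (T.height + 1)) (f := T.level) fun v _ => by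
      have : T.level v ≤ T.height := Nat.sub_le _ _
      simpa using Nat.lt_succ_of_le this
  rw [Finset.card_univ, Fintype.card_fin] at h
  refine Eq.trans (Finset.sum_congr rfl fun j _ => ?_) h.symm
  rw [← List.toFinset_card_of_nodup (lv.nodup j)]
  congr 1
  ext v
  simp [lv.mem_iff]

variable (A : AdjLists T.graph) (A' : AdjLists T'.graph)

/-- Preprocessing costs `91` per vertex and the iterations `199` per vertex and `189` per level.
There are at most `n` levels when the heights agree, and both orders are positive, so `500 * (n +
n')` absorbs the remaining constants. -/
theorem program_traces :
    Traces (AtStage A A') program (inputMem T T' A A') (500 * (n + n'))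
      (stages T T' (bfsLevels A) (bfsLevels A') (stableSort _) (stableSort _))
      fun s => s.var 0 =
        (output T T' (bfsLevels A) (bfsLevels A') (stableSort _) (stableSort _)).toNat := by
  have hn := height_lt A
  have hn' := height_lt A'
  have hstages : stages T T' (bfsLevels A) (bfsLevels A') (stableSort _) (stableSort _) =
      .preprocessed :: if T.height = T'.height then (loop T T' (bfsLevels A) (bfsLevels A')
        (stableSort _) (stableSort _) (T.height + 1) 0 [] []).1 else [] := by
    rw [stages, run]
    split_ifs <;> simp_all
  have hout : output T T' (bfsLevels A) (bfsLevels A') (stableSort _) (stableSort _) =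
      if T.height = T'.height then (loop T T' (bfsLevels A) (bfsLevels A')
        (stableSort _) (stableSort _) (T.height + 1) 0 [] []).2 else false := by
    rw [output, run]
    split_ifs <;> simp_all
  rw [hstages, hout]
  generalize hrest : (if T.height = T'.height then (loop T T' (bfsLevels A) (bfsLevels A')
    (stableSort _) (stableSort _) (T.height + 1) 0 [] []).1 else []) = rest
  refine Traces.seq (l := []) (holdsInput_fst.loopInv.both holdsInput_snd.loopInv).traces
    (N' := 199 * (n + n') + 189 * n + 16) ?_ (by omega)
  rintro s₁ ⟨⟨h1, h1'⟩, -⟩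
  have hst : AtStage A A' s₁ .preprocessed := ⟨h1.base.prepared.levels, h1'.base.prepared.levels⟩
  refine Traces.seq (l := [_]) (traces_skip hst) (N' := 199 * (n + n') + 189 * n + 13) ?_ (by omega)
  rintro s₁ rfl
  rw [← List.append_nil rest]
  refine Traces.seq (N := 199 * (n + n') + 189 * n + 11) (N' := 1) (P := fun s => s.var cOk =
    (if T.height = T'.height then (loop T T' (bfsLevels A) (bfsLevels A') (stableSort _)
      (stableSort _) (T.height + 1) 0 [] []).2 else false).toNat) ?_ ?_ (by omega)
  · refine Traces.ite (N := 199 * (n + n') + 189 * n + 10) ?_ (by omega)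
    have e : s₁.var (reg 0 vHeight) = T.height := h1.base.prepared.levels.1
    have e' : s₁.var (reg 1 vHeight) = T'.height := h1'.base.prepared.levels.1
    simp only [Test.eval, e, e', decide_eq_true_eq]
    rw [← hrest]
    split_ifs with hh
    · refine Traces.seq (l := []) (N := 7) (N' := 199 * (n + n') + 189 * n + 2)
        (P := Ready A A' T.height 0 [] []) (Ends.simple_le rfl le_rfl ?_).traces ?_ (by omega)
      · have hv : ∀ b, b < 2 → view (reg b) ((block [.copy cBound (reg 0 vHeight), .succ cBound,
            .const cOk 1, .const cOne 1]).eval s₁) = view (reg b) s₁ := by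
          intro b hb
          refine Mem.ext' (fun x => ?_) fun _ => rfl
          have : ∀ y, 4 ≤ y % 6 → reg b x ≠ y := by
            rintro _ h rfl
            simp only [reg] at h
            omega
          simp [view, block, Cmd.eval, this]
        refine ⟨by rwa [hv 0 (by decide)], by rwa [hv 1 (by decide)], ?_, ?_, ?_⟩
        all_goals simp [block, Cmd.eval, e]
      · intro s₂ h2
        refine (iterations_traces hh (T.height + 1) 0 [] [] s₂ (by omega) isLevelList_nil
          isLevelList_nil h2).mono ?_ fun _ h => h
        have hs := (bfsLevels A).sum_length
        have hs' := (bfsLevels A').sum_length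
        rw [← hh] at hs'
        simp only [zero_add, Finset.sum_add_distrib, ← Finset.mul_sum, hs, hs',
          Finset.sum_const, Finset.card_range, smul_eq_mul, List.length_nil]
        omega
    · exact (Ends.simple_le rfl (by simp [cost]) (by simp [Cmd.eval])).traces
  · intro s₂ h2
    refine (Ends.simple_le rfl le_rfl ?_).traces
    simpa [Cmd.eval] using h2

/-- The times at which the machine reaches a `skip` serve as `τ`. -/
theorem program_executes :
    Executes program (treeLayout.rename (reg 0)) (treeLayout.rename (reg 1)) (reg 0 vLevel) T T'
      A A' (500 * (n + n')) := by
  obtain ⟨t, ht, τ, s', he, hτ, hQ⟩ := program_traces A A'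
  obtain ⟨h1, ts, h2, h3, h4⟩ := he.passes []
  have hlen := h4.length_eq.trans hτ.length_eq
  refine ⟨bfsLevels A, bfsLevels A', stableSort _, stableSort _, t,
    fun i => ts.get (i.cast hlen.symm), ht, ?_, ?_, ?_, ?_⟩
  · rw [after, h1]
  · rw [after, h1]
    exact hQ
  · intro i j hij
    exact List.pairwise_iff_get.1 h2 _ _ hij
  · intro i
    refine ⟨(h3 _ (List.get_mem _ _)).le, ?_⟩
    have e1 := (List.forall₂_iff_get.1 h4).2 i (by rw [hlen]; exact i.2)
      (by rw [hτ.length_eq]; exact i.2)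
    have e2 := (List.forall₂_iff_get.1 hτ).2 i (by rw [hτ.length_eq]; exact i.2) i.2
    rw [← e1] at e2
    exact e2

end Main

end AHU

theorem mainTheorem2 :
    (∀ {V : Type*} {V' : Type*} [Fintype V] [Fintype V'] (T : AHU.RTree V) (T' : AHU.RTree V')
      (lv : AHU.LevelLists T) (lv' : AHU.LevelLists T')
      (ls : AHU.LexSort V) (ls' : AHU.LexSort V'),
      AHU.output T T' lv lv' ls ls' = true ↔ AHU.Isomorphic T T') ∧
    (∃ (P : AHU.Cmd) (l l' : AHU.Layout) (x C : ℕ),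
      ∀ (n n' : ℕ) (T : AHU.RTree (Fin n)) (T' : AHU.RTree (Fin n'))
        (A : AHU.AdjLists T.graph) (A' : AHU.AdjLists T'.graph),
        AHU.Executes P l l' x T T' A A' (C * (n + n'))) :=
  ⟨fun _ _ lv lv' ls ls' => AHU.output_eq_true_iff lv lv' ls ls',
    AHU.program, _, _, _, 500, fun _ _ _ _ A A' => AHU.program_executes A A'⟩
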